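/- Let $\Omega\subset\mathbb R^n$, $n\ge 1$, be a bounded Lipschitz domain, let $A$ be a symmetric, uniformly elliptic, uniformly Lipschitz matrix field on $\Omega$, and put $a(u,v)=\int_\Omega A\nabla u\cdot\nabla v$, $|u|_a^2=a(u,u)$. Here $H^{-1}(\Omega)$ denotes the dual of $H^1(\Omega)$, and $H^{1+s}(\Omega)$ is the Sobolev–Slobodeckij space. Let $\mathcal T_h$ be a conforming simplicial mesh (affine cells) or quadrilateral/cuboidal mesh (multilinear cells) covering $\overline\Omega$, with $h=\max_{K\in\mathcal T_h}\operatorname{diam}K$, which is shape-regular and quasi-uniform with constant $\kappa$, that is, the map $F_K$ of the reference cell onto $K$ satisfies $\operatorname{diam}K\,|x-y|\le\kappa|F_K(x)-F_K(y)|$, and $h\le\kappa\operatorname{diam}K$, for every cell $K$. Let $V_h\subset H^1(\Omega)$ be the corresponding conforming Lagrange finite element space of degree $k$ ($P_k$ on simplices, $Q_k$ on cuboidal cells, in reference coordinates), and let $0<s\le k$. Let $Y$ be a real Hilbert space and $L_H:H^1(\Omega)\to Y$ a bounded linear map with $\|L_Hv\|_Y^2\le C_S\|v\|_{L^2(\Omega)}^2$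 for all $v\in H^1(\Omega)$. Let $\mu>0$, $T>0$, $f\in L^2(0,T;H^{-1}(\Omega))$, $g\in L^2(0,T;H^{-1/2}(\partial\Omega))$, $\nu_0\in L^2(\Omega)$, and let $\nu,u\in L^2(0,T;H^1(\Omega))\cap H^1(0,T;H^{-1}(\Omega))$ and $u_h\in H^1(0,T;V_h)$ satisfy, for almost every $t\in(0,T)$, $$\langle\partial_t\nu,v\rangle+a(\nu,v)=\langle f,v\rangle+\langle g,v\rangle_\partial\quad\forall v\in H^1(\Omega),\qquad \nu(0)=\nu_0,$$ $$\langle\partial_tu,v\rangle+a(u,v)+\mu(L_Hu-L_H\nu,L_Hv)_Y=\langle f,v\rangle+\langle g,v\rangle_\partial\quad\forall v\in H^1(\Omega),\qquad u(0)=0,$$ $$(\partial_tu_h,v_h)+a(u_h,v_h)+\mu(L_Hu_h-L_H\nu,L_Hv_h)_Y=\langle f,v_h\rangle+\langle g,v_h\rangle_\partial\quad\forall v_h\in V_h,\qquad u_h(0)=0.$$ Assume that the nudged solution satisfies $u\in L^2(0,T;H^{1+s}(\Omega))$, and put $e_u=u_h-u$. Then, for all $t\in[0,T]$, $$\int_0^t|e_u|_a^2\,d\tau+\mu\int_0^t\|L_He_u\|_Y^2\,d\tau\le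 C\,h^{2s}(1+\mu h^2)\int_0^t\|u\|_{H^{1+s}(\Omega)}^2\,d\tau,$$ with a constant $C>0$ that depends only on $\Omega$ (and $n$), $A$, the type of the cells, $k$, $s$, $\kappa$ and $C_S$; in particular $C$ does not depend on $h$, the mesh, $\mu$, $T$, $t$, $Y$, $L_H$, $f$, $g$, $\nu_0$ or the solutions. -/

import Mathlib

open MeasureTheory Set
open scoped ENNReal InnerProductSpace

noncomputable section

namespace Nudging

open scoped ContDiff

/-! ### Domains -/

/-- The Euclidean space `ℝⁿ`. -/
abbrev Eu (n : ℕ) := EuclideanSpace ℝ (Fin n)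

/-- The `i`-th coordinate vector. -/
def coordVec {n : ℕ} (i : Fin n) : Eu n := EuclideanSpace.single i 1

/-- Bounded Lipschitz domain: bounded, open, connected, and near each boundary point, after a
choice of a "vertical" unit direction `e`, equal to the strict epigraph of a Lipschitz function
`γ` which does not depend on the vertical coordinate. -/
structure IsBoundedLipschitzDomain {n : ℕ} (Ω : Set (Eu n)) : Prop where
  isOpen : IsOpen Ω
  isConnected : IsConnected Ω
  isBounded : Bornology.IsBounded Ω
  lipschitz : ∀ x ∈ frontier Ω, ∃ (e : Eu n) (r : ℝ) (K : NNReal) (γ : Eu n → ℝ),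
    ‖e‖ = 1 ∧ 0 < r ∧ LipschitzWith K γ ∧ (∀ (y : Eu n) (τ : ℝ), γ (y + τ • e) = γ y) ∧
      ∀ y ∈ Metric.ball x r, y ∈ Ω ↔ γ y < ⟪e, y⟫_ℝ

/-! ### Sobolev spaces -/

/-- Real `L²(Ω)`. -/
abbrev L2 {n : ℕ} (Ω : Set (Eu n)) := Lp ℝ 2 (volume.restrict Ω)

/-- `L²(Ω; ℝⁿ)`. -/
abbrev L2vec {n : ℕ} (Ω : Set (Eu n)) := Lp (Eu n) 2 (volume.restrict Ω)

/-- Test functions: `φ ∈ C_c^∞(Ω)`. -/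
structure IsTest {n : ℕ} (Ω : Set (Eu n)) (φ : Eu n → ℝ) : Prop where
  smooth : ContDiff ℝ ∞ φ
  compact : HasCompactSupport φ
  support : tsupport φ ⊆ Ω

/-- `G` is the weak gradient of `u` in `Ω`. -/
def IsWeakGradient {n : ℕ} (Ω : Set (Eu n)) (u : L2 Ω) (G : L2vec Ω) : Prop :=
  ∀ φ : Eu n → ℝ, IsTest Ω φ → ∀ i : Fin n,
    ∫ x in Ω, u x * fderiv ℝ φ x (coordVec i) = - ∫ x in Ω, G x i * φ x

theorem IsTest.integrable_mul {n : ℕ} {Ω : Set (Eu n)} {φ : Eu n → ℝ} (hφ : IsTest Ω φ)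
    {u : Eu n → ℝ} (hu : MemLp u 2 (volume.restrict Ω)) :
    Integrable (fun x => u x * φ x) (volume.restrict Ω) :=
  hu.integrable_mul (q := 2)
    ((hφ.smooth.continuous.memLp_of_hasCompactSupport hφ.compact).restrict Ω)

theorem IsTest.integrable_mul_fderiv {n : ℕ} {Ω : Set (Eu n)} {φ : Eu n → ℝ} (hφ : IsTest Ω φ)
    {u : Eu n → ℝ} (hu : MemLp u 2 (volume.restrict Ω)) (v : Eu n) :
    Integrable (fun x => u x * fderiv ℝ φ x v) (volume.restrict Ω) := by
  refine hu.integrable_mul (q := 2) (MemLp.restrict Ω ?_)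
  have hc : Continuous (fun x => fderiv ℝ φ x v) :=
    (hφ.smooth.continuous_fderiv (by simp)).clm_apply continuous_const
  exact hc.memLp_of_hasCompactSupport (hφ.compact.fderiv_apply (𝕜 := ℝ) v)

theorem memLp_coord {n : ℕ} {Ω : Set (Eu n)} (G : L2vec Ω) (i : Fin n) :
    MemLp (fun x => G x i) 2 (volume.restrict Ω) :=
  (EuclideanSpace.proj (𝕜 := ℝ) i : Eu n →L[ℝ] ℝ).comp_memLp' (Lp.memLp G)

/-- The pairs `(u, ∇u)` with `u ∈ L²(Ω)` and weak gradient `∇u ∈ L²(Ω; ℝⁿ)`. -/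
def h1Submodule {n : ℕ} (Ω : Set (Eu n)) : Submodule ℝ (WithLp 2 (L2 Ω × L2vec Ω)) where
  carrier := {p | IsWeakGradient Ω p.fst p.snd}
  zero_mem' := by
    intro φ hφ i
    have h1 : ∫ x in Ω, (0 : L2 Ω) x * fderiv ℝ φ x (coordVec i) = 0 := by
      refine integral_eq_zero_of_ae ?_
      filter_upwards [Lp.coeFn_zero ℝ 2 (volume.restrict Ω)] with x hx
      rw [hx]
      simp
    have h2 : ∫ x in Ω, (0 : L2vec Ω) x i * φ x = 0 := by
      refine integral_eq_zero_of_ae ?_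
      filter_upwards [Lp.coeFn_zero (Eu n) 2 (volume.restrict Ω)] with x hx
      rw [hx]
      simp
    change ∫ x in Ω, (0 : L2 Ω) x * fderiv ℝ φ x (coordVec i)
      = - ∫ x in Ω, (0 : L2vec Ω) x i * φ x
    rw [h1, h2, neg_zero]
  add_mem' := by
    intro p q hp hq φ hφ i
    have h1 : ∫ x in Ω, (p.fst + q.fst) x * fderiv ℝ φ x (coordVec i)
        = (∫ x in Ω, p.fst x * fderiv ℝ φ x (coordVec i))
          + ∫ x in Ω, q.fst x * fderiv ℝ φ x (coordVec i) := by
      rw [← integral_add (hφ.integrable_mul_fderiv (Lp.memLp p.fst) _)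
        (hφ.integrable_mul_fderiv (Lp.memLp q.fst) _)]
      refine integral_congr_ae ?_
      filter_upwards [Lp.coeFn_add p.fst q.fst] with x hx
      rw [hx]
      simp [add_mul]
    have h2 : ∫ x in Ω, (p.snd + q.snd) x i * φ x
        = (∫ x in Ω, p.snd x i * φ x) + ∫ x in Ω, q.snd x i * φ x := by
      rw [← integral_add (hφ.integrable_mul (memLp_coord p.snd i))
        (hφ.integrable_mul (memLp_coord q.snd i))]
      refine integral_congr_ae ?_
      filter_upwards [Lp.coeFn_add p.snd q.snd] with x hx
      rw [hx]
      simp [add_mul]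
    change ∫ x in Ω, (p.fst + q.fst) x * fderiv ℝ φ x (coordVec i)
      = - ∫ x in Ω, (p.snd + q.snd) x i * φ x
    rw [h1, h2, hp φ hφ i, hq φ hφ i, neg_add]
  smul_mem' := by
    intro c p hp φ hφ i
    have h1 : ∫ x in Ω, (c • p.fst) x * fderiv ℝ φ x (coordVec i)
        = c * ∫ x in Ω, p.fst x * fderiv ℝ φ x (coordVec i) := by
      rw [← integral_const_mul]
      refine integral_congr_ae ?_
      filter_upwards [Lp.coeFn_smul c p.fst] with x hx
      rw [hx]
      simp [mul_assoc]
    have h2 : ∫ x in Ω, (c • p.snd) x i * φ x = c * ∫ x in Ω, p.snd x i * φ x := by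
      rw [← integral_const_mul]
      refine integral_congr_ae ?_
      filter_upwards [Lp.coeFn_smul c p.snd] with x hx
      rw [hx]
      simp [mul_assoc]
    change ∫ x in Ω, (c • p.fst) x * fderiv ℝ φ x (coordVec i)
      = - ∫ x in Ω, (c • p.snd) x i * φ x
    rw [h1, h2, hp φ hφ i, mul_neg]

/-- `H¹(Ω)`, with `‖u‖² = ‖u‖²_{L²} + ‖∇u‖²_{L²}` (a weak gradient is unique when `Ω` is open,
so a pair `(u, ∇u)` is the same as `u`). -/
abbrev H1 {n : ℕ} (Ω : Set (Eu n)) := ↥(h1Submodule Ω)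

/-- The inclusion `H¹(Ω) → L²(Ω)`. -/
def toL2 {n : ℕ} (Ω : Set (Eu n)) : H1 Ω →L[ℝ] L2 Ω :=
  (WithLp.fstL 2 ℝ (L2 Ω) (L2vec Ω)).comp (h1Submodule Ω).subtypeL

/-- The weak gradient `H¹(Ω) → L²(Ω; ℝⁿ)`. -/
def grad {n : ℕ} (Ω : Set (Eu n)) : H1 Ω →L[ℝ] L2vec Ω :=
  (WithLp.sndL 2 ℝ (L2 Ω) (L2vec Ω)).comp (h1Submodule Ω).subtypeL

/-- `g` is the weak partial derivative `∂_{I 0} ⋯ ∂_{I (m-1)} u` in `Ω`. -/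
def IsWeakPartial {n : ℕ} (Ω : Set (Eu n)) {m : ℕ} (I : Fin m → Fin n) (u g : L2 Ω) : Prop :=
  ∀ φ : Eu n → ℝ, IsTest Ω φ →
    ∫ x in Ω, u x * iteratedFDeriv ℝ m φ x (fun j => coordVec (I j))
      = (-1) ^ m * ∫ x in Ω, g x * φ x

/-- The square of the Sobolev–Slobodeckij norm of `H^r(Ω)`, `r = m + σ`, `m = ⌊r⌋`, `σ ∈ [0, 1)`:
`∑_{j ≤ m} ‖D^j u‖²_{L²}`, plus, if `σ > 0`,
`∬_{Ω×Ω} |D^m u(x) - D^m u(y)|² / |x - y|^{n + 2σ} dx dy`.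
It is `∞` if `u ∉ H^r(Ω)`; the infimum runs over the (at most one) choice of the weak derivatives
of order `≤ m`. -/
def sobolevSq {n : ℕ} (Ω : Set (Eu n)) (r : ℝ) (u : L2 Ω) : ℝ≥0∞ :=
  ⨅ (D : (j : ℕ) → (Fin j → Fin n) → L2 Ω)
    (_ : ∀ j ≤ ⌊r⌋₊, ∀ I : Fin j → Fin n, IsWeakPartial Ω I u (D j I)),
    (∑ j ∈ Finset.range (⌊r⌋₊ + 1), ∑ I : Fin j → Fin n, ‖D j I‖ₑ ^ 2)
      + open Classical in if Int.fract r = 0 then 0 else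
          ∑ I : Fin ⌊r⌋₊ → Fin n, ∫⁻ x in Ω, ∫⁻ y in Ω,
            ENNReal.ofReal ((D ⌊r⌋₊ I x - D ⌊r⌋₊ I y) ^ 2
              / ‖x - y‖ ^ ((n : ℝ) + 2 * Int.fract r))

/-! ### Dual spaces -/

/-- `H^{-1}(Ω)`, the dual of `H¹(Ω)`. -/
abbrev HNeg1 {n : ℕ} (Ω : Set (Eu n)) := StrongDual ℝ (H1 Ω)

/-- The embedding `L²(Ω) → H^{-1}(Ω)`, `w ↦ (w, ·)`. -/
def pivot {n : ℕ} (Ω : Set (Eu n)) (w : L2 Ω) : HNeg1 Ω := (innerSL ℝ w).comp (toL2 Ω)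

/-- `H¹₀(Ω)`, the closure of the test functions in `H¹(Ω)`: the kernel of the trace. -/
def H10 {n : ℕ} (Ω : Set (Eu n)) : Submodule ℝ (H1 Ω) :=
  (Submodule.span ℝ {u : H1 Ω | ∃ φ : Eu n → ℝ, IsTest Ω φ ∧
    toL2 Ω u =ᵐ[volume.restrict Ω] φ}).topologicalClosure

/-- `H^{-1/2}(∂Ω)`: the dual of the trace space `H^{1/2}(∂Ω) = H¹(Ω) / H¹₀(Ω)`, that is, the
functionals on `H¹(Ω)` that see a function only through its trace. For `g` in this space,
`⟨g, v⟩_∂` is `g v`. -/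
def HNegHalfBdry {n : ℕ} (Ω : Set (Eu n)) : Submodule ℝ (HNeg1 Ω) where
  carrier := {g | ∀ v ∈ H10 Ω, g v = 0}
  zero_mem' := fun _ _ => rfl
  add_mem' := fun {a b} ha hb v hv => by simp [ha v hv, hb v hv]
  smul_mem' := fun c a ha v hv => by simp [ha v hv]

/-! ### The bilinear form -/

/-- Conductivity matrices: symmetric, uniformly elliptic, uniformly Lipschitz on `Ω`. A matrix is
identified with the linear map `ξ ↦ A x ξ`. -/
structure IsConductivity {n : ℕ} (Ω : Set (Eu n)) (A : Eu n → Eu n →L[ℝ] Eu n) : Prop where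
  symm : ∀ x ∈ Ω, ∀ ξ η : Eu n, ⟪A x ξ, η⟫_ℝ = ⟪ξ, A x η⟫_ℝ
  elliptic : ∃ α : ℝ, 0 < α ∧ ∀ x ∈ Ω, ∀ ξ : Eu n, α * ‖ξ‖ ^ 2 ≤ ⟪A x ξ, ξ⟫_ℝ
  lipschitz : ∃ K : NNReal, LipschitzOnWith K A Ω

/-- `a(u, v) = (A ∇u, ∇v)`. -/
def aForm {n : ℕ} (Ω : Set (Eu n)) (A : Eu n → Eu n →L[ℝ] Eu n) (u v : H1 Ω) : ℝ :=
  ∫ x in Ω, ⟪A x (grad Ω u x), grad Ω v x⟫_ℝ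

/-! ### Finite element spaces -/

/-- Simplicial or quadrilateral (in `ℝⁿ`: cuboidal) cells. -/
inductive CellShape
  | simplex
  | cube

/-- The reference cell: the unit simplex or the unit cube. -/
def refCell (n : ℕ) : CellShape → Set (Eu n)
  | .simplex => {x | (∀ i, 0 ≤ x i) ∧ ∑ i, x i ≤ 1}
  | .cube => {x | ∀ i, 0 ≤ x i ∧ x i ≤ 1}

/-- Polynomials on the reference cell: `P_k` (total degree at most `k`) on the simplex, `Q_k`
(degree at most `k` in each variable) on the cube. -/
def refPoly (n k : ℕ) : CellShape → Submodule ℝ (MvPolynomial (Fin n) ℝ)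
  | .simplex => MvPolynomial.restrictTotalDegree (Fin n) ℝ k
  | .cube => MvPolynomial.restrictDegree (Fin n) ℝ k

/-- The map `ℝⁿ → ℝⁿ` with the given polynomial components. -/
def polyMap {n : ℕ} (P : Fin n → MvPolynomial (Fin n) ℝ) (x : Eu n) : Eu n :=
  WithLp.toLp 2 (fun j => MvPolynomial.eval (fun i => x i) (P j))

/-- A finite conforming mesh of `Ω`. Each cell is the image of the reference cell under a `P_1`
(affine) resp. `Q_1` (multilinear) map; the cells cover `closure Ω`, have disjoint interiors, and
two of them meet in a common face (possibly empty), which the two cell maps parametrize in the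
same way up to an affine identification of the two reference faces. -/
structure Mesh {n : ℕ} (Ω : Set (Eu n)) (shape : CellShape) where
  /-- the number of cells -/
  card : ℕ
  /-- the components of the cell maps -/
  poly : Fin card → Fin n → MvPolynomial (Fin n) ℝ
  poly_mem : ∀ c j, poly c j ∈ refPoly n 1 shape
  cover : ⋃ c, polyMap (poly c) '' refCell n shape = closure Ω
  disjoint : ∀ c d, c ≠ d → Disjoint (polyMap (poly c) '' interior (refCell n shape))
    (polyMap (poly d) '' interior (refCell n shape))
  conforming : ∀ c d, ∃ (f g : Set (Eu n)) (B : Eu n ≃ᵃ[ℝ] Eu n),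
    IsExposed ℝ (refCell n shape) f ∧ IsExposed ℝ (refCell n shape) g ∧ B '' f = g ∧
      polyMap (poly c) '' refCell n shape ∩ polyMap (poly d) '' refCell n shape
        = polyMap (poly c) '' f ∧
      ∀ x ∈ f, polyMap (poly d) (B x) = polyMap (poly c) x

namespace Mesh

variable {n : ℕ} {Ω : Set (Eu n)} {shape : CellShape}

/-- The cell map `F_K`. -/
def map (M : Mesh Ω shape) (c : Fin M.card) : Eu n → Eu n := polyMap (M.poly c)

/-- The cell `K`. -/
def cell (M : Mesh Ω shape) (c : Fin M.card) : Set (Eu n) := M.map c '' refCell n shape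

/-- The mesh size `h = max_K diam K`. -/
def size (M : Mesh Ω shape) : ℝ := ⨆ c, Metric.diam (M.cell c)

/-- The mesh is shape-regular and quasi-uniform with constant `κ`. Shape regularity is
`diam K * |x - y| ≤ κ * |F_K x - F_K y|` on the reference cell, that is, `|DF_K⁻¹| ≤ κ / diam K`
(on simplices this is equivalent to a bound of `diam K` by a multiple of the inradius of `K`).
Quasi-uniformity is `h ≤ κ * diam K`. -/
structure IsRegular (M : Mesh Ω shape) (κ : ℝ) : Prop where
  shapeRegular : ∀ c, ∀ x ∈ refCell n shape, ∀ y ∈ refCell n shape,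
    Metric.diam (M.cell c) * ‖x - y‖ ≤ κ * ‖M.map c x - M.map c y‖
  quasiUniform : ∀ c, M.size ≤ κ * Metric.diam (M.cell c)

/-- The conforming Lagrange finite element space `V_h ⊂ H¹(Ω)` of degree `k`: the functions that
are continuous on `closure Ω` and, on each cell, a polynomial in `P_k` resp. `Q_k` in the
reference coordinates. -/
def feSpace (M : Mesh Ω shape) (k : ℕ) : Submodule ℝ (H1 Ω) where
  carrier := {u | ∃ w : Eu n → ℝ, ContinuousOn w (closure Ω) ∧
    (∀ c, ∃ p ∈ refPoly n k shape, ∀ x ∈ refCell n shape,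
      w (M.map c x) = MvPolynomial.eval (fun i => x i) p) ∧
    toL2 Ω u =ᵐ[volume.restrict Ω] w}
  zero_mem' := by
    refine ⟨0, continuousOn_const, fun c => ⟨0, Submodule.zero_mem _, by simp⟩, ?_⟩
    rw [map_zero]
    exact Lp.coeFn_zero ℝ 2 (volume.restrict Ω)
  add_mem' := by
    rintro u v ⟨w, hw, hp, hu⟩ ⟨z, hz, hq, hv⟩
    refine ⟨w + z, hw.add hz, fun c => ?_, ?_⟩
    · obtain ⟨p, hpm, hp⟩ := hp c
      obtain ⟨q, hqm, hq⟩ := hq c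
      exact ⟨p + q, Submodule.add_mem _ hpm hqm, fun x hx => by simp [hp x hx, hq x hx]⟩
    · rw [map_add]
      exact (Lp.coeFn_add _ _).trans (hu.add hv)
  smul_mem' := by
    rintro a u ⟨w, hw, hp, hu⟩
    refine ⟨a • w, hw.const_smul a, fun c => ?_, ?_⟩
    · obtain ⟨p, hpm, hp⟩ := hp c
      exact ⟨a • p, Submodule.smul_mem _ a hpm, fun x hx => by simp [hp x hx]⟩
    · rw [map_smul]
      exact (Lp.coeFn_smul _ _).trans (hu.const_smul a)

end Mesh

/-! ### The evolution problems on `(0, T)` -/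

/-- Lebesgue measure on the time interval `(0, T)`. -/
abbrev timeMeasure (T : ℝ) : Measure ℝ := volume.restrict (Ioo 0 T)

/-- `w ∈ L²(0,T; H¹(Ω)) ∩ H¹(0,T; H^{-1}(Ω))` with time derivative `dw` and `w(0) = w₀`:
`w(t) = w₀ + ∫₀ᵗ dw` in `H^{-1}(Ω)` for almost every `t`. -/
structure IsTrajectory {n : ℕ} (Ω : Set (Eu n)) (T : ℝ) (w : ℝ → H1 Ω) (dw : ℝ → HNeg1 Ω)
    (w₀ : L2 Ω) : Prop where
  memLp : MemLp w 2 (timeMeasure T)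
  memLp_deriv : MemLp dw 2 (timeMeasure T)
  eq_integral : ∀ᵐ t ∂(timeMeasure T),
    pivot Ω (toL2 Ω (w t)) = pivot Ω w₀ + ∫ τ in (0 : ℝ)..t, dw τ

/-- `ν` solves the heat equation
`⟨∂ₜν, v⟩ + a(ν, v) = ⟨f, v⟩ + ⟨g, v⟩_∂` for all `v ∈ H¹(Ω)`, with `ν(0) = ν₀`. -/
def SolvesHeat {n : ℕ} (Ω : Set (Eu n)) (A : Eu n → Eu n →L[ℝ] Eu n) (T : ℝ)
    (f : ℝ → HNeg1 Ω) (g : ℝ → HNegHalfBdry Ω) (ν₀ : L2 Ω) (ν : ℝ → H1 Ω) : Prop :=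
  ∃ dν : ℝ → HNeg1 Ω, IsTrajectory Ω T ν dν ν₀ ∧
    ∀ᵐ t ∂(timeMeasure T), ∀ v : H1 Ω,
      dν t v + aForm Ω A (ν t) v = f t v + (g t : HNeg1 Ω) v

/-- `u` solves the nudged problem
`⟨∂ₜu, v⟩ + a(u, v) + μ (L u - ν_H, L v)_Y = ⟨f, v⟩ + ⟨g, v⟩_∂` for all `v ∈ H¹(Ω)`, with
`u(0) = 0`. -/
def SolvesNudged {n : ℕ} (Ω : Set (Eu n)) (A : Eu n → Eu n →L[ℝ] Eu n) (T : ℝ)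
    (f : ℝ → HNeg1 Ω) (g : ℝ → HNegHalfBdry Ω)
    {Y : Type*} [NormedAddCommGroup Y] [InnerProductSpace ℝ Y]
    (L : H1 Ω →L[ℝ] Y) (μ : ℝ) (νH : ℝ → Y) (u : ℝ → H1 Ω) : Prop :=
  ∃ du : ℝ → HNeg1 Ω, IsTrajectory Ω T u du 0 ∧
    ∀ᵐ t ∂(timeMeasure T), ∀ v : H1 Ω,
      du t v + aForm Ω A (u t) v + μ * ⟪L (u t) - νH t, L v⟫_ℝ = f t v + (g t : HNeg1 Ω) v

/-- `u_h ∈ H¹(0,T; V_h)` solves the nudging scheme on `V_h`: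
`⟨∂ₜu_h, v_h⟩ + a(u_h, v_h) + μ (L u_h - ν_H, L v_h)_Y = ⟨f, v_h⟩ + ⟨g, v_h⟩_∂` for all
`v_h ∈ V_h`, with `u_h(0) = 0`. -/
def SolvesSemiDiscrete {n : ℕ} (Ω : Set (Eu n)) (A : Eu n → Eu n →L[ℝ] Eu n) (T : ℝ)
    (f : ℝ → HNeg1 Ω) (g : ℝ → HNegHalfBdry Ω)
    {Y : Type*} [NormedAddCommGroup Y] [InnerProductSpace ℝ Y]
    (L : H1 Ω →L[ℝ] Y) (μ : ℝ) (νH : ℝ → Y) (Vh : Submodule ℝ (H1 Ω)) (uh : ℝ → H1 Ω) : Prop :=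
  (∀ t ∈ Icc 0 T, uh t ∈ Vh) ∧
  ∃ duh : ℝ → H1 Ω, (∀ t, duh t ∈ Vh) ∧ MemLp duh 2 (timeMeasure T) ∧
    (∀ t ∈ Icc 0 T, toL2 Ω (uh t) = ∫ τ in (0 : ℝ)..t, toL2 Ω (duh τ)) ∧
    ∀ᵐ t ∂(timeMeasure T), ∀ vh ∈ Vh,
      ⟪toL2 Ω (duh t), toL2 Ω vh⟫_ℝ + aForm Ω A (uh t) vh + μ * ⟪L (uh t) - νH t, L vh⟫_ℝ
        = f t vh + (g t : HNeg1 Ω) vh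

end Nudging

end

open Nudging

/-!
The error is compared with that of the `L²` projection `P` onto the finite element space. Put
`𝔟(v, w) = a(v, w) + μ (L v, L w)_Y`, `e = u_h - u`, `ρ = u - P u` and `θ = u_h - P u = e + ρ`.
Testing the difference of the two equations with `θ ∈ V_h` gives `(e', θ) + 𝔟(e, θ) = 0`. As `ρ` is
orthogonal to `V_h` at every time, `(e', θ)` is half the derivative of `‖θ‖²`, and `θ(0) = 0`, so that
`∫ 𝔟(e, θ) ≤ 0`. Since `2 𝔟(e, θ) = 𝔟(e, e) + 𝔟(θ, θ) - 𝔟(ρ, ρ)`, it follows that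
`∫ 𝔟(e, e) ≤ ∫ 𝔟(ρ, ρ)`. This is `lintegral_galerkin_error_le`; it uses the coordinates of `θ` in an
`L²` orthonormal basis of `V_h`, so that only scalar functions of time have to be differentiated.

It remains to show `‖ρ‖ ≤ C h^{1+s} ‖u‖_{1+s}` and `‖∇ρ‖ ≤ C h^s ‖u‖_{1+s}`
(`Mesh.exists_projection_error`); the first bound, with the assumption on `L`, is what produces the
factor `1 + μ h²`. By best approximation in `L²` and the inverse inequality
(`Mesh.IsRegular.exists_inverse_inequality`), it is enough to find one function in `V_h` that is this
close to `u` (`Mesh.exists_approx`). Three facts give such a function.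

* A bounded Lipschitz domain has a uniform cone property: at small scales `h`, the part of `Ω` near a
  point lies in an open set `U ⊆ Ω` of diameter `O(h)` that is star-shaped with respect to a ball of
  radius `h` (`IsBoundedLipschitzDomain.exists_starShaped`). On `U`, a polynomial of degree at most
  `⌈s⌉ ≤ k` is chosen so that all derivatives of the error up to the order `⌈s⌉` have mean zero over
  the ball (`exists_poly_integral_eq`). Poincaré's inequality on `U` (`poincare_starShaped`) lowers the
  order of the derivatives step by step, and for the top order the Slobodeckij seminorm takes over
  (`slobodeckij_mean_zero`). This is `IsBoundedLipschitzDomain.exists_local_poly`. It works without an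
  extension operator, and with polynomials in the physical coordinates; these are reproduced by the
  Lagrange interpolation on affine and on multilinear cells.

* Point values at the nodes determine a continuous piecewise polynomial
  (`Mesh.IsRegular.exists_feSpace_interp`). Continuity across cells uses that the affine
  identification of two faces of the reference cell permutes the facet functions that are not constant
  on the face (`exists_lam_comp_eq`), so that corresponding basis functions have the same trace
  (`evalE_nodal_map`). That such a function belongs to `H¹(Ω)` is `exists_h1_of_locallyLipschitz`.

* Assign to each node the value of the local polynomial of one of the cells that contain it. On a
  cell, the difference to the local polynomial of that cell is a combination of differences of local
  polynomials of neighbouring cells, and these are controlled in `L²` by the local errors through the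
  equivalence of norms on the reference cell (`Mesh.IsRegular.exists_quasi_interpolant`). Summing over
  the cells is possible because a ball of radius `O(h)` contains boundedly many of the points
  `F_K(0)` (`Mesh.IsRegular.exists_packing`).

On meshes that are not fine (`h ≥ h₀`), the zero function is close enough.
-/

namespace Nudging

/-! ### Lipschitz domains -/

/-- A frontier point lies on the graph of each local defining function. -/
theorem eq_of_mem_frontier_of_epigraph {n : ℕ} {Ω : Set (Eu n)} (hΩ : IsOpen Ω) {x e : Eu n}
    {r : ℝ} {γ : Eu n → ℝ} (hγ : Continuous γ)
    (h : ∀ y ∈ Metric.ball x r, y ∈ Ω ↔ γ y < ⟪e, y⟫_ℝ) {y : Eu n} (hy : y ∈ Metric.ball x r)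
    (hyf : y ∈ frontier Ω) : γ y = ⟪e, y⟫_ℝ := by
  have hy' : y ∈ closure Ω ∧ y ∉ Ω := by rwa [hΩ.frontier_eq] at hyf
  refine le_antisymm ?_ (not_lt.1 fun hlt => hy'.2 ((h y hy).2 hlt))
  by_contra hlt
  rw [not_le] at hlt
  have hopen : IsOpen ({z | ⟪e, z⟫_ℝ < γ z} ∩ Metric.ball x r) :=
    (isOpen_lt (by fun_prop) hγ).inter Metric.isOpen_ball
  obtain ⟨z, ⟨hz1, hz2⟩, hz3⟩ := mem_closure_iff.1 hy'.1 _ hopen ⟨hlt, hy⟩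
  exact lt_asymm hz1 ((h z hz2).1 hz3)

/-- Vertical translates of a graph are disjoint, so a graph is a null set. -/
theorem volume_graph_eq_zero {n : ℕ} {e : Eu n} (he : ‖e‖ = 1) {γ : Eu n → ℝ}
    (hγ : Continuous γ) (hinv : ∀ (y : Eu n) (τ : ℝ), γ (y + τ • e) = γ y) :
    volume {y : Eu n | γ y = ⟪e, y⟫_ℝ} = 0 := by
  refine Measure.addHaar_eq_zero_of_disjoint_translates volume
    (fun m : ℕ => ((1 : ℝ) / (m + 1)) • e) ?_ ?_ (isClosed_eq hγ (by fun_prop)).measurableSet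
  · refine (Metric.isBounded_closedBall (x := (0 : Eu n)) (r := 1)).subset ?_
    rintro _ ⟨m, rfl⟩
    simp only [Metric.mem_closedBall, dist_zero_right, norm_smul, he, mul_one, Real.norm_eq_abs]
    rw [abs_of_nonneg (by positivity), div_le_one (by positivity)]
    linarith [(Nat.cast_nonneg m : (0 : ℝ) ≤ m)]
  · intro i j hij
    refine Set.disjoint_left.2 ?_
    rintro y hy1 hy2
    simp only [singleton_add, mem_image, mem_ofPred_eq] at hy1 hy2
    obtain ⟨a, ha, rfl⟩ := hy1
    obtain ⟨b, hb, hab⟩ := hy2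
    apply hij
    have h1 : b = a + ((1 : ℝ) / (i + 1) - (1 : ℝ) / (j + 1)) • e := by
      rw [sub_smul, eq_comm, ← sub_eq_zero]
      rw [← sub_eq_zero] at hab
      rw [← neg_eq_zero, ← hab]
      abel
    rw [h1, hinv, ha, inner_add_right, inner_smul_right, real_inner_self_eq_norm_sq, he] at hb
    have h2 : (1 : ℝ) / (i + 1) = 1 / (j + 1) := by linarith
    have h3 : ((i : ℝ) + 1) = j + 1 := by
      rw [div_eq_div_iff (by positivity) (by positivity)] at h2
      linarith
    exact_mod_cast add_right_cancel h3

theorem IsBoundedLipschitzDomain.isCompact_frontier {n : ℕ} {Ω : Set (Eu n)}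
    (hΩ : IsBoundedLipschitzDomain Ω) : IsCompact (frontier Ω) :=
  hΩ.isBounded.isCompact_closure.of_isClosed_subset isClosed_frontier frontier_subset_closure

/-- Locally the frontier is a graph, hence a null set. -/
theorem IsBoundedLipschitzDomain.volume_frontier {n : ℕ} {Ω : Set (Eu n)}
    (hΩ : IsBoundedLipschitzDomain Ω) : volume (frontier Ω) = 0 := by
  refine hΩ.isCompact_frontier.measure_zero_of_nhdsWithin fun x hx => ?_
  obtain ⟨e, r, K, γ, he, hr, hγ, hinv, h⟩ := hΩ.lipschitz x hx
  refine ⟨Metric.ball x r ∩ frontier Ω, Filter.inter_mem (mem_nhdsWithin_of_mem_nhds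
    (Metric.ball_mem_nhds x hr)) self_mem_nhdsWithin, ?_⟩
  refine measure_mono_null ?_ (volume_graph_eq_zero he hγ.continuous hinv)
  rintro y ⟨hy1, hy2⟩
  exact eq_of_mem_frontier_of_epigraph hΩ.isOpen hγ.continuous h hy1 hy2

/-- The uniform cone property: at every small scale `h`, all points of `Ω` within distance `3 h` of
`z` see the whole of some ball of radius `h` inside `Ω`. -/
theorem IsBoundedLipschitzDomain.exists_visible_ball {n : ℕ} {Ω : Set (Eu n)}
    (hΩ : IsBoundedLipschitzDomain Ω) :
    ∃ h₀ R : ℝ, 0 < h₀ ∧ 3 ≤ R ∧ ∀ z ∈ closure Ω, ∀ h : ℝ, 0 < h → h < h₀ → ∃ b : Eu n,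
      ∀ y ∈ Ω ∩ Metric.ball z (3 * h), ∀ w ∈ Metric.ball b h,
        segment ℝ y w ⊆ Ω ∩ Metric.ball z (R * h) := by
  choose! e r K γ he hr hγ hinv hepi using hΩ.lipschitz
  obtain ⟨t, htf, htc⟩ := hΩ.isCompact_frontier.elim_nhds_subcover
    (fun x => Metric.ball x (r x / 2))
    (fun x hx => Metric.ball_mem_nhds x (half_pos (hr x hx)))
  -- uniform Lipschitz constant and radius over the finite subcover
  set Km : ℝ := ∑ x ∈ t, (K x : ℝ) with hKm
  have hKle : ∀ x ∈ t, (K x : ℝ) ≤ Km := fun x hx =>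
    Finset.single_le_sum (f := fun x => (K x : ℝ)) (fun i _ => (K i).2) hx
  have hKm0 : 0 ≤ Km := Finset.sum_nonneg fun i _ => (K i).2
  obtain ⟨ρ, hρ0, hρ⟩ : ∃ ρ : ℝ, 0 < ρ ∧ ∀ x ∈ t, ρ ≤ r x := by
    by_cases hne : t.Nonempty
    · obtain ⟨x, hx, hxm⟩ := t.exists_min_image r hne
      exact ⟨r x, hr x (htf x hx), hxm⟩
    · rw [Finset.not_nonempty_iff_eq_empty] at hne
      exact ⟨1, one_pos, by simp [hne]⟩
  set M : ℝ := 4 * Km + 4 with hM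
  set R : ℝ := M + 5 with hR
  refine ⟨ρ / (2 * (R + 3)), R, by positivity, by linarith, fun z hz h h0 hh => ?_⟩
  by_cases hball : Metric.ball z (3 * h) ⊆ Ω
  · refine ⟨z, fun y hy w hw => ?_⟩
    have hw' : w ∈ Metric.ball z (3 * h) := Metric.ball_subset_ball (by linarith) hw
    refine ((convex_ball z (3 * h)).segment_subset hy.2 hw').trans (subset_inter hball ?_)
    exact Metric.ball_subset_ball (by nlinarith)
  · obtain ⟨z', hz'f, hz'⟩ : ∃ z' ∈ frontier Ω, dist z' z < 3 * h := by
      have hne1 : (Metric.ball z (3 * h) ∩ Ω).Nonempty := by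
        obtain ⟨p, hp1, hp2⟩ := Metric.mem_closure_iff.1 hz (3 * h) (by linarith)
        exact ⟨p, by rw [Metric.mem_ball, dist_comm]; exact hp2, hp1⟩
      have hne2 : (Metric.ball z (3 * h) ∩ Ωᶜ).Nonempty := by
        obtain ⟨p, hp1, hp2⟩ := Set.not_subset.1 hball
        exact ⟨p, hp1, hp2⟩
      by_contra! hno
      have hcov : Metric.ball z (3 * h) ⊆ Ω ∪ (closure Ω)ᶜ := fun p hp => by
        by_contra hp'
        rw [mem_union, not_or, mem_compl_iff, not_not] at hp'
        have hpf : p ∈ frontier Ω := by rw [hΩ.isOpen.frontier_eq]; exact ⟨hp'.2, hp'.1⟩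
        exact absurd (Metric.mem_ball.1 hp) (not_lt.2 (hno p hpf))
      obtain ⟨q, hq1, hq2⟩ := hne2
      obtain ⟨p, -, hp1, hp2⟩ := (convex_ball z (3 * h)).isPreconnected Ω (closure Ω)ᶜ hΩ.isOpen
        isClosed_closure.isOpen_compl hcov hne1 ⟨q, hq1, (hcov hq1).resolve_left hq2⟩
      exact hp2 (subset_closure hp1)
    obtain ⟨x, hxt, hx⟩ : ∃ x ∈ t, z' ∈ Metric.ball x (r x / 2) := by
      simpa using htc hz'f
    have hxf := htf x hxt
    have hRh : (R + 3) * h < r x / 2 := by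
      rw [lt_div_iff₀ (by positivity)] at hh
      linarith [hρ x hxt]
    have hsub : Metric.ball z (R * h) ⊆ Metric.ball x (r x) := by
      intro p hp
      rw [Metric.mem_ball] at hp hx ⊢
      have h1 := dist_triangle p z x
      have h2 := dist_triangle z z' x
      rw [dist_comm z z'] at h2
      nlinarith
    refine ⟨z + (M * h) • e x, fun y hy w hw => ?_⟩
    have hyz : ‖y - z‖ < 3 * h := by rw [← dist_eq_norm]; exact hy.2
    have hwζ : ‖w - (z + (M * h) • e x)‖ < h := by rw [← dist_eq_norm]; exact hw
    have hwz : w ∈ Metric.ball z (R * h) := by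
      rw [Metric.mem_ball, dist_eq_norm]
      have h1 : w - z = (w - (z + (M * h) • e x)) + (M * h) • e x := by abel
      have h2 : ‖(M * h) • e x‖ = M * h := by
        rw [norm_smul, he x hxf, mul_one, Real.norm_eq_abs, abs_of_nonneg (by positivity)]
      rw [h1]
      refine (norm_add_le _ _).trans_lt ?_
      rw [h2]; nlinarith
    have hyR : y ∈ Metric.ball z (R * h) := Metric.ball_subset_ball (by nlinarith) hy.2
    have hseg := (convex_ball z (R * h)).segment_subset hyR hwz
    refine subset_inter (fun p hp => ?_) hseg
    refine (hepi x hxf p (hsub (hseg hp))).2 ?_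
    have hy1 := (hepi x hxf y (hsub hyR)).1 hy.1
    obtain ⟨a, τ, ha, hτ, hsum, rfl⟩ := hp
    -- the horizontal displacement costs at most `4 K τ h`, the vertical one gains `(M - 4) τ h`
    set ζ := w - (z + (M * h) • e x) with hζ
    have hp1 : a • y + τ • w = (y + τ • ((z - y) + ζ)) + (τ * (M * h)) • e x := by
      have : w = ζ + (z + (M * h) • e x) := by rw [hζ]; abel
      rw [this, show a = 1 - τ by linarith]
      module
    have hdisp : ‖(z - y) + ζ‖ ≤ 4 * h := by
      refine (norm_add_le _ _).trans ?_
      rw [norm_sub_rev z y]; linarith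
    have hγ1 : γ x (a • y + τ • w) ≤ γ x y + Km * (τ * (4 * h)) := by
      rw [hp1, hinv x hxf]
      have h1 := (hγ x hxf).dist_le_mul (y + τ • ((z - y) + ζ)) y
      rw [Real.dist_eq, dist_eq_norm, add_sub_cancel_left, norm_smul, Real.norm_eq_abs,
        abs_of_nonneg hτ] at h1
      have h2 := (le_abs_self _).trans h1
      have h3 : (K x : ℝ) * (τ * ‖z - y + ζ‖) ≤ Km * (τ * (4 * h)) := by
        gcongr
        exact hKle x hxt
      linarith
    have hin : ⟪e x, y⟫_ℝ + τ * ((M - 4) * h) ≤ ⟪e x, a • y + τ • w⟫_ℝ := by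
      rw [hp1, inner_add_right, inner_add_right, inner_smul_right, inner_smul_right,
        real_inner_self_eq_norm_sq, he x hxf]
      have h1 := abs_real_inner_le_norm (e x) ((z - y) + ζ)
      rw [he x hxf, one_mul] at h1
      have h2 := (abs_le.1 (h1.trans hdisp)).1
      nlinarith [mul_le_mul_of_nonneg_left h2 hτ]
    have hM4 : M - 4 = 4 * Km := by rw [hM]; ring
    rw [hM4] at hin
    nlinarith

/-- The star hull of `S` with respect to a convex set `B`. -/
def starHull {n : ℕ} (S B : Set (Eu n)) : Set (Eu n) := ⋃ y ∈ S, ⋃ w ∈ B, segment ℝ y w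

theorem subset_starHull {n : ℕ} {S B : Set (Eu n)} (hB : B.Nonempty) : S ⊆ starHull S B := by
  intro y hy
  obtain ⟨w, hw⟩ := hB
  exact mem_biUnion hy (mem_biUnion hw (left_mem_segment ℝ y w))

theorem subset_starHull_right {n : ℕ} {S B : Set (Eu n)} (hS : S.Nonempty) :
    B ⊆ starHull S B := by
  intro w hw
  obtain ⟨y, hy⟩ := hS
  exact mem_biUnion hy (mem_biUnion hw (right_mem_segment ℝ y w))

theorem segment_subset_starHull {n : ℕ} {S B : Set (Eu n)} (hB : Convex ℝ B) {x w : Eu n}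
    (hx : x ∈ starHull S B) (hw : w ∈ B) : segment ℝ x w ⊆ starHull S B := by
  simp only [starHull, mem_iUnion] at hx
  obtain ⟨y, hy, w', hw', a, b, ha, hb, hab, rfl⟩ := hx
  rintro _ ⟨c, d, hc, hd, hcd, rfl⟩
  rcases eq_or_lt_of_le (add_nonneg (mul_nonneg hc hb) hd) with h0 | hpos
  · have hd0 : d = 0 := by nlinarith [mul_nonneg hc hb]
    have hc1 : c = 1 := by linarith
    have hb0 : b = 0 := by subst hc1; linarith
    have ha1 : a = 1 := by linarith
    subst hd0 hc1 hb0 ha1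
    simpa using subset_starHull ⟨w', hw'⟩ hy
  · refine mem_biUnion hy (mem_biUnion (x := (c * b / (c * b + d)) • w' + (d / (c * b + d)) • w)
      (hB hw' hw (by positivity) (by positivity) (by field_simp)) ?_)
    refine ⟨c * a, c * b + d, by positivity, hpos.le, by nlinarith, ?_⟩
    rw [smul_add, smul_smul, smul_smul, mul_div_cancel₀ _ hpos.ne', mul_div_cancel₀ _ hpos.ne',
      smul_add, smul_smul, smul_smul, add_assoc]

theorem isOpen_starHull {n : ℕ} {S B : Set (Eu n)} (hS : IsOpen S) (hB : IsOpen B) :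
    IsOpen (starHull S B) := by
  rw [isOpen_iff_mem_nhds]
  intro x hx
  simp only [starHull, mem_iUnion] at hx
  obtain ⟨y, hy, w, hw, a, b, ha, hb, hab, rfl⟩ := hx
  -- move both end points of the segment by the same small vector
  have hc : Filter.Tendsto (fun p : Eu n => p - (a • y + b • w)) (nhds (a • y + b • w)) (nhds 0) := by
    have : Continuous fun p : Eu n => p - (a • y + b • w) := by fun_prop
    simpa using this.tendsto (a • y + b • w)
  have h1 : ∀ᶠ v in nhds (0 : Eu n), y + v ∈ S := by
    have : Continuous fun v : Eu n => y + v := by fun_prop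
    exact this.tendsto' 0 y (by simp) (hS.mem_nhds hy)
  have h2 : ∀ᶠ v in nhds (0 : Eu n), w + v ∈ B := by
    have : Continuous fun v : Eu n => w + v := by fun_prop
    exact this.tendsto' 0 w (by simp) (hB.mem_nhds hw)
  filter_upwards [hc.eventually h1, hc.eventually h2] with p hp1 hp2
  refine mem_biUnion hp1 (mem_biUnion hp2 ⟨a, b, ha, hb, hab, ?_⟩)
  rw [show a = 1 - b by linarith]
  module

/-- `U` is a neighbourhood of `z` in `Ω`, of size comparable to `h`, that is star-shaped with respect
to each point of the ball of centre `b` and radius `h`. -/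
structure IsStarNbhd {n : ℕ} (Ω : Set (Eu n)) (z : Eu n) (h R : ℝ) (b : Eu n) (U : Set (Eu n)) :
    Prop where
  isOpen : IsOpen U
  ball_subset : Metric.ball b h ⊆ U
  near_subset : Ω ∩ Metric.ball z (3 * h) ⊆ U
  subset_near : U ⊆ Ω ∩ Metric.ball z (R * h)
  segment_subset : ∀ y ∈ U, ∀ w ∈ Metric.ball b h, segment ℝ y w ⊆ U

/-- At every small scale `h`, the part of `Ω` near `z` is contained in an open subset of `Ω`, of
size comparable to `h`, that is star-shaped with respect to a ball of radius `h`. -/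
theorem IsBoundedLipschitzDomain.exists_starShaped {n : ℕ} {Ω : Set (Eu n)}
    (hΩ : IsBoundedLipschitzDomain Ω) :
    ∃ h₀ R : ℝ, 0 < h₀ ∧ 3 ≤ R ∧ ∀ z ∈ closure Ω, ∀ h : ℝ, 0 < h → h < h₀ →
      ∃ (b : Eu n) (U : Set (Eu n)), IsStarNbhd Ω z h R b U := by
  obtain ⟨h₀, R, hh₀, hR, H⟩ := hΩ.exists_visible_ball
  refine ⟨h₀, R, hh₀, hR, fun z hz h h0 hh => ?_⟩
  obtain ⟨b, hb⟩ := H z hz h h0 hh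
  have hne : (Ω ∩ Metric.ball z (3 * h)).Nonempty := by
    obtain ⟨p, hp1, hp2⟩ := Metric.mem_closure_iff.1 hz (3 * h) (by linarith)
    exact ⟨p, hp1, by rw [Metric.mem_ball, dist_comm]; exact hp2⟩
  refine ⟨b, starHull (Ω ∩ Metric.ball z (3 * h)) (Metric.ball b h),
    isOpen_starHull (hΩ.isOpen.inter Metric.isOpen_ball) Metric.isOpen_ball,
    subset_starHull_right hne, subset_starHull (Metric.nonempty_ball.2 h0), ?_,
    fun y hy w hw => segment_subset_starHull (convex_ball b h) hy hw⟩
  exact iUnion₂_subset fun y hy => iUnion₂_subset fun w hw => hb y hy w hw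

end Nudging

namespace Nudging

open scoped ContDiff Topology
open Filter

/-! ### A Poincaré inequality on star-shaped sets -/

theorem sq_lintegral_le {α : Type*} [MeasurableSpace α] (μ : Measure α) {f : α → ℝ≥0∞}
    (hf : AEMeasurable f μ) : (∫⁻ x, f x ∂μ) ^ 2 ≤ μ univ * ∫⁻ x, f x ^ 2 ∂μ := by
  have h := ENNReal.lintegral_mul_le_Lp_mul_Lq μ (p := 2) (q := 2)
    Real.HolderConjugate.two_two (f := fun _ => 1) (g := f) aemeasurable_const hf
  simp only [Pi.mul_apply, one_mul, one_pow, lintegral_one, ENNReal.rpow_ofNat] at h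
  calc (∫⁻ x, f x ∂μ) ^ 2 ≤ (μ univ ^ (1 / 2 : ℝ) * (∫⁻ x, f x ^ 2 ∂μ) ^ (1 / 2 : ℝ)) ^ 2 := by
        gcongr
    _ = μ univ * ∫⁻ x, f x ^ 2 ∂μ := by
        rw [mul_pow, ← ENNReal.rpow_two, ← ENNReal.rpow_two, ← ENNReal.rpow_mul,
          ← ENNReal.rpow_mul]
        norm_num

theorem lintegral_comp_smul_add {n : ℕ} {g : Eu n → ℝ≥0∞} (hg : Measurable g) {a : ℝ} (ha : a ≠ 0)
    (c : Eu n) : ∫⁻ y, g (a • y + c) = ENNReal.ofReal |(a ^ n)⁻¹| * ∫⁻ y, g y := by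
  have h1 : ∫⁻ y, g (a • y + c) = ∫⁻ y, g (y + c) ∂(Measure.map (a • ·) volume) := by
    rw [lintegral_map (by fun_prop) (by fun_prop)]
  rw [h1, Measure.map_addHaar_smul volume ha, lintegral_smul_measure, lintegral_add_right_eq_self]
  simp

theorem lintegral_comp_smul_add_le {n : ℕ} {g : Eu n → ℝ≥0∞} (hg : Measurable g) {a : ℝ}
    (ha : 1 / 2 ≤ a) (c : Eu n) : ∫⁻ y, g (a • y + c) ≤ 2 ^ n * ∫⁻ y, g y := by
  rw [lintegral_comp_smul_add hg (by positivity)]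
  gcongr
  rw [abs_of_nonneg (by positivity), ← inv_pow]
  have : ENNReal.ofReal (a⁻¹ ^ n) ≤ ENNReal.ofReal (2 ^ n) := by
    apply ENNReal.ofReal_le_ofReal
    gcongr
    rw [inv_le_comm₀ (by positivity) (by positivity)]
    linarith
  simpa [ENNReal.ofReal_pow] using this

/-- Averaging a nonnegative function over all segments from `U` to `B`. On each half of the
segments, one of the two end points is a change of variables with bounded Jacobian. -/
theorem lintegral_segments_le {n : ℕ} {g : Eu n → ℝ≥0∞} (hg : Measurable g) (U B : Set (Eu n)) :
    ∫⁻ p, (∫⁻ t in Icc (0 : ℝ) 1, g (p.1 + t • (p.2 - p.1)))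
        ∂((volume.restrict U).prod (volume.restrict B))
      ≤ 2 ^ n * (volume U + volume B) * ∫⁻ x, g x := by
  have hm : Measurable fun p : (Eu n × Eu n) × ℝ => g (p.1.1 + p.2 • (p.1.2 - p.1.1)) :=
    hg.comp (by fun_prop)
  rw [lintegral_lintegral_swap hm.aemeasurable]
  have hle : ∀ t ∈ Icc (0 : ℝ) 1,
      ∫⁻ p, g (p.1 + t • (p.2 - p.1)) ∂((volume.restrict U).prod (volume.restrict B))
        ≤ 2 ^ n * (volume U + volume B) * ∫⁻ x, g x := by
    intro t ht
    have hmt : Measurable fun p : Eu n × Eu n => g (p.1 + t • (p.2 - p.1)) :=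
      hg.comp (by fun_prop)
    rcases le_total t (1 / 2) with h | h
    · rw [lintegral_prod_symm _ hmt.aemeasurable]
      calc ∫⁻ w in B, ∫⁻ y in U, g (y + t • (w - y))
          ≤ ∫⁻ w in B, 2 ^ n * ∫⁻ x, g x := by
            refine lintegral_mono fun w => (setLIntegral_le_lintegral _ _).trans ?_
            have := lintegral_comp_smul_add_le hg (a := 1 - t) (by linarith) (t • w)
            convert! this using 4
            module
        _ = 2 ^ n * volume B * ∫⁻ x, g x := by
            rw [setLIntegral_const]; ring
        _ ≤ _ := by gcongr; exact le_add_self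
    · rw [lintegral_prod _ hmt.aemeasurable]
      calc ∫⁻ y in U, ∫⁻ w in B, g (y + t • (w - y))
          ≤ ∫⁻ y in U, 2 ^ n * ∫⁻ x, g x := by
            refine lintegral_mono fun y => (setLIntegral_le_lintegral _ _).trans ?_
            have := lintegral_comp_smul_add_le hg h ((1 - t) • y)
            convert! this using 4
            module
        _ = 2 ^ n * volume U * ∫⁻ x, g x := by
            rw [setLIntegral_const]; ring
        _ ≤ _ := by gcongr; exact le_self_add
  calc _ ≤ ∫⁻ t in Icc (0 : ℝ) 1, 2 ^ n * (volume U + volume B) * ∫⁻ x, g x :=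
        setLIntegral_mono measurable_const hle
    _ = _ := by simp

/-- The function `g` is the weak partial derivative `∂_i v` in `U`. -/
def IsWeakDeriv {n : ℕ} (U : Set (Eu n)) (i : Fin n) (v g : Eu n → ℝ) : Prop :=
  ∀ φ : Eu n → ℝ, IsTest U φ →
    ∫ x in U, v x * fderiv ℝ φ x (coordVec i) = - ∫ x in U, g x * φ x

theorem sum_smul_coordVec {n : ℕ} (v : Eu n) : ∑ i, v i • coordVec i = v := by
  have := (EuclideanSpace.basisFun (Fin n) ℝ).sum_repr v
  simpa [coordVec] using this

theorem enorm_clm_sq_le {n : ℕ} (l : Eu n →L[ℝ] ℝ) (v : Eu n) :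
    ‖l v‖ₑ ^ 2 ≤ ‖v‖ₑ ^ 2 * ∑ i, ‖l (coordVec i)‖ₑ ^ 2 := by
  have h1 : l v = ∑ i, v i * l (coordVec i) := by
    conv_lhs => rw [← sum_smul_coordVec v]
    simp
  have h2 : (l v) ^ 2 ≤ ‖v‖ ^ 2 * ∑ i, (l (coordVec i)) ^ 2 := by
    rw [h1, EuclideanSpace.norm_sq_eq]
    simpa using Finset.sum_mul_sq_le_sq_mul_sq Finset.univ (fun i => v i)
      (fun i => l (coordVec i))
  have h3 : ∀ r : ℝ, ‖r‖ₑ ^ 2 = ENNReal.ofReal (r ^ 2) := fun r => by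
    rw [← ofReal_norm, ← ENNReal.ofReal_pow (norm_nonneg _), Real.norm_eq_abs, sq_abs]
  simp only [h3]
  rw [← ofReal_norm, ← ENNReal.ofReal_pow (norm_nonneg _),
    ← ENNReal.ofReal_sum_of_nonneg (fun _ _ => sq_nonneg _), ← ENNReal.ofReal_mul (by positivity)]
  exact ENNReal.ofReal_le_ofReal h2

/-- The mean value inequality along a segment, in square-integrated form. -/
theorem enorm_sub_sq_le_segment {n : ℕ} {v : Eu n → ℝ} (hv : ContDiff ℝ 1 v) {g : Eu n → ℝ≥0∞}
    {y w : Eu n} (hg : ∀ p ∈ segment ℝ y w, ∑ i, ‖fderiv ℝ v p (coordVec i)‖ₑ ^ 2 ≤ g p) :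
    ‖v y - v w‖ₑ ^ 2 ≤ ‖w - y‖ₑ ^ 2 * ∫⁻ t in Icc (0 : ℝ) 1, g (y + t • (w - y)) := by
  have hd : ∀ t : ℝ, HasDerivAt (fun t : ℝ => v (y + t • (w - y)))
      (fderiv ℝ v (y + t • (w - y)) (w - y)) t := by
    intro t
    have h1 : HasDerivAt (fun t : ℝ => y + t • (w - y)) (w - y) t := by
      simpa using ((hasDerivAt_id t).smul_const (w - y)).const_add y
    exact ((hv.differentiable (by simp) _).hasFDerivAt).comp_hasDerivAt t h1
  have hc : Continuous fun t : ℝ => fderiv ℝ v (y + t • (w - y)) (w - y) :=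
    ((hv.continuous_fderiv (by simp)).comp (by fun_prop)).clm_apply continuous_const
  have hint := intervalIntegral.integral_eq_sub_of_hasDerivAt (a := 0) (b := 1)
    (fun t _ => hd t) (hc.intervalIntegrable _ _)
  simp only [one_smul, zero_smul, add_zero, add_sub_cancel] at hint
  have h1 : ‖v y - v w‖ₑ ≤ ∫⁻ t in Icc (0 : ℝ) 1, ‖fderiv ℝ v (y + t • (w - y)) (w - y)‖ₑ := by
    rw [← enorm_neg, neg_sub, ← hint, intervalIntegral.integral_of_le zero_le_one,
      ← integral_Icc_eq_integral_Ioc]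
    exact enorm_integral_le_lintegral_enorm _
  calc ‖v y - v w‖ₑ ^ 2
      ≤ (∫⁻ t in Icc (0 : ℝ) 1, ‖fderiv ℝ v (y + t • (w - y)) (w - y)‖ₑ) ^ 2 := by gcongr
    _ ≤ (volume.restrict (Icc (0 : ℝ) 1)) univ
          * ∫⁻ t in Icc (0 : ℝ) 1, ‖fderiv ℝ v (y + t • (w - y)) (w - y)‖ₑ ^ 2 :=
        sq_lintegral_le _ hc.enorm.measurable.aemeasurable
    _ = ∫⁻ t in Icc (0 : ℝ) 1, ‖fderiv ℝ v (y + t • (w - y)) (w - y)‖ₑ ^ 2 := by simp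
    _ ≤ ∫⁻ t in Icc (0 : ℝ) 1, ‖w - y‖ₑ ^ 2 * g (y + t • (w - y)) := by
        refine setLIntegral_mono' measurableSet_Icc fun t ht => ?_
        refine (enorm_clm_sq_le _ _).trans ?_
        gcongr
        refine hg _ ⟨1 - t, t, by linarith [ht.2], ht.1, by ring, by module⟩
    _ = _ := lintegral_const_mul' _ _ (by simp)

end Nudging

namespace Nudging

open scoped ContDiff Topology
open Filter

/-- Mollification with a normalized bump function. -/
noncomputable def mollify {n : ℕ} (φ : ContDiffBump (0 : Eu n)) (v : Eu n → ℝ) : Eu n → ℝ :=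
  convolution (φ.normed volume) v (ContinuousLinearMap.lsmul ℝ ℝ) volume

theorem contDiff_mollify {n : ℕ} (φ : ContDiffBump (0 : Eu n)) {v : Eu n → ℝ}
    (hv : LocallyIntegrable v) : ContDiff ℝ 1 (mollify φ v) :=
  φ.hasCompactSupport_normed.contDiff_convolution_left (n := 1) (ContinuousLinearMap.lsmul ℝ ℝ)
    (φ.contDiff_normed (n := 1)) hv

theorem isTest_normed_sub {n : ℕ} (φ : ContDiffBump (0 : Eu n)) {U : Set (Eu n)} {x : Eu n}
    (hx : Metric.closedBall x φ.rOut ⊆ U) : IsTest U (fun y => φ.normed volume (x - y)) where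
  smooth := by
    have h : ContDiff ℝ ∞ (φ.normed volume) := φ.contDiff_normed (n := ⊤)
    exact h.comp (contDiff_const.sub contDiff_id)
  compact := φ.hasCompactSupport_normed.comp_homeomorph (Homeomorph.subLeft x)
  support := by
    refine (closure_minimal ?_ Metric.isClosed_closedBall).trans hx
    intro y hy
    have : x - y ∈ Function.support (φ.normed volume) := hy
    rw [φ.support_normed_eq, Metric.mem_ball, dist_zero_right] at this
    rw [Metric.mem_closedBall, dist_eq_norm, norm_sub_rev]
    exact this.le

/-- Away from the boundary, mollification commutes with weak differentiation. -/
theorem fderiv_mollify {n : ℕ} (φ : ContDiffBump (0 : Eu n)) {U : Set (Eu n)} (hU : IsOpen U)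
    {v g : Eu n → ℝ} (hv : LocallyIntegrable (U.indicator v)) {i : Fin n}
    (hw : IsWeakDeriv U i v g) {x : Eu n} (hx : Metric.closedBall x φ.rOut ⊆ U) :
    fderiv ℝ (mollify φ (U.indicator v)) x (coordVec i)
      = ∫ y, φ.normed volume (x - y) * U.indicator g y := by
  have hsm : ContDiff ℝ 1 (φ.normed volume) := φ.contDiff_normed (n := 1)
  have h1 := φ.hasCompactSupport_normed.hasFDerivAt_convolution_left
    (ContinuousLinearMap.lsmul ℝ ℝ) hsm hv x
  have hex := (φ.hasCompactSupport_normed (μ := volume)).fderiv (𝕜 := ℝ) |>.convolutionExists_left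
    ((ContinuousLinearMap.lsmul ℝ ℝ : ℝ →L[ℝ] ℝ →L[ℝ] ℝ).precompL (Eu n))
    (hsm.continuous_fderiv (by simp)) hv x
  rw [mollify, h1.fderiv, convolution_def, ContinuousLinearMap.integral_apply hex]
  have h2 : ∀ t, ((ContinuousLinearMap.lsmul ℝ ℝ : ℝ →L[ℝ] ℝ →L[ℝ] ℝ).precompL (Eu n)
      (fderiv ℝ (φ.normed volume) t) (U.indicator v (x - t))) (coordVec i)
      = fderiv ℝ (φ.normed volume) t (coordVec i) * U.indicator v (x - t) := by
    intro t
    simp [ContinuousLinearMap.precompL]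
  simp only [h2]
  rw [← integral_sub_left_eq_self _ _ x]
  simp only [sub_sub_cancel]
  have h3 : ∀ y, fderiv ℝ (fun y => φ.normed volume (x - y)) y (coordVec i)
      = - fderiv ℝ (φ.normed volume) (x - y) (coordVec i) := by
    intro y
    have : HasFDerivAt (fun y => x - y) (-(ContinuousLinearMap.id ℝ (Eu n))) y :=
      (hasFDerivAt_id y).const_sub x
    have := ((hsm.differentiable (by simp) (x - y)).hasFDerivAt).comp y this
    rw [show (fun y => φ.normed volume (x - y)) = φ.normed volume ∘ fun y => x - y from rfl,
      this.fderiv]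
    simp
  have h4 := hw _ (isTest_normed_sub φ hx)
  simp only [h3, mul_neg] at h4
  rw [integral_neg, neg_inj, ← integral_indicator hU.measurableSet,
    ← integral_indicator hU.measurableSet] at h4
  refine (integral_congr_ae (Eventually.of_forall fun y => ?_)).trans
    (h4.trans (integral_congr_ae (Eventually.of_forall fun y => ?_)))
  · by_cases hy : y ∈ U <;> simp [hy, mul_comm]
  · by_cases hy : y ∈ U <;> simp [hy, mul_comm]

theorem enorm_integral_normed_sq_le {n : ℕ} (φ : ContDiffBump (0 : Eu n)) {g : Eu n → ℝ}
    (hg : AEMeasurable g) (x : Eu n) :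
    ‖∫ y, φ.normed volume (x - y) * g y‖ₑ ^ 2
      ≤ ∫⁻ y, ENNReal.ofReal (φ.normed volume (x - y)) * ‖g y‖ₑ ^ 2 := by
  set ρ : Eu n → ℝ≥0∞ := fun y => ENNReal.ofReal (φ.normed volume (x - y)) with hρ
  have hρm : Measurable ρ :=
    ((φ.continuous_normed.comp (by fun_prop)).measurable).ennreal_ofReal
  have hρ1 : ∫⁻ y, ρ y = 1 := by
    rw [← ofReal_integral_eq_lintegral_ofReal (φ.integrable_normed.comp_sub_left x)
      (Eventually.of_forall fun y => φ.nonneg_normed _), integral_sub_left_eq_self,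
      φ.integral_normed, ENNReal.ofReal_one]
  have h1 := sq_lintegral_le (volume.withDensity ρ) (f := fun y => ‖g y‖ₑ)
    (hg.enorm.mono_ac (withDensity_absolutelyContinuous _ _))
  rw [lintegral_withDensity_eq_lintegral_mul₀ hρm.aemeasurable hg.enorm,
    lintegral_withDensity_eq_lintegral_mul₀ hρm.aemeasurable (hg.enorm.pow_const 2),
    withDensity_apply _ MeasurableSet.univ, setLIntegral_univ, hρ1, one_mul] at h1
  refine le_trans ?_ h1
  gcongr
  refine (enorm_integral_le_lintegral_enorm _).trans_eq (lintegral_congr fun y => ?_)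
  rw [enorm_mul, Real.enorm_of_nonneg (φ.nonneg_normed _)]
  rfl

theorem lintegral_lintegral_normed {n : ℕ} (φ : ContDiffBump (0 : Eu n)) {f : Eu n → ℝ≥0∞}
    (hf : Measurable f) :
    ∫⁻ x, ∫⁻ y, ENNReal.ofReal (φ.normed volume (x - y)) * f y = ∫⁻ y, f y := by
  have hm : Measurable fun p : Eu n × Eu n =>
      ENNReal.ofReal (φ.normed volume (p.1 - p.2)) * f p.2 :=
    ((φ.continuous_normed.comp (by fun_prop)).measurable.ennreal_ofReal).mul (hf.comp (by fun_prop))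
  rw [lintegral_lintegral_swap hm.aemeasurable]
  refine lintegral_congr fun y => ?_
  have hmy : Measurable fun x => ENNReal.ofReal (φ.normed volume (x - y)) :=
    (φ.continuous_normed.comp (by fun_prop)).measurable.ennreal_ofReal
  rw [lintegral_mul_const _ hmy,
    ← ofReal_integral_eq_lintegral_ofReal (φ.integrable_normed.comp_sub_right y)
      (Eventually.of_forall fun x => φ.nonneg_normed _), integral_sub_right_eq_self,
    φ.integral_normed, ENNReal.ofReal_one, one_mul]

/-- Poincaré's inequality on an open set that is star-shaped with respect to each point of `B`. The
inequality for the mollified functions comes from the mean value inequality on segments, and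
passes to the limit by Fatou's lemma, as each segment is eventually far from the boundary. -/
theorem poincare_starShaped {n : ℕ} {U B : Set (Eu n)} (hU : IsOpen U)
    (hstar : ∀ y ∈ U, ∀ w ∈ B, segment ℝ y w ⊆ U) (hBm : MeasurableSet B) (hBU : B ⊆ U)
    {D : ℝ} (hD : ∀ y ∈ U, ∀ w ∈ B, ‖w - y‖ ≤ D) {v : Eu n → ℝ} {g : Fin n → Eu n → ℝ}
    (hv : MemLp v 2 (volume.restrict U)) (hg : ∀ i, Measurable (g i))
    (hw : ∀ i, IsWeakDeriv U i v (g i)) :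
    ∫⁻ p, ‖v p.1 - v p.2‖ₑ ^ 2 ∂((volume.restrict U).prod (volume.restrict B))
      ≤ ENNReal.ofReal D ^ 2 * (2 ^ n * (volume U + volume B)
        * ∫⁻ x in U, ∑ i, ‖g i x‖ₑ ^ 2) := by
  have hloc : LocallyIntegrable (U.indicator v) :=
    ((memLp_indicator_iff_restrict hU.measurableSet).2 hv).locallyIntegrable (by norm_num)
  let φ : ℕ → ContDiffBump (0 : Eu n) := fun m =>
    ⟨1 / ((m : ℝ) + 1) / 2, 1 / ((m : ℝ) + 1), by positivity, by
      have : (0 : ℝ) < 1 / ((m : ℝ) + 1) := by positivity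
      linarith⟩
  have hφ : Tendsto (fun m => (φ m).rOut) atTop (𝓝 0) :=
    tendsto_one_div_add_atTop_nhds_zero_nat
  have hφ2 : ∀ᶠ m in atTop, (φ m).rOut ≤ 2 * (φ m).rIn := Eventually.of_forall fun m => by
    change 1 / ((m : ℝ) + 1) ≤ 2 * (1 / ((m : ℝ) + 1) / 2)
    linarith
  have hconv := ContDiffBump.ae_convolution_tendsto_right_of_locallyIntegrable hφ hφ2 hloc
  set G : ℕ → Eu n → ℝ≥0∞ := fun m x =>
    ∑ i, ∫⁻ y, ENNReal.ofReal ((φ m).normed volume (x - y)) * ‖U.indicator (g i) y‖ₑ ^ 2 with hG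
  have hgm : ∀ i, Measurable (fun y => ‖U.indicator (g i) y‖ₑ ^ 2) := fun i =>
    ((hg i).indicator hU.measurableSet).enorm.pow_const 2
  have hint : ∀ m i, Measurable fun x =>
      ∫⁻ y, ENNReal.ofReal ((φ m).normed volume (x - y)) * ‖U.indicator (g i) y‖ₑ ^ 2 := by
    intro m i
    refine Measurable.lintegral_prod_right' (f := fun p : Eu n × Eu n =>
      ENNReal.ofReal ((φ m).normed volume (p.1 - p.2)) * ‖U.indicator (g i) p.2‖ₑ ^ 2) ?_
    exact (((φ m).continuous_normed.comp (by fun_prop)).measurable.ennreal_ofReal).mul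
      ((hgm i).comp measurable_snd)
  have hGm : ∀ m, Measurable (G m) := fun m => Finset.measurable_sum _ fun i _ => hint m i
  have hGint : ∀ m, ∫⁻ x, G m x = ∫⁻ x in U, ∑ i, ‖g i x‖ₑ ^ 2 := by
    intro m
    rw [hG, lintegral_finsetSum _ fun i _ => hint m i,
      lintegral_finsetSum _ fun i _ => (hg i).enorm.pow_const 2]
    refine Finset.sum_congr rfl fun i _ => ?_
    rw [lintegral_lintegral_normed _ (hgm i), ← lintegral_indicator hU.measurableSet]
    refine lintegral_congr fun x => ?_
    by_cases hx : x ∈ U <;> simp [hx]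
  set H : ℕ → Eu n × Eu n → ℝ≥0∞ := fun m p =>
    ENNReal.ofReal D ^ 2 * ∫⁻ t in Icc (0 : ℝ) 1, G m (p.1 + t • (p.2 - p.1)) with hH
  have hHm0 : ∀ m, Measurable fun p : Eu n × Eu n =>
      ∫⁻ t in Icc (0 : ℝ) 1, G m (p.1 + t • (p.2 - p.1)) := fun m =>
    Measurable.lintegral_prod_right' (f := fun q : (Eu n × Eu n) × ℝ =>
      G m (q.1.1 + q.2 • (q.1.2 - q.1.1))) ((hGm m).comp (by fun_prop))
  have hHm : ∀ m, Measurable (H m) := fun m => (hHm0 m).const_mul _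
  have hae : ∀ᵐ p ∂((volume.restrict U).prod (volume.restrict B)),
      ‖v p.1 - v p.2‖ₑ ^ 2 ≤ liminf (fun m => H m p) atTop := by
    have h1 := (Measure.quasiMeasurePreserving_fst (μ := volume.restrict U)
      (ν := volume.restrict B)).ae ((ae_restrict_of_ae hconv).and
        (ae_restrict_mem hU.measurableSet))
    have h2 := (Measure.quasiMeasurePreserving_snd (μ := volume.restrict U)
      (ν := volume.restrict B)).ae ((ae_restrict_of_ae hconv).and (ae_restrict_mem hBm))
    filter_upwards [h1, h2] with p hp1 hp2
    obtain ⟨hc1, hp1U⟩ := hp1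
    obtain ⟨hc2, hp2B⟩ := hp2
    rw [indicator_of_mem hp1U] at hc1
    rw [indicator_of_mem (hBU hp2B)] at hc2
    have hlim : Tendsto (fun m => ‖mollify (φ m) (U.indicator v) p.1
        - mollify (φ m) (U.indicator v) p.2‖ₑ ^ 2) atTop (𝓝 (‖v p.1 - v p.2‖ₑ ^ 2)) :=
      ((ENNReal.continuous_pow 2).comp continuous_enorm).continuousAt.tendsto.comp (hc1.sub hc2)
    rw [← hlim.liminf_eq]
    refine liminf_le_liminf ?_
    have hcomp : IsCompact (segment ℝ p.1 p.2) := by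
      rw [← convexHull_pair]
      exact (Set.toFinite {p.1, p.2}).isCompact_convexHull (𝕜 := ℝ)
    obtain ⟨δ, hδ0, hδ⟩ := hcomp.exists_cthickening_subset_open hU (hstar _ hp1U _ hp2B)
    filter_upwards [hφ.eventually (gt_mem_nhds hδ0)] with m hm
    refine (enorm_sub_sq_le_segment (g := G m) (contDiff_mollify (φ m) hloc) ?_).trans ?_
    · intro q hq
      have hqU : Metric.closedBall q (φ m).rOut ⊆ U := fun y hy => hδ <|
        Metric.mem_cthickening_of_dist_le y q δ _ hq ((Metric.mem_closedBall.1 hy).trans hm.le)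
      refine Finset.sum_le_sum fun i _ => ?_
      rw [fderiv_mollify (φ m) hU hloc (hw i) hqU]
      exact enorm_integral_normed_sq_le (φ m) ((hg i).indicator hU.measurableSet).aemeasurable q
    · simp only [hH]
      gcongr
      rw [← ofReal_norm]
      exact ENNReal.ofReal_le_ofReal (hD _ hp1U _ hp2B)
  calc _ ≤ ∫⁻ p, liminf (fun m => H m p) atTop ∂((volume.restrict U).prod (volume.restrict B)) :=
        lintegral_mono_ae hae
    _ ≤ liminf (fun m => ∫⁻ p, H m p ∂((volume.restrict U).prod (volume.restrict B))) atTop :=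
        lintegral_liminf_le hHm
    _ ≤ liminf (fun _ : ℕ => ENNReal.ofReal D ^ 2 * (2 ^ n * (volume U + volume B)
        * ∫⁻ x in U, ∑ i, ‖g i x‖ₑ ^ 2)) atTop := by
        refine liminf_le_liminf (Eventually.of_forall fun m => ?_)
        simp only [hH]
        rw [lintegral_const_mul _ (hHm0 m)]
        refine mul_le_mul_right ?_ _
        rw [← hGint m]
        exact lintegral_segments_le (hGm m) U B
    _ = _ := liminf_const _

end Nudging

namespace Nudging

open scoped ContDiff Topology
open Filter

/-! ### Polynomials with prescribed mean derivatives -/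

theorem pderiv_pderiv_comm {σ : Type*} (i j : σ) (p : MvPolynomial σ ℝ) :
    MvPolynomial.pderiv i (MvPolynomial.pderiv j p)
      = MvPolynomial.pderiv j (MvPolynomial.pderiv i p) := by
  classical
  ext m
  simp only [MvPolynomial.coeff_pderiv, Finsupp.add_apply]
  rw [add_right_comm]
  rcases eq_or_ne i j with rfl | h
  · ring
  · simp [Finsupp.single_eq_of_ne h, Finsupp.single_eq_of_ne h.symm]
    ring

instance {σ : Type*} :
    LeftCommutative fun (i : σ) (p : MvPolynomial σ ℝ) => MvPolynomial.pderiv i p :=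
  ⟨fun i j p => pderiv_pderiv_comm i j p⟩

/-- The iterated partial derivative of a polynomial in the directions listed in `s`. -/
noncomputable def polyD {σ : Type*} (s : Multiset σ) (p : MvPolynomial σ ℝ) : MvPolynomial σ ℝ :=
  s.foldr (fun i p => MvPolynomial.pderiv i p) p

@[simp] theorem polyD_zero {σ : Type*} (p : MvPolynomial σ ℝ) : polyD 0 p = p := rfl

@[simp] theorem polyD_cons {σ : Type*} (i : σ) (s : Multiset σ) (p : MvPolynomial σ ℝ) :
    polyD (i ::ₘ s) p = MvPolynomial.pderiv i (polyD s p) :=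
  Multiset.foldr_cons _ _ _ _

theorem polyD_cons' {σ : Type*} (i : σ) (s : Multiset σ) (p : MvPolynomial σ ℝ) :
    polyD (i ::ₘ s) p = polyD s (MvPolynomial.pderiv i p) := by
  induction s using Multiset.induction_on with
  | empty => rfl
  | cons j s ih => rw [Multiset.cons_swap, polyD_cons, ih, polyD_cons]

theorem polyD_add {σ : Type*} (s : Multiset σ) (p q : MvPolynomial σ ℝ) :
    polyD s (p + q) = polyD s p + polyD s q := by
  induction s using Multiset.induction_on with
  | empty => rfl
  | cons i s ih => simp [ih]

theorem coeff_polyD_eq_zero {σ : Type*} (s : Multiset σ) (p : MvPolynomial σ ℝ) (β : σ →₀ ℕ)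
    (h : p.totalDegree < β.degree + s.card) : (polyD s p).coeff β = 0 := by
  classical
  have key : ∀ (s : Multiset σ) (β : σ →₀ ℕ),
      p.coeff (β + Multiset.toFinsupp s) = 0 → (polyD s p).coeff β = 0 := by
    intro s
    induction s using Multiset.induction_on with
    | empty => intro β h; simpa using h
    | cons i s ih =>
      intro β h
      rw [polyD_cons, MvPolynomial.coeff_pderiv, ih, zero_mul]
      rw [← h, ← Multiset.singleton_add, map_add, Multiset.toFinsupp_singleton, add_assoc]
  refine key s β (MvPolynomial.coeff_eq_zero_of_totalDegree_lt (h.trans_eq ?_))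
  have h1 : (Multiset.toFinsupp s).degree = s.card := Multiset.toFinsupp_sum_eq s
  have h2 : (β + Multiset.toFinsupp s).degree = β.degree + s.card := by rw [map_add, h1]
  rw [← h2, Finsupp.degree_apply]

/-- Derivatives of order larger than the degree vanish. -/
theorem polyD_eq_zero {σ : Type*} (s : Multiset σ) (p : MvPolynomial σ ℝ)
    (h : p.totalDegree < s.card) : polyD s p = 0 := by
  ext β
  rw [coeff_polyD_eq_zero s p β (by omega), MvPolynomial.coeff_zero]

/-- Derivatives of order at least the degree are constant. -/
theorem polyD_eq_C {σ : Type*} (s : Multiset σ) (p : MvPolynomial σ ℝ)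
    (h : p.totalDegree ≤ s.card) : ∃ a, polyD s p = MvPolynomial.C a := by
  classical
  refine ⟨(polyD s p).coeff 0, ?_⟩
  ext β
  rw [MvPolynomial.coeff_C]
  split_ifs with hβ
  · rw [← hβ]
  · refine coeff_polyD_eq_zero s p β ?_
    have : β.degree ≠ 0 := fun h0 => hβ (((Finsupp.degree_eq_zero_iff β).1 h0).symm)
    omega

/-- The homogeneous polynomial of degree `d` whose derivatives of order `d` are prescribed. -/
noncomputable def homogPoly {n : ℕ} (d : ℕ) (c : Multiset (Fin n) → ℝ) : MvPolynomial (Fin n) ℝ :=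
  ∑ α ∈ Finset.univ.finsuppAntidiag d,
    MvPolynomial.monomial α (c (Finsupp.toMultiset α) / ∏ i, ((α i).factorial : ℝ))

theorem coeff_homogPoly {n : ℕ} (d : ℕ) (c : Multiset (Fin n) → ℝ) (β : Fin n →₀ ℕ) :
    (homogPoly d c).coeff β = if ∑ i, β i = d then
      c (Finsupp.toMultiset β) / ∏ i, ((β i).factorial : ℝ) else 0 := by
  classical
  rw [homogPoly, MvPolynomial.coeff_sum]
  simp only [MvPolynomial.coeff_monomial]
  rw [Finset.sum_ite_eq']
  simp [Finset.mem_finsuppAntidiag]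

theorem totalDegree_homogPoly_le {n : ℕ} (d : ℕ) (c : Multiset (Fin n) → ℝ) :
    (homogPoly d c).totalDegree ≤ d := by
  refine Finset.sup_le fun β hβ => ?_
  rw [MvPolynomial.mem_support_iff, coeff_homogPoly] at hβ
  rw [Finsupp.sum_fintype _ _ fun _ => rfl]
  by_contra h
  exact hβ (if_neg fun h' => h h'.le)

theorem pderiv_homogPoly {n : ℕ} (d : ℕ) (c : Multiset (Fin n) → ℝ) (i : Fin n) :
    MvPolynomial.pderiv i (homogPoly (d + 1) c) = homogPoly d fun s => c (i ::ₘ s) := by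
  classical
  ext β
  rw [MvPolynomial.coeff_pderiv, coeff_homogPoly, coeff_homogPoly]
  have h1 : ∑ j, (β + Finsupp.single i 1 : Fin n →₀ ℕ) j = ∑ j, β j + 1 := by
    simp [Finset.sum_add_distrib, Finsupp.single_apply]
  have h2 : Finsupp.toMultiset (β + Finsupp.single i 1) = i ::ₘ Finsupp.toMultiset β := by
    rw [map_add, Finsupp.toMultiset_single, one_smul, add_comm, Multiset.singleton_add]
  have h3 : ∏ j, (((β + Finsupp.single i 1 : Fin n →₀ ℕ) j).factorial : ℝ)
      = (β i + 1) * ∏ j, ((β j).factorial : ℝ) := by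
    rw [← Finset.mul_prod_erase _ _ (Finset.mem_univ i),
      ← Finset.mul_prod_erase _ (fun j => ((β j).factorial : ℝ)) (Finset.mem_univ i), ← mul_assoc]
    congr 1
    · simp [Nat.factorial_succ]
    · refine Finset.prod_congr rfl fun j hj => ?_
      simp [Finsupp.single_eq_of_ne (Finset.ne_of_mem_erase hj)]
  rw [h1, h2, h3]
  simp only [add_left_inj]
  split_ifs
  · have : ∏ j, ((β j).factorial : ℝ) ≠ 0 :=
      Finset.prod_ne_zero_iff.2 fun j _ => by positivity
    have : (β i : ℝ) + 1 ≠ 0 := by positivity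
    field_simp
  · simp

theorem polyD_homogPoly {n : ℕ} (s : Multiset (Fin n)) (c : Multiset (Fin n) → ℝ) :
    polyD s (homogPoly s.card c) = MvPolynomial.C (c s) := by
  induction s using Multiset.induction_on generalizing c with
  | empty =>
    ext β
    rw [polyD_zero, coeff_homogPoly, MvPolynomial.coeff_C]
    by_cases h : β = 0
    · subst h; simp
    · rw [if_neg (Ne.symm h), if_neg]
      simpa [Finsupp.ext_iff] using h
  | cons i s ih => rw [polyD_cons', Multiset.card_cons, pderiv_homogPoly, ih]

/-- The value of a polynomial at a point of `ℝⁿ`. -/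
noncomputable def evalE {n : ℕ} (p : MvPolynomial (Fin n) ℝ) (x : Eu n) : ℝ :=
  MvPolynomial.eval (fun i => x i) p

theorem contDiff_evalE {n : ℕ} (p : MvPolynomial (Fin n) ℝ) : ContDiff ℝ ∞ (evalE p) := by
  unfold evalE
  induction p using MvPolynomial.induction_on with
  | C a => simpa using contDiff_const
  | add p q hp hq => simpa using hp.add hq
  | mul_X p i hp =>
    have : ContDiff ℝ ∞ fun x : Eu n => x i := by fun_prop
    simpa using hp.mul this

theorem fderiv_evalE {n : ℕ} (p : MvPolynomial (Fin n) ℝ) (x : Eu n) (i : Fin n) :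
    fderiv ℝ (evalE p) x (coordVec i) = evalE (MvPolynomial.pderiv i p) x := by
  have hd : ∀ q : MvPolynomial (Fin n) ℝ, DifferentiableAt ℝ (evalE q) x := fun q =>
    (contDiff_evalE q).differentiable (by simp) x
  induction p using MvPolynomial.induction_on with
  | C a =>
    have : evalE (MvPolynomial.C a : MvPolynomial (Fin n) ℝ) = fun _ : Eu n => a := by
      ext; simp [evalE]
    rw [this]
    simp [evalE]
  | add p q hp hq =>
    have : evalE (p + q) = evalE p + evalE q := by ext; simp [evalE]
    rw [this, fderiv_add (hd p) (hd q)]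
    simp only [add_apply, hp, hq]
    simp [evalE]
  | mul_X p j hp =>
    have : evalE (p * MvPolynomial.X j) = fun x => evalE p x * x j := by ext; simp [evalE]
    have hj : HasFDerivAt (fun x : Eu n => x j) (EuclideanSpace.proj j : Eu n →L[ℝ] ℝ) x :=
      (EuclideanSpace.proj (𝕜 := ℝ) j : Eu n →L[ℝ] ℝ).hasFDerivAt
    have hm : HasFDerivAt (fun x => evalE p x * x j) _ x := (hd p).hasFDerivAt.mul hj
    rw [this, hm.fderiv]
    simp only [add_apply, smul_apply, hp]
    by_cases h : i = j
    · subst h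
      simp [evalE, coordVec]
    · simp [evalE, coordVec, MvPolynomial.pderiv_X_of_ne (Ne.symm h), Ne.symm h]

theorem evalE_add {n : ℕ} (p q : MvPolynomial (Fin n) ℝ) (x : Eu n) :
    evalE (p + q) x = evalE p x + evalE q x := by simp [evalE]

/-- On a bounded set of positive measure, there is a polynomial of degree at most `d` whose
derivatives of order at most `d` have prescribed integrals. -/
theorem exists_poly_integral_eq {n : ℕ} {B : Set (Eu n)} (hB : Bornology.IsBounded B)
    (hB0 : volume B ≠ 0) (d : ℕ) (c : Multiset (Fin n) → ℝ) :
    ∃ q : MvPolynomial (Fin n) ℝ, q.totalDegree ≤ d ∧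
      ∀ s : Multiset (Fin n), s.card ≤ d → ∫ x in B, evalE (polyD s q) x = c s := by
  have hBtop : volume B ≠ ⊤ := hB.measure_lt_top.ne
  have hint : ∀ p : MvPolynomial (Fin n) ℝ, IntegrableOn (evalE p) B := fun p =>
    ((contDiff_evalE p).continuous.locallyIntegrable.integrableOn_isCompact
      hB.isCompact_closure).mono_set subset_closure
  have hreal : volume.real B ≠ 0 := (ENNReal.toReal_pos hB0 hBtop).ne'
  have hconst : ∀ a : ℝ, ∫ x in B, evalE (MvPolynomial.C (a / volume.real B)) x = a := by
    intro a
    simp only [evalE, MvPolynomial.eval_C, setIntegral_const, smul_eq_mul]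
    field_simp
  induction d generalizing c with
  | zero =>
    refine ⟨MvPolynomial.C (c 0 / volume.real B), by simp, fun s hs => ?_⟩
    obtain rfl : s = 0 := by simpa using hs
    rw [polyD_zero, hconst]
  | succ d ih =>
    -- fix the top order first, then correct the lower orders
    set p := homogPoly (n := n) (d + 1) fun s => c s / volume.real B with hp
    obtain ⟨q, hqd, hq⟩ := ih fun s => c s - ∫ x in B, evalE (polyD s p) x
    refine ⟨p + q, (MvPolynomial.totalDegree_add _ _).trans
      (max_le (totalDegree_homogPoly_le _ _) (by omega)), fun s hs => ?_⟩
    have hsplit : ∫ x in B, evalE (polyD s (p + q)) x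
        = (∫ x in B, evalE (polyD s p) x) + ∫ x in B, evalE (polyD s q) x := by
      rw [← integral_add (hint _) (hint _)]
      simp only [polyD_add, evalE_add]
    rw [hsplit]
    rcases Nat.lt_or_ge s.card (d + 1) with h | h
    · rw [hq s (by omega)]
      ring
    · obtain h : s.card = d + 1 := le_antisymm hs h
      rw [polyD_eq_zero s q (by omega), hp, ← h, polyD_homogPoly, hconst]
      simp [evalE]

end Nudging

namespace Nudging

open scoped ContDiff Topology
open Filter

/-! ### Weak derivatives of higher order -/

/-- The partial derivative `∂_i f`. -/
noncomputable def partialD {n : ℕ} (i : Fin n) (f : Eu n → ℝ) : Eu n → ℝ :=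
  fun x => fderiv ℝ f x (coordVec i)

/-- The iterated partial derivative of a function in the directions listed in `l`. -/
noncomputable def listD {n : ℕ} (l : List (Fin n)) (f : Eu n → ℝ) : Eu n → ℝ := l.foldr partialD f

@[simp] theorem listD_nil {n : ℕ} (f : Eu n → ℝ) : listD [] f = f := rfl

@[simp] theorem listD_cons {n : ℕ} (i : Fin n) (l : List (Fin n)) (f : Eu n → ℝ) :
    listD (i :: l) f = partialD i (listD l f) := rfl

theorem listD_concat {n : ℕ} (i : Fin n) (l : List (Fin n)) (f : Eu n → ℝ) :
    listD (l ++ [i]) f = listD l (partialD i f) := by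
  simp [listD]

theorem contDiff_partialD {n : ℕ} (i : Fin n) {f : Eu n → ℝ} (hf : ContDiff ℝ ∞ f) :
    ContDiff ℝ ∞ (partialD i f) :=
  (hf.fderiv_right (m := ∞) (by simp)).clm_apply contDiff_const

theorem contDiff_listD {n : ℕ} (l : List (Fin n)) {f : Eu n → ℝ} (hf : ContDiff ℝ ∞ f) :
    ContDiff ℝ ∞ (listD l f) := by
  induction l with
  | nil => exact hf
  | cons i l ih => exact contDiff_partialD i ih

theorem partialD_comm {n : ℕ} (i j : Fin n) {f : Eu n → ℝ} (hf : ContDiff ℝ ∞ f) :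
    partialD i (partialD j f) = partialD j (partialD i f) := by
  have hd : Differentiable ℝ (fderiv ℝ f) :=
    (hf.fderiv_right (m := ∞) (by simp)).differentiable (by simp)
  have key : ∀ (v w x : Eu n), fderiv ℝ (fun y => fderiv ℝ f y w) x v
      = fderiv ℝ (fderiv ℝ f) x v w := by
    intro v w x
    rw [fderiv_clm_apply (hd x) (differentiableAt_const w)]
    simp
  ext x
  have hs : IsSymmSndFDerivAt ℝ f x :=
    hf.contDiffAt.isSymmSndFDerivAt (by
      rw [minSmoothness_of_isRCLikeNormedField]; exact WithTop.coe_le_coe.2 le_top)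
  change fderiv ℝ (fun y => fderiv ℝ f y (coordVec j)) x (coordVec i)
    = fderiv ℝ (fun y => fderiv ℝ f y (coordVec i)) x (coordVec j)
  rw [key, key, hs]

theorem listD_perm {n : ℕ} {l l' : List (Fin n)} (h : l.Perm l') {f : Eu n → ℝ}
    (hf : ContDiff ℝ ∞ f) : listD l f = listD l' f := by
  induction h with
  | nil => rfl
  | cons i _ ih => rw [listD_cons, ih, listD_cons]
  | swap i j l =>
    simp only [listD_cons]
    exact partialD_comm j i (contDiff_listD l hf)
  | trans _ _ ih1 ih2 => rw [ih1, ih2]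

theorem iteratedFDeriv_eq_listD {n m : ℕ} (I : Fin m → Fin n) {f : Eu n → ℝ}
    (hf : ContDiff ℝ ∞ f) (x : Eu n) :
    iteratedFDeriv ℝ m f x (fun j => coordVec (I j)) = listD (List.ofFn I) f x := by
  induction m generalizing x with
  | zero => simp
  | succ m ih =>
    rw [iteratedFDeriv_succ_apply_left, List.ofFn_succ, listD_cons, partialD]
    have hd : DifferentiableAt ℝ (iteratedFDeriv ℝ m f) x :=
      (hf.iteratedFDeriv_right (m := 1) (i := m) (by exact_mod_cast le_top)).differentiable
        (by simp) x
    have h1 : listD (List.ofFn fun j : Fin m => I j.succ) f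
        = fun y => iteratedFDeriv ℝ m f y (fun j => coordVec (I j.succ)) := by
      ext y
      exact (ih (fun j => I j.succ) y).symm
    rw [h1, fderiv_continuousMultilinear_apply_const_apply hd]
    rfl

theorem IsTest.partialD {n : ℕ} {Ω : Set (Eu n)} {φ : Eu n → ℝ} (hφ : IsTest Ω φ) (i : Fin n) :
    IsTest Ω (partialD i φ) where
  smooth := contDiff_partialD i hφ.smooth
  compact := hφ.compact.fderiv_apply (𝕜 := ℝ) (coordVec i)
  support := (tsupport_fderiv_apply_subset ℝ _).trans hφ.support

theorem IsTest.mono {n : ℕ} {U Ω : Set (Eu n)} (h : U ⊆ Ω) {φ : Eu n → ℝ} (hφ : IsTest U φ) :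
    IsTest Ω φ := ⟨hφ.smooth, hφ.compact, hφ.support.trans h⟩

theorem setIntegral_mul_test_eq {n : ℕ} {U Ω : Set (Eu n)} (hΩ : MeasurableSet Ω)
    (h : U ⊆ Ω) {φ : Eu n → ℝ} (hφ : tsupport φ ⊆ U) (v : Eu n → ℝ) :
    ∫ x in Ω, v x * φ x = ∫ x in U, v x * φ x := by
  refine setIntegral_eq_of_subset_of_forall_sdiff_eq_zero hΩ h fun x hx => ?_
  rw [image_eq_zero_of_notMem_tsupport fun hx' => hx.2 (hφ hx'), mul_zero]

theorem IsWeakDeriv.mono {n : ℕ} {U Ω : Set (Eu n)} (hΩ : MeasurableSet Ω) (h : U ⊆ Ω)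
    {i : Fin n} {v g : Eu n → ℝ} (hv : IsWeakDeriv Ω i v g) : IsWeakDeriv U i v g := by
  intro φ hφ
  have h1 := hv φ (hφ.mono h)
  rw [setIntegral_mul_test_eq hΩ h hφ.support,
    setIntegral_mul_test_eq hΩ h (φ := fun x => fderiv ℝ φ x (coordVec i))
      (hφ.partialD i).support] at h1
  exact h1

/-- The fundamental lemma of the calculus of variations, for square-integrable functions. -/
theorem ae_eq_of_integral_mul_test_eq {n : ℕ} {U : Set (Eu n)} (hU : IsOpen U)
    {f g : Eu n → ℝ} (hf : MemLp f 2 (volume.restrict U)) (hg : MemLp g 2 (volume.restrict U))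
    (h : ∀ φ, IsTest U φ → ∫ x in U, f x * φ x = ∫ x in U, g x * φ x) :
    f =ᵐ[volume.restrict U] g := by
  have hl : LocallyIntegrableOn (f - g) U volume := by
    intro x _
    refine ⟨Metric.ball x 1 ∩ U, Filter.inter_mem (mem_nhdsWithin_of_mem_nhds
      (Metric.ball_mem_nhds x one_pos)) self_mem_nhdsWithin, ?_⟩
    have : IsFiniteMeasure (volume.restrict (Metric.ball x 1 ∩ U)) :=
      ⟨by rw [Measure.restrict_apply_univ]
          exact (measure_mono inter_subset_left).trans_lt measure_ball_lt_top⟩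
    exact ((hf.sub hg).mono_measure (Measure.restrict_mono inter_subset_right le_rfl)).integrable
      (by norm_num)
  have h1 := hU.ae_eq_zero_of_integral_contDiff_smul_eq_zero hl fun φ h1 h2 h3 => by
    have hφ : IsTest U φ := ⟨h1, h2, h3⟩
    have h4 := h φ hφ
    rw [← sub_eq_zero, ← integral_sub (hφ.integrable_mul hf) (hφ.integrable_mul hg)] at h4
    rw [← setIntegral_eq_integral_of_forall_compl_eq_zero (s := U), ← h4]
    · refine integral_congr_ae (Eventually.of_forall fun x => ?_)
      simp
      ring
    · intro x hx
      rw [image_eq_zero_of_notMem_tsupport fun hx' => hx (h3 hx'), zero_smul]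
  rw [Filter.EventuallyEq, ae_restrict_iff' hU.measurableSet]
  filter_upwards [h1] with x hx hxU
  exact sub_eq_zero.1 (hx hxU)

theorem IsWeakDeriv.unique {n : ℕ} {U : Set (Eu n)} (hU : IsOpen U) {i : Fin n}
    {v g g' : Eu n → ℝ} (hg : MemLp g 2 (volume.restrict U)) (hg' : MemLp g' 2 (volume.restrict U))
    (h : IsWeakDeriv U i v g) (h' : IsWeakDeriv U i v g') : g =ᵐ[volume.restrict U] g' :=
  ae_eq_of_integral_mul_test_eq hU hg hg' fun φ hφ => neg_injective ((h φ hφ).symm.trans (h' φ hφ))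

theorem IsWeakDeriv.sub {n : ℕ} {U : Set (Eu n)} {i : Fin n} {v w g g' : Eu n → ℝ}
    (hv : MemLp v 2 (volume.restrict U)) (hw : MemLp w 2 (volume.restrict U))
    (hg : MemLp g 2 (volume.restrict U)) (hg' : MemLp g' 2 (volume.restrict U))
    (h : IsWeakDeriv U i v g) (h' : IsWeakDeriv U i w g') :
    IsWeakDeriv U i (fun x => v x - w x) (fun x => g x - g' x) := by
  intro φ hφ
  simp only [sub_mul]
  rw [integral_sub (hφ.integrable_mul_fderiv hv _) (hφ.integrable_mul_fderiv hw _), h φ hφ, h' φ hφ,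
    integral_sub (hφ.integrable_mul hg) (hφ.integrable_mul hg')]
  ring

theorem IsWeakDeriv.congr {n : ℕ} {U : Set (Eu n)} {i : Fin n} {v v' g g' : Eu n → ℝ}
    (h : IsWeakDeriv U i v g) (hv : v =ᵐ[volume.restrict U] v')
    (hg : g =ᵐ[volume.restrict U] g') : IsWeakDeriv U i v' g' := by
  intro φ hφ
  have h1 : ∫ x in U, v x * fderiv ℝ φ x (coordVec i) = ∫ x in U, v' x * fderiv ℝ φ x (coordVec i) :=
    integral_congr_ae (hv.mono fun x hx => by simp only [hx])
  have h2 : ∫ x in U, g x * φ x = ∫ x in U, g' x * φ x :=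
    integral_congr_ae (hg.mono fun x hx => by simp only [hx])
  rw [← h1, ← h2, h φ hφ]

/-- Classical derivatives are weak derivatives. -/
theorem isWeakDeriv_of_contDiff {n : ℕ} (U : Set (Eu n)) (i : Fin n)
    {f : Eu n → ℝ} (hf : ContDiff ℝ ∞ f) : IsWeakDeriv U i f (Nudging.partialD i f) := by
  intro φ hφ
  have h1 := integral_mul_fderiv_eq_neg_fderiv_mul_of_integrable (μ := volume) (f := f) (g := φ)
    (v := coordVec i)
    (((contDiff_partialD i hf).continuous.mul hφ.smooth.continuous).integrable_of_hasCompactSupport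
      hφ.compact.mul_left)
    ((hf.continuous.mul (hφ.partialD i).smooth.continuous).integrable_of_hasCompactSupport
      (hφ.partialD i).compact.mul_left)
    ((hf.continuous.mul hφ.smooth.continuous).integrable_of_hasCompactSupport hφ.compact.mul_left)
    (fun x _ => hf.differentiable (by simp) x) (fun x _ => hφ.smooth.differentiable (by simp) x)
  rw [← setIntegral_mul_test_eq MeasurableSet.univ (subset_univ U) hφ.support,
    ← setIntegral_mul_test_eq MeasurableSet.univ (subset_univ U) (φ := fun x => fderiv ℝ φ x (coordVec i))
      (hφ.partialD i).support, setIntegral_univ, setIntegral_univ]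
  exact h1

theorem isWeakDeriv_evalE {n : ℕ} (U : Set (Eu n)) (i : Fin n)
    (p : MvPolynomial (Fin n) ℝ) : IsWeakDeriv U i (evalE p) (evalE (MvPolynomial.pderiv i p)) := by
  have h := isWeakDeriv_of_contDiff U i (contDiff_evalE p)
  rwa [show Nudging.partialD i (evalE p) = evalE (MvPolynomial.pderiv i p) from
    funext fun x => fderiv_evalE p x i] at h

/-- Consecutive weak partial derivatives, indexed by multisets of directions. -/
theorem isWeakDeriv_of_listD {n : ℕ} {Ω : Set (Eu n)} {u : Eu n → ℝ}
    {V : Multiset (Fin n) → Eu n → ℝ} {s : Multiset (Fin n)} {i : Fin n}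
    (h1 : ∀ φ, IsTest Ω φ → ∫ x in Ω, u x * listD s.toList φ x
      = (-1) ^ s.card * ∫ x in Ω, V s x * φ x)
    (h2 : ∀ φ, IsTest Ω φ → ∫ x in Ω, u x * listD (i ::ₘ s).toList φ x
      = (-1) ^ (s.card + 1) * ∫ x in Ω, V (i ::ₘ s) x * φ x) :
    IsWeakDeriv Ω i (V s) (V (i ::ₘ s)) := by
  intro φ hφ
  have h3 := h1 _ (hφ.partialD i)
  have hperm : (s.toList ++ [i]).Perm (i ::ₘ s).toList := by
    rw [← Multiset.coe_eq_coe, ← Multiset.coe_add, Multiset.coe_toList, Multiset.coe_toList,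
      Multiset.coe_singleton, add_comm, Multiset.singleton_add]
  rw [← listD_concat, listD_perm hperm hφ.smooth, h2 φ hφ, pow_succ, mul_assoc,
    mul_right_inj' (by simp)] at h3
  rw [neg_one_mul] at h3
  exact h3.symm

end Nudging

namespace Nudging

open scoped Topology
open Filter

/-! ### Local polynomial approximation -/

/-- A function with mean zero over `B` is controlled by its differences with the values in `B`. -/
theorem lintegral_sq_le_of_integral_eq_zero {n : ℕ} {U B : Set (Eu n)} {f : Eu n → ℝ}
    (hf : Measurable f) (hfB : IntegrableOn f B) (h0 : ∫ x in B, f x = 0) (hB : volume B ≠ 0)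
    (hB' : volume B ≠ ⊤) :
    ∫⁻ y in U, ‖f y‖ₑ ^ 2 ≤ (volume B)⁻¹
      * ∫⁻ p, ‖f p.1 - f p.2‖ₑ ^ 2 ∂((volume.restrict U).prod (volume.restrict B)) := by
  have hm : Measurable fun p : Eu n × Eu n => ‖f p.1 - f p.2‖ₑ ^ 2 := by fun_prop
  rw [lintegral_prod _ hm.aemeasurable, ← lintegral_const_mul' _ _ (ENNReal.inv_ne_top.2 hB)]
  refine lintegral_mono fun y => ?_
  have hfin : IsFiniteMeasure (volume.restrict B) :=
    ⟨by rw [Measure.restrict_apply_univ]; exact hB'.lt_top⟩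
  have h1 : ∫ w in B, (f y - f w) = volume.real B * f y := by
    rw [integral_sub (integrable_const _) hfB, h0, setIntegral_const, smul_eq_mul, sub_zero]
  have h2 : volume B * ‖f y‖ₑ ≤ ∫⁻ w in B, ‖f y - f w‖ₑ := by
    refine le_trans (le_of_eq ?_) (enorm_integral_le_lintegral_enorm _)
    rw [h1, enorm_mul, Real.enorm_of_nonneg measureReal_nonneg, ofReal_measureReal hB']
  have h3 : (volume B * ‖f y‖ₑ) ^ 2 ≤ volume B * ∫⁻ w in B, ‖f y - f w‖ₑ ^ 2 := by
    have := sq_lintegral_le (volume.restrict B) (f := fun w => ‖f y - f w‖ₑ) (by fun_prop)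
    rw [Measure.restrict_apply_univ] at this
    exact (by gcongr : _ ≤ _).trans this
  rw [mul_pow, sq, mul_assoc, ENNReal.mul_le_mul_iff_right hB hB'] at h3
  rwa [← ENNReal.mul_le_iff_le_inv hB hB']

/-- The constant of the Poincaré inequality `poincare_mean_zero`. -/
noncomputable def poincareConst (n : ℕ) (R : ℝ) : ℝ := (2 * R) ^ 2 * (2 ^ n * (R ^ n + 1))

theorem poincareConst_nonneg (n : ℕ) {R : ℝ} (hR : 0 ≤ R) : 0 ≤ poincareConst n R := by
  unfold poincareConst; positivity

theorem volume_ball_eq {n : ℕ} (x : Eu n) {r : ℝ} (hr : 0 < r) :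
    volume (Metric.ball x r) = ENNReal.ofReal (r ^ n * volume.real (Metric.ball (0 : Eu n) 1)) := by
  rw [Measure.addHaar_ball_of_pos _ _ hr, ENNReal.ofReal_mul (by positivity),
    ofReal_measureReal measure_ball_lt_top.ne, finrank_euclideanSpace_fin]

theorem volume_real_unitBall_pos (n : ℕ) : 0 < volume.real (Metric.ball (0 : Eu n) 1) :=
  ENNReal.toReal_pos (Metric.measure_ball_pos _ _ one_pos).ne' measure_ball_lt_top.ne

namespace IsStarNbhd

variable {n : ℕ} {Ω : Set (Eu n)} {z b : Eu n} {h R : ℝ} {U : Set (Eu n)}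

theorem norm_sub_le (hU : IsStarNbhd Ω z h R b U) {y w : Eu n} (hy : y ∈ U) (hw : w ∈ U) :
    ‖w - y‖ ≤ 2 * R * h := by
  have h1 := (hU.subset_near hy).2
  have h2 := (hU.subset_near hw).2
  rw [Metric.mem_ball] at h1 h2
  rw [← dist_eq_norm]
  linarith [dist_triangle_right w y z]

/-- Poincaré's inequality for functions with mean zero over the inner ball, with the scaling `h²`. -/
theorem poincare_mean_zero (hU : IsStarNbhd Ω z h R b U) (hh : 0 < h) (hR : 0 < R)
    {v : Eu n → ℝ} {g : Fin n → Eu n → ℝ} (hvm : Measurable v)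
    (hv : MemLp v 2 (volume.restrict U)) (hg : ∀ i, Measurable (g i))
    (hw : ∀ i, IsWeakDeriv U i v (g i)) (h0 : ∫ x in Metric.ball b h, v x = 0) :
    ∫⁻ x in U, ‖v x‖ₑ ^ 2
      ≤ ENNReal.ofReal (poincareConst n R * h ^ 2) * ∫⁻ x in U, ∑ i, ‖g i x‖ₑ ^ 2 := by
  have hB0 : volume (Metric.ball b h) ≠ 0 := (Metric.measure_ball_pos _ _ hh).ne'
  have hBt : volume (Metric.ball b h) ≠ ⊤ := measure_ball_lt_top.ne
  have hfin : IsFiniteMeasure (volume.restrict (Metric.ball b h)) :=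
    ⟨by rw [Measure.restrict_apply_univ]; exact hBt.lt_top⟩
  have hvB : IntegrableOn v (Metric.ball b h) :=
    (hv.mono_measure (Measure.restrict_mono hU.ball_subset le_rfl)).integrable (by norm_num)
  have h1 := lintegral_sq_le_of_integral_eq_zero (U := U) hvm hvB h0 hB0 hBt
  have h2 := poincare_starShaped hU.isOpen hU.segment_subset measurableSet_ball hU.ball_subset
    (fun y hy w hw => hU.norm_sub_le hy (hU.ball_subset hw)) hv hg hw
  refine h1.trans ((mul_le_mul_right h2 _).trans ?_)
  rw [← mul_assoc, ← mul_assoc]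
  refine mul_le_mul_left ?_ _
  have hω := volume_real_unitBall_pos n
  set ω := volume.real (Metric.ball (0 : Eu n) 1) with hω'
  have hvU : volume U + volume (Metric.ball b h) ≤ ENNReal.ofReal ((R ^ n + 1) * h ^ n * ω) := by
    have : volume U ≤ ENNReal.ofReal ((R * h) ^ n * ω) := by
      rw [← volume_ball_eq z (by positivity)]
      exact measure_mono (hU.subset_near.trans inter_subset_right)
    refine (add_le_add this (volume_ball_eq b hh).le).trans (le_of_eq ?_)
    rw [← hω', ← ENNReal.ofReal_add (by positivity) (by positivity), mul_pow]
    ring_nf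
  calc (volume (Metric.ball b h))⁻¹ * ENNReal.ofReal (2 * R * h) ^ 2
        * (2 ^ n * (volume U + volume (Metric.ball b h)))
      ≤ (ENNReal.ofReal (h ^ n * ω))⁻¹ * ENNReal.ofReal (2 * R * h) ^ 2
        * (ENNReal.ofReal (2 ^ n) * ENNReal.ofReal ((R ^ n + 1) * h ^ n * ω)) := by
        rw [volume_ball_eq b hh, ← hω']
        rw [volume_ball_eq b hh, ← hω'] at hvU
        gcongr
        rw [ENNReal.ofReal_pow (by norm_num)]
        simp
    _ = ENNReal.ofReal (poincareConst n R * h ^ 2) := by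
        rw [← ENNReal.ofReal_inv_of_pos (by positivity), ← ENNReal.ofReal_pow (by positivity),
          ← ENNReal.ofReal_mul (by positivity), ← ENNReal.ofReal_mul (by positivity),
          ← ENNReal.ofReal_mul (by positivity)]
        congr 1
        unfold poincareConst
        field_simp

/-- The fractional counterpart of the Poincaré inequality. -/
theorem slobodeckij_mean_zero (hU : IsStarNbhd Ω z h R b U) (hh : 0 < h) (hR : 0 < R)
    {σ : ℝ} (hσ : 0 ≤ σ) {f : Eu n → ℝ} (hf : Measurable f)
    (hfB : IntegrableOn f (Metric.ball b h)) (h0 : ∫ x in Metric.ball b h, f x = 0) :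
    ∫⁻ x in U, ‖f x‖ₑ ^ 2
      ≤ ENNReal.ofReal ((2 * R) ^ (n + 2 * σ) / volume.real (Metric.ball (0 : Eu n) 1)
          * h ^ (2 * σ))
        * ∫⁻ x in U, ∫⁻ y in Ω, ENNReal.ofReal ((f x - f y) ^ 2 / ‖x - y‖ ^ (n + 2 * σ)) := by
  have hB0 : volume (Metric.ball b h) ≠ 0 := (Metric.measure_ball_pos _ _ hh).ne'
  have hBt : volume (Metric.ball b h) ≠ ⊤ := measure_ball_lt_top.ne
  refine (lintegral_sq_le_of_integral_eq_zero (U := U) hf hfB h0 hB0 hBt).trans ?_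
  have hm : Measurable fun p : Eu n × Eu n => ‖f p.1 - f p.2‖ₑ ^ 2 := by fun_prop
  have hω := volume_real_unitBall_pos n
  set ω := volume.real (Metric.ball (0 : Eu n) 1) with hω'
  rw [lintegral_prod _ hm.aemeasurable]
  have hpt : ∀ x ∈ U, ∫⁻ y in Metric.ball b h, ‖f x - f y‖ₑ ^ 2
      ≤ ENNReal.ofReal ((2 * R * h) ^ (n + 2 * σ))
        * ∫⁻ y in Ω, ENNReal.ofReal ((f x - f y) ^ 2 / ‖x - y‖ ^ (n + 2 * σ)) := by
    intro x hx
    refine le_trans ?_ (mul_le_mul_right (lintegral_mono_set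
      (hU.ball_subset.trans (hU.subset_near.trans inter_subset_left))) _)
    rw [← lintegral_const_mul' _ _ ENNReal.ofReal_ne_top]
    refine setLIntegral_mono' measurableSet_ball fun y hy => ?_
    rw [← ofReal_norm, ← ENNReal.ofReal_pow (norm_nonneg _), Real.norm_eq_abs, sq_abs,
      ← ENNReal.ofReal_mul (by positivity)]
    refine ENNReal.ofReal_le_ofReal ?_
    rcases eq_or_ne x y with rfl | hxy
    · simp
    · have hpos : 0 < ‖x - y‖ := norm_pos_iff.2 (sub_ne_zero.2 hxy)
      have h1 := hU.norm_sub_le (hU.ball_subset hy) hx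
      rw [mul_div_assoc', le_div_iff₀ (by positivity), mul_comm]
      gcongr
  calc _ ≤ (volume (Metric.ball b h))⁻¹ * ∫⁻ x in U, ENNReal.ofReal ((2 * R * h) ^ (n + 2 * σ))
        * ∫⁻ y in Ω, ENNReal.ofReal ((f x - f y) ^ 2 / ‖x - y‖ ^ (n + 2 * σ)) := by
        exact mul_le_mul_right (setLIntegral_mono' hU.isOpen.measurableSet hpt) _
    _ = _ := by
        rw [lintegral_const_mul' _ _ ENNReal.ofReal_ne_top, ← mul_assoc, volume_ball_eq b hh,
          ← hω', ← ENNReal.ofReal_inv_of_pos (by positivity), ← ENNReal.ofReal_mul (by positivity)]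
        congr 2
        rw [Real.mul_rpow (by positivity) hh.le, Real.rpow_add hh, Real.rpow_natCast]
        field_simp

/-- Iterating the Poincaré inequality down from derivatives of order `d`. -/
theorem poincare_iterate (hU : IsStarNbhd Ω z h R b U) (hh : 0 < h) (hR : 0 < R) {d : ℕ}
    {W : Multiset (Fin n) → Eu n → ℝ} (hWm : ∀ s, Measurable (W s))
    (hW : ∀ s, s.card ≤ d → MemLp (W s) 2 (volume.restrict U))
    (hw : ∀ s, s.card < d → ∀ i, IsWeakDeriv U i (W s) (W (i ::ₘ s)))
    (h0 : ∀ s, s.card < d → ∫ x in Metric.ball b h, W s x = 0) {X : ℝ≥0∞}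
    (hX : ∀ s, s.card = d → ∫⁻ x in U, ‖W s x‖ₑ ^ 2 ≤ X) (j : ℕ) (s : Multiset (Fin n))
    (hs : s.card + j = d) :
    ∫⁻ x in U, ‖W s x‖ₑ ^ 2 ≤ ENNReal.ofReal ((n * poincareConst n R * h ^ 2) ^ j) * X := by
  have hP := poincareConst_nonneg n hR.le
  induction j generalizing s with
  | zero => simpa using hX s hs
  | succ j ih =>
    refine (hU.poincare_mean_zero hh hR (hWm s) (hW s (by omega)) (fun i => hWm (i ::ₘ s))
      (hw s (by omega)) (h0 s (by omega))).trans ?_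
    rw [lintegral_finsetSum _ fun i _ => (hWm _).enorm.pow_const 2]
    have h1 : ∑ i, ∫⁻ x in U, ‖W (i ::ₘ s) x‖ₑ ^ 2
        ≤ ∑ _i : Fin n, ENNReal.ofReal ((n * poincareConst n R * h ^ 2) ^ j) * X :=
      Finset.sum_le_sum fun i _ => ih _ (by rw [Multiset.card_cons]; omega)
    refine (mul_le_mul_right h1 _).trans (le_of_eq ?_)
    rw [Finset.sum_const, Finset.card_univ, Fintype.card_fin, nsmul_eq_mul, ← mul_assoc,
      ← mul_assoc, ← ENNReal.ofReal_natCast n, ← ENNReal.ofReal_mul (by positivity),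
      ← ENNReal.ofReal_mul (by positivity), pow_succ]
    congr 2
    ring

end IsStarNbhd

end Nudging

namespace Nudging

open scoped Topology
open Filter

/-- The quantity minimized in `sobolevSq`, for a given choice of the weak derivatives. -/
noncomputable def sobolevExpr {n : ℕ} (Ω : Set (Eu n)) (r : ℝ)
    (D : (j : ℕ) → (Fin j → Fin n) → L2 Ω) : ℝ≥0∞ :=
  (∑ j ∈ Finset.range (⌊r⌋₊ + 1), ∑ I : Fin j → Fin n, ‖D j I‖ₑ ^ 2)
      + open Classical in if Int.fract r = 0 then 0 else
          ∑ I : Fin ⌊r⌋₊ → Fin n, ∫⁻ x in Ω, ∫⁻ y in Ω,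
            ENNReal.ofReal ((D ⌊r⌋₊ I x - D ⌊r⌋₊ I y) ^ 2
              / ‖x - y‖ ^ ((n : ℝ) + 2 * Int.fract r))

theorem lp_enorm_sq {n : ℕ} {Ω : Set (Eu n)} (f : L2 Ω) :
    ‖f‖ₑ ^ 2 = ∫⁻ x in Ω, ‖f x‖ₑ ^ 2 := by
  rw [Lp.enorm_def, eLpNorm_eq_lintegral_rpow_enorm_toReal (by norm_num) (by norm_num),
    ← ENNReal.rpow_two, ← ENNReal.rpow_mul]
  simp

theorem memLp_evalE {n : ℕ} {U : Set (Eu n)} (hU : Bornology.IsBounded U)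
    (p : MvPolynomial (Fin n) ℝ) : MemLp (evalE p) 2 (volume.restrict U) := by
  have hfin : IsFiniteMeasure (volume.restrict (closure U)) :=
    ⟨by rw [Measure.restrict_apply_univ]; exact hU.isCompact_closure.measure_lt_top⟩
  have hc := (contDiff_evalE p).continuous
  obtain ⟨C, hC⟩ := hU.isCompact_closure.exists_bound_of_continuousOn hc.continuousOn
  refine MemLp.mono_measure (Measure.restrict_mono subset_closure le_rfl)
    (MemLp.of_bound hc.aestronglyMeasurable C ?_)
  exact (ae_restrict_mem isClosed_closure.measurableSet).mono hC

theorem isWeakDeriv_toL2 {n : ℕ} {Ω : Set (Eu n)} (v : H1 Ω) (i : Fin n) :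
    IsWeakDeriv Ω i (toL2 Ω v) (fun x => grad Ω v x i) := fun φ hφ => v.2 φ hφ i

/-- The weak derivatives of `v`, indexed by multisets of directions. -/
theorem exists_weakDeriv_family {n : ℕ} {Ω : Set (Eu n)} (hΩ : IsOpen Ω) (v : H1 Ω) {m : ℕ}
    (hm : 1 ≤ m) {D : (j : ℕ) → (Fin j → Fin n) → L2 Ω}
    (hD : ∀ j ≤ m, ∀ I : Fin j → Fin n, IsWeakPartial Ω I (toL2 Ω v) (D j I)) :
    ∃ V : Multiset (Fin n) → Eu n → ℝ, (∀ s, Measurable (V s)) ∧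
      (∀ s, MemLp (V s) 2 (volume.restrict Ω)) ∧
      (∀ s i, s.card < m → IsWeakDeriv Ω i (V s) (V (i ::ₘ s))) ∧
      V 0 =ᵐ[volume.restrict Ω] toL2 Ω v ∧
      (∀ i, V {i} =ᵐ[volume.restrict Ω] fun x => grad Ω v x i) ∧
      ∀ s, ∃ I : Fin s.card → Fin n, V s = D s.card I := by
  let I : (s : Multiset (Fin n)) → Fin s.card → Fin n := fun s j =>
    s.toList.get (j.cast s.length_toList.symm)
  have hI : ∀ s, List.ofFn (I s) = s.toList := by
    intro s
    refine List.ext_get (by simp) fun k h1 h2 => by simp [I]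
  have hV : ∀ s : Multiset (Fin n), s.card ≤ m → ∀ φ, IsTest Ω φ →
      ∫ x in Ω, toL2 Ω v x * listD s.toList φ x
        = (-1) ^ s.card * ∫ x in Ω, D s.card (I s) x * φ x := by
    intro s hs φ hφ
    rw [← hD s.card hs (I s) φ hφ]
    simp only [iteratedFDeriv_eq_listD (I s) hφ.smooth, hI]
  have hmem : ∀ s : Multiset (Fin n), MemLp (D s.card (I s)) 2 (volume.restrict Ω) := fun s =>
    Lp.memLp _
  have hchain : ∀ (s : Multiset (Fin n)) (i : Fin n), s.card < m →
      IsWeakDeriv Ω i (D s.card (I s)) (D (i ::ₘ s).card (I (i ::ₘ s))) := by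
    intro s i hs
    refine isWeakDeriv_of_listD (u := toL2 Ω v) (V := fun s => D s.card (I s)) (hV s hs.le) ?_
    intro φ hφ
    have := hV (i ::ₘ s) (by rw [Multiset.card_cons]; omega) φ hφ
    rwa [show ((-1 : ℝ)) ^ (i ::ₘ s).card = (-1) ^ (s.card + 1) by rw [Multiset.card_cons]] at this
  have h0 : D (0 : Multiset (Fin n)).card (I 0) =ᵐ[volume.restrict Ω] toL2 Ω v := by
    refine ae_eq_of_integral_mul_test_eq hΩ (hmem 0) (Lp.memLp _) fun φ hφ => ?_
    have := hV 0 (by simp) φ hφ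
    rw [Multiset.toList_zero, listD_nil,
      show ((-1 : ℝ)) ^ (0 : Multiset (Fin n)).card = 1 from pow_zero _, one_mul] at this
    exact this.symm
  refine ⟨fun s => D s.card (I s), fun s => (Lp.stronglyMeasurable _).measurable, hmem, hchain, h0,
    fun i => ?_, fun s => ⟨I s, rfl⟩⟩
  exact ((hchain 0 i (by rw [Multiset.card_zero]; omega)).congr h0 (EventuallyEq.refl _ _)).unique hΩ
    (hmem (i ::ₘ 0)) (memLp_coord _ i) (isWeakDeriv_toL2 v i)

/-- The highest-order seminorm in `sobolevSq` as the integral of a density. The two assertions are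
the remainder bounds that it provides on star-shaped sets. -/
theorem exists_density {n : ℕ} {Ω : Set (Eu n)} {s : ℝ} (hs : 0 < s) {R : ℝ} (hR : 0 < R)
    {D : (j : ℕ) → (Fin j → Fin n) → L2 Ω} {V : Multiset (Fin n) → Eu n → ℝ}
    (hVm : ∀ s, Measurable (V s)) (hV : ∀ s, MemLp (V s) 2 (volume.restrict Ω))
    (hw : ∀ t i, t.card < ⌊1 + s⌋₊ → IsWeakDeriv Ω i (V t) (V (i ::ₘ t)))
    (hVD : ∀ s, ∃ I : Fin s.card → Fin n, V s = D s.card I) (hΩ : MeasurableSet Ω) :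
    ∃ G : Eu n → ℝ≥0∞, Measurable G ∧ ∫⁻ x in Ω, G x ≤ sobolevExpr Ω (1 + s) D ∧
      ∀ {z b : Eu n} {h : ℝ} {U : Set (Eu n)}, IsStarNbhd Ω z h R b U → 0 < h →
        ∀ (t : Multiset (Fin n)) (a : ℝ), t.card = ⌈s⌉₊ →
          ∫ x in Metric.ball b h, (V t x - a) = 0 →
          ∫⁻ x in U, ‖V t x - a‖ₑ ^ 2
            ≤ ENNReal.ofReal ((n * poincareConst n R + (2 * R) ^ (n + 2 * (1 + s - ⌈s⌉₊))
              / volume.real (Metric.ball (0 : Eu n) 1)) * h ^ (2 * (1 + s - ⌈s⌉₊)))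
              * ∫⁻ x in U, G x := by
  have hP := poincareConst_nonneg n hR.le
  have hω := volume_real_unitBall_pos n
  have hconst : ∀ {U : Set (Eu n)} (a : ℝ), Bornology.IsBounded U →
      MemLp (fun _ : Eu n => a) 2 (volume.restrict U) := by
    intro U a hU
    have h1 : (fun _ : Eu n => a) = evalE (MvPolynomial.C a) := by ext; simp [evalE]
    rw [h1]
    exact memLp_evalE hU _
  by_cases hfr : Int.fract (1 + s) = 0
  · -- integer order: Poincaré's inequality once more
    have hfl : (⌊1 + s⌋₊ : ℝ) = 1 + s := by
      rw [natCast_floor_eq_intCast_floor (by linarith)]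
      have := Int.floor_add_fract (1 + s)
      linarith
    have hd : ⌊1 + s⌋₊ = ⌈s⌉₊ + 1 := by
      have h1 : s = ((⌊1 + s⌋₊ - 1 : ℕ) : ℝ) := by
        rw [Nat.cast_sub (Nat.le_floor (by simp; linarith)), hfl]; simp
      have h2 : ⌈s⌉₊ = ⌊1 + s⌋₊ - 1 := by
        conv_lhs => rw [h1]
        exact Nat.ceil_natCast _
      have h3 : 1 ≤ ⌊1 + s⌋₊ := Nat.le_floor (by simp; linarith)
      omega
    have hτ : 1 + s - (⌈s⌉₊ : ℝ) = 1 := by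
      rw [hd] at hfl
      push_cast at hfl
      linarith
    refine ⟨fun x => ∑ I : Fin ⌊1 + s⌋₊ → Fin n, ‖D ⌊1 + s⌋₊ I x‖ₑ ^ 2, ?_, ?_, ?_⟩
    · exact Finset.measurable_sum _ fun I _ =>
        (Lp.stronglyMeasurable (D _ I)).measurable.enorm.pow_const 2
    · rw [lintegral_finsetSum _ fun I _ =>
        (Lp.stronglyMeasurable (D _ I)).measurable.enorm.pow_const 2]
      simp only [← lp_enorm_sq]
      refine le_trans ?_ le_self_add
      exact Finset.single_le_sum (f := fun j => ∑ I : Fin j → Fin n, ‖D j I‖ₑ ^ 2)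
        (fun _ _ => zero_le) (Finset.mem_range.2 (Nat.lt_succ_self _))
    · intro z b h U hU hh t a ht h0
      have hUΩ : U ⊆ Ω := hU.subset_near.trans inter_subset_left
      have hUb : Bornology.IsBounded U :=
        Metric.isBounded_ball.subset (hU.subset_near.trans inter_subset_right)
      have hVU : MemLp (V t) 2 (volume.restrict U) :=
        (hV t).mono_measure (Measure.restrict_mono hUΩ le_rfl)
      have hwd : ∀ i, IsWeakDeriv U i (fun x => V t x - a) (V (i ::ₘ t)) := by
        intro i
        have h1 := (hw t i (by omega)).mono hΩ hUΩ
        have h2 := isWeakDeriv_evalE U i (MvPolynomial.C a)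
        have h3 := h1.sub hVU (memLp_evalE hUb _)
          ((hV (i ::ₘ t)).mono_measure (Measure.restrict_mono hUΩ le_rfl)) (memLp_evalE hUb _) h2
        simpa [evalE] using h3
      refine (hU.poincare_mean_zero hh hR ((hVm t).sub_const a) (hVU.sub (hconst a hUb))
        (fun i => hVm (i ::ₘ t)) hwd h0).trans ?_
      have hsum : ∫⁻ x in U, ∑ i, ‖V (i ::ₘ t) x‖ₑ ^ 2
          ≤ n * ∫⁻ x in U, ∑ I : Fin ⌊1 + s⌋₊ → Fin n, ‖D ⌊1 + s⌋₊ I x‖ₑ ^ 2 := by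
        rw [← lintegral_const_mul' _ _ (by simp)]
        refine lintegral_mono fun x => ?_
        have : ∀ i ∈ (Finset.univ : Finset (Fin n)), ‖V (i ::ₘ t) x‖ₑ ^ 2
            ≤ ∑ I : Fin ⌊1 + s⌋₊ → Fin n, ‖D ⌊1 + s⌋₊ I x‖ₑ ^ 2 := by
          intro i _
          have hc : (i ::ₘ t).card = ⌊1 + s⌋₊ := by rw [Multiset.card_cons, ht, hd]
          obtain ⟨I, hI⟩ := hVD (i ::ₘ t)
          rw [hI, ← hc]
          exact Finset.single_le_sum (f := fun I => ‖D (i ::ₘ t).card I x‖ₑ ^ 2)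
            (fun _ _ => zero_le) (Finset.mem_univ I)
        refine (Finset.sum_le_sum this).trans (le_of_eq ?_)
        simp
      refine (mul_le_mul_right hsum _).trans ?_
      rw [← mul_assoc, ← ENNReal.ofReal_natCast n, ← ENNReal.ofReal_mul (by positivity), hτ]
      refine mul_le_mul_left (ENNReal.ofReal_le_ofReal ?_) _
      rw [mul_one, Real.rpow_two]
      have : 0 ≤ (2 * R) ^ (n + 2 * 1 : ℝ) / volume.real (Metric.ball (0 : Eu n) 1) := by positivity
      nlinarith [mul_nonneg this (sq_nonneg h)]
  · -- fractional order
    have hfloor : ⌊1 + s⌋₊ = ⌊s⌋₊ + 1 := by rw [add_comm, Nat.floor_add_one hs.le]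
    have hfr' : Int.fract s ≠ 0 := by
      rwa [show (1 : ℝ) + s = s + 1 by ring, Int.fract_add_one] at hfr
    have hceil : ⌈s⌉₊ = ⌊s⌋₊ + 1 := by
      refine le_antisymm (Nat.ceil_le_floor_add_one s) ?_
      rw [Nat.add_one_le_iff, Nat.lt_ceil]
      refine lt_of_le_of_ne (Nat.floor_le hs.le) fun h => hfr' ?_
      rw [← h]
      exact Int.fract_natCast _
    have hd : ⌈s⌉₊ = ⌊1 + s⌋₊ := by rw [hfloor, hceil]
    have hτ : 1 + s - (⌈s⌉₊ : ℝ) = Int.fract (1 + s) := by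
      rw [hd, Int.fract, natCast_floor_eq_intCast_floor (by linarith)]
    have hKm : ∀ I : Fin ⌊1 + s⌋₊ → Fin n, Measurable fun x => ∫⁻ y in Ω,
        ENNReal.ofReal ((D ⌊1 + s⌋₊ I x - D ⌊1 + s⌋₊ I y) ^ 2
          / ‖x - y‖ ^ ((n : ℝ) + 2 * Int.fract (1 + s))) := by
      intro I
      have hDm := (Lp.stronglyMeasurable (D ⌊1 + s⌋₊ I)).measurable
      refine Measurable.lintegral_prod_right' (f := fun p : Eu n × Eu n =>
        ENNReal.ofReal ((D ⌊1 + s⌋₊ I p.1 - D ⌊1 + s⌋₊ I p.2) ^ 2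
          / ‖p.1 - p.2‖ ^ ((n : ℝ) + 2 * Int.fract (1 + s)))) ?_
      fun_prop
    refine ⟨fun x => ∑ I : Fin ⌊1 + s⌋₊ → Fin n, ∫⁻ y in Ω,
        ENNReal.ofReal ((D ⌊1 + s⌋₊ I x - D ⌊1 + s⌋₊ I y) ^ 2
          / ‖x - y‖ ^ ((n : ℝ) + 2 * Int.fract (1 + s))),
        Finset.measurable_sum _ fun I _ => hKm I, ?_, ?_⟩
    · rw [lintegral_finsetSum _ fun I _ => hKm I, sobolevExpr, if_neg hfr]
      exact le_add_self
    · intro z b h U hU hh t a ht h0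
      have hUΩ : U ⊆ Ω := hU.subset_near.trans inter_subset_left
      have hBΩ := hU.ball_subset.trans hUΩ
      have hfin : IsFiniteMeasure (volume.restrict (Metric.ball b h)) :=
        ⟨by rw [Measure.restrict_apply_univ]; exact measure_ball_lt_top⟩
      have hint : IntegrableOn (fun x => V t x - a) (Metric.ball b h) :=
        (((hV t).mono_measure (Measure.restrict_mono hBΩ le_rfl)).integrable
          (by norm_num)).sub (integrable_const a)
      have hfn : 0 ≤ Int.fract (1 + s) := Int.fract_nonneg _
      refine (hU.slobodeckij_mean_zero hh hR hfn ((hVm t).sub_const a) hint h0).trans ?_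
      rw [hτ]
      refine mul_le_mul' (ENNReal.ofReal_le_ofReal ?_) (lintegral_mono fun x => ?_)
      · gcongr
        have : 0 ≤ n * poincareConst n R := by positivity
        linarith
      · have hc : t.card = ⌊1 + s⌋₊ := by rw [ht, hd]
        obtain ⟨I, hI⟩ := hVD t
        simp only [sub_sub_sub_cancel_right]
        rw [hI, ← hc]
        exact Finset.single_le_sum (f := fun I => ∫⁻ y in Ω,
          ENNReal.ofReal ((D t.card I x - D t.card I y) ^ 2
          / ‖x - y‖ ^ ((n : ℝ) + 2 * Int.fract (1 + s)))) (fun _ _ => zero_le) (Finset.mem_univ I)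

set_option maxHeartbeats 1000000 in
/-- Local approximation of `H^{1+s}` functions by polynomials of degree at most `⌈s⌉`. All means of the
derivatives of order at most `⌈s⌉` of the error vanish, so that the Poincaré inequality can be
iterated. -/
theorem IsBoundedLipschitzDomain.exists_local_poly {n : ℕ} {Ω : Set (Eu n)}
    (hΩ : IsBoundedLipschitzDomain Ω) {s : ℝ} (hs : 0 < s) :
    ∃ h₀ R C : ℝ, 0 < h₀ ∧ 3 ≤ R ∧ 0 ≤ C ∧ ∀ (v : H1 Ω) (D : (j : ℕ) → (Fin j → Fin n) → L2 Ω),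
      (∀ j ≤ ⌊1 + s⌋₊, ∀ I : Fin j → Fin n, IsWeakPartial Ω I (toL2 Ω v) (D j I)) →
      ∃ G : Eu n → ℝ≥0∞, Measurable G ∧ ∫⁻ x in Ω, G x ≤ sobolevExpr Ω (1 + s) D ∧
        ∀ z ∈ closure Ω, ∀ h : ℝ, 0 < h → h < h₀ →
          ∃ q : MvPolynomial (Fin n) ℝ, q.totalDegree ≤ ⌈s⌉₊ ∧
            ∫⁻ x in Ω ∩ Metric.ball z (3 * h), ‖toL2 Ω v x - evalE q x‖ₑ ^ 2
              ≤ ENNReal.ofReal (C * h ^ (2 * (1 + s)))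
                * ∫⁻ x in Ω ∩ Metric.ball z (R * h), G x ∧
            ∀ i, ∫⁻ x in Ω ∩ Metric.ball z (3 * h),
                ‖grad Ω v x i - evalE (MvPolynomial.pderiv i q) x‖ₑ ^ 2
              ≤ ENNReal.ofReal (C * h ^ (2 * s))
                * ∫⁻ x in Ω ∩ Metric.ball z (R * h), G x := by
  obtain ⟨h₀, R, hh₀, hR3, hstar⟩ := hΩ.exists_starShaped
  have hR : 0 < R := by linarith
  have hP := poincareConst_nonneg n hR.le
  have hω := volume_real_unitBall_pos n
  set K : ℝ := n * poincareConst n R with hK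
  set T : ℝ := n * poincareConst n R + (2 * R) ^ (n + 2 * (1 + s - ⌈s⌉₊))
    / volume.real (Metric.ball (0 : Eu n) 1) with hT
  have hK0 : 0 ≤ K := by positivity
  have hT0 : 0 ≤ T := by positivity
  obtain ⟨d, hd⟩ : ∃ d, ⌈s⌉₊ = d + 1 := ⟨⌈s⌉₊ - 1, by have := Nat.ceil_pos.2 hs; omega⟩
  have hdm : ⌈s⌉₊ ≤ ⌊1 + s⌋₊ := by
    rw [add_comm, Nat.floor_add_one hs.le]
    exact Nat.ceil_le_floor_add_one s
  refine ⟨h₀, R, (K ^ (d + 1) + K ^ d) * T, hh₀, hR3, by positivity, fun v D hD => ?_⟩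
  obtain ⟨V, hVm, hV, hw, hV0, hV1, hVD⟩ := exists_weakDeriv_family hΩ.isOpen v (by omega) hD
  obtain ⟨G, hGm, hGD, hG⟩ := exists_density hs hR hVm hV (fun t i h => hw t i h) hVD
    hΩ.isOpen.measurableSet
  refine ⟨G, hGm, hGD, fun z hz h hh hhh₀ => ?_⟩
  obtain ⟨b, U, hU⟩ := hstar z hz h hh hhh₀
  have hUΩ : U ⊆ Ω := hU.subset_near.trans inter_subset_left
  have hUb : Bornology.IsBounded U :=
    Metric.isBounded_ball.subset (hU.subset_near.trans inter_subset_right)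
  have hVU : ∀ t, MemLp (V t) 2 (volume.restrict U) := fun t =>
    (hV t).mono_measure (Measure.restrict_mono hUΩ le_rfl)
  have hfin : IsFiniteMeasure (volume.restrict (Metric.ball b h)) :=
    ⟨by rw [Measure.restrict_apply_univ]; exact measure_ball_lt_top⟩
  obtain ⟨q, hqd, hq⟩ := exists_poly_integral_eq (Metric.isBounded_ball (x := b) (r := h))
    (Metric.measure_ball_pos _ _ hh).ne' ⌈s⌉₊ (fun t => ∫ x in Metric.ball b h, V t x)
  set W : Multiset (Fin n) → Eu n → ℝ := fun t x => V t x - evalE (polyD t q) x with hWdef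
  have hWm : ∀ t, Measurable (W t) := fun t =>
    (hVm t).sub (contDiff_evalE _).continuous.measurable
  have hWU : ∀ t, MemLp (W t) 2 (volume.restrict U) := fun t =>
    (hVU t).sub (memLp_evalE hUb _)
  have hWw : ∀ t, t.card < ⌈s⌉₊ → ∀ i, IsWeakDeriv U i (W t) (W (i ::ₘ t)) := by
    intro t ht i
    refine ((hw t i (by omega)).mono hΩ.isOpen.measurableSet hUΩ).sub (hVU t) (memLp_evalE hUb _)
      (hVU _) (memLp_evalE hUb _) ?_
    rw [polyD_cons]
    exact isWeakDeriv_evalE U i _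
  have hW0 : ∀ t, t.card ≤ ⌈s⌉₊ → ∫ x in Metric.ball b h, W t x = 0 := by
    intro t ht
    have h1 : IntegrableOn (V t) (Metric.ball b h) :=
      ((hVU t).mono_measure (Measure.restrict_mono hU.ball_subset le_rfl)).integrable (by norm_num)
    have h2 : IntegrableOn (evalE (polyD t q)) (Metric.ball b h) :=
      (memLp_evalE Metric.isBounded_ball _).integrable (by norm_num)
    rw [hWdef, integral_sub h1 h2, hq t ht, sub_self]
  have htop : ∀ t, t.card = ⌈s⌉₊ → ∫⁻ x in U, ‖W t x‖ₑ ^ 2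
      ≤ ENNReal.ofReal (T * h ^ (2 * (1 + s - ⌈s⌉₊))) * ∫⁻ x in U, G x := by
    intro t ht
    obtain ⟨a, ha⟩ := polyD_eq_C t q (by omega)
    have hWa : W t = fun x => V t x - a := by
      ext x
      simp [hWdef, ha, evalE]
    rw [hWa]
    refine hG hU hh t a ht ?_
    rw [← hWa]
    exact hW0 t ht.le
  have hGU : ∫⁻ x in U, G x ≤ ∫⁻ x in Ω ∩ Metric.ball z (R * h), G x :=
    lintegral_mono_set hU.subset_near
  -- the powers of `h` add up
  have hpow : ∀ (j : ℕ) (A : ℝ), K ^ j ≤ A → ∀ t : Multiset (Fin n), t.card + j = ⌈s⌉₊ →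
      ∫⁻ x in Ω ∩ Metric.ball z (3 * h), ‖W t x‖ₑ ^ 2
        ≤ ENNReal.ofReal (A * T * h ^ (2 * (j + 1 + s - ⌈s⌉₊)))
          * ∫⁻ x in Ω ∩ Metric.ball z (R * h), G x := by
    intro j A hA t ht
    refine (lintegral_mono_set hU.near_subset).trans ?_
    refine (hU.poincare_iterate hh hR hWm (fun t _ => hWU t) hWw (fun t ht => hW0 t ht.le) htop j t
      ht).trans ?_
    rw [← mul_assoc, ← ENNReal.ofReal_mul (by positivity)]
    refine mul_le_mul' (ENNReal.ofReal_le_ofReal ?_) hGU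
    have h1 : h ^ (2 * (j + 1 + s - ⌈s⌉₊)) = (h ^ 2) ^ j * h ^ (2 * (1 + s - ⌈s⌉₊)) := by
      rw [← pow_mul, ← Real.rpow_natCast, ← Real.rpow_add hh]
      congr 1
      push_cast
      ring
    rw [h1, mul_pow]
    calc K ^ j * (h ^ 2) ^ j * (T * h ^ (2 * (1 + s - ⌈s⌉₊)))
        = K ^ j * T * ((h ^ 2) ^ j * h ^ (2 * (1 + s - ⌈s⌉₊))) := by ring
      _ ≤ _ := by gcongr
  refine ⟨q, hqd, ?_, fun i => ?_⟩
  · have h1 := hpow (d + 1) (K ^ (d + 1) + K ^ d) (by nlinarith [pow_nonneg hK0 d]) 0 (by simp [hd])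
    rw [show 2 * ((d + 1 : ℕ) + 1 + s - (⌈s⌉₊ : ℝ)) = 2 * (1 + s) by rw [hd]; ring] at h1
    refine le_trans (le_of_eq (lintegral_congr_ae ?_)) h1
    filter_upwards [ae_restrict_of_ae_restrict_of_subset inter_subset_left hV0] with x hx
    simp only [hWdef, polyD_zero, hx]
  · have h1 := hpow d (K ^ (d + 1) + K ^ d) (by nlinarith [pow_nonneg hK0 (d + 1)]) {i} (by simp [hd]; ring)
    rw [show 2 * ((d : ℝ) + 1 + s - (⌈s⌉₊ : ℝ)) = 2 * s by rw [hd]; push_cast; ring] at h1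
    refine le_trans (le_of_eq (lintegral_congr_ae ?_)) h1
    filter_upwards [ae_restrict_of_ae_restrict_of_subset inter_subset_left (hV1 i)] with x hx
    have : polyD {i} q = MvPolynomial.pderiv i q := polyD_cons i 0 q
    simp only [hWdef, hx, this]

end Nudging

namespace Nudging

open scoped Topology
open Filter

/-! ### The faces of the reference cell -/

/-- The facets of the reference cell: for the simplex, `some i` stands for `x_i = 0` and `none` for
`∑ x_i = 1`; for the cube, `(i, true)` stands for `x_i = 0` and `(i, false)` for `x_i = 1`. -/
def Facet (n : ℕ) : CellShape → Type
  | .simplex => Option (Fin n)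
  | .cube => Fin n × Bool

instance {n : ℕ} : (shape : CellShape) → Fintype (Facet n shape)
  | .simplex => inferInstanceAs (Fintype (Option (Fin n)))
  | .cube => inferInstanceAs (Fintype (Fin n × Bool))

instance {n : ℕ} : (shape : CellShape) → DecidableEq (Facet n shape)
  | .simplex => inferInstanceAs (DecidableEq (Option (Fin n)))
  | .cube => inferInstanceAs (DecidableEq (Fin n × Bool))

/-- The `i`-th coordinate as an affine function. -/
noncomputable def coordAff {n : ℕ} (i : Fin n) : Eu n →ᵃ[ℝ] ℝ :=
  (EuclideanSpace.proj (𝕜 := ℝ) i : Eu n →L[ℝ] ℝ).toLinearMap.toAffineMap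

/-- The affine function that vanishes on a facet and whose maximum over the reference cell is `1`. -/
noncomputable def lam {n : ℕ} : {shape : CellShape} → Facet n shape → (Eu n →ᵃ[ℝ] ℝ)
  | .simplex, some i => coordAff i
  | .simplex, none => AffineMap.const ℝ (Eu n) 1 - ∑ i, coordAff i
  | .cube, (i, true) => coordAff i
  | .cube, (i, false) => AffineMap.const ℝ (Eu n) 1 - coordAff i

/-- The polynomial of degree one that represents `lam ℓ`. -/
noncomputable def facetPoly {n : ℕ} : {shape : CellShape} → Facet n shape → MvPolynomial (Fin n) ℝ
  | .simplex, some i => MvPolynomial.X i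
  | .simplex, none => 1 - ∑ i, MvPolynomial.X i
  | .cube, (i, true) => MvPolynomial.X i
  | .cube, (i, false) => 1 - MvPolynomial.X i

theorem sum_coordAff_apply {n : ℕ} (x : Eu n) :
    (∑ i, coordAff i : Eu n →ᵃ[ℝ] ℝ) x = ∑ i, x i := by
  have : ∀ t : Finset (Fin n), (∑ i ∈ t, coordAff i : Eu n →ᵃ[ℝ] ℝ) x = ∑ i ∈ t, x i := by
    intro t
    induction t using Finset.induction_on with
    | empty => simp
    | insert i t hi ih => rw [Finset.sum_insert hi, Finset.sum_insert hi, ← ih]; rfl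
  exact this _

@[simp] theorem lam_simplex_some {n : ℕ} (i : Fin n) (x : Eu n) :
    lam (shape := .simplex) (some i) x = x i := rfl

@[simp] theorem lam_simplex_none {n : ℕ} (x : Eu n) :
    lam (shape := .simplex) none x = 1 - ∑ i, x i := by
  rw [← sum_coordAff_apply]; rfl

@[simp] theorem lam_cube_true {n : ℕ} (i : Fin n) (x : Eu n) :
    lam (shape := .cube) (i, true) x = x i := rfl

@[simp] theorem lam_cube_false {n : ℕ} (i : Fin n) (x : Eu n) :
    lam (shape := .cube) (i, false) x = 1 - x i := rfl

theorem evalE_facetPoly {n : ℕ} {shape : CellShape} (ℓ : Facet n shape) (x : Eu n) :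
    evalE (facetPoly ℓ) x = lam ℓ x := by
  cases shape with
  | simplex =>
    rcases ℓ with _ | i
    · exact Eq.trans (by simp [evalE, facetPoly]) (lam_simplex_none x).symm
    · exact MvPolynomial.eval_X i
  | cube =>
    obtain ⟨i, b⟩ := ℓ
    cases b <;> simp [evalE, facetPoly]

theorem continuous_lam {n : ℕ} {shape : CellShape} (ℓ : Facet n shape) :
    Continuous fun x => lam ℓ x := (lam ℓ).continuous_of_finiteDimensional

theorem mem_refCell_iff {n : ℕ} {shape : CellShape} {x : Eu n} :
    x ∈ refCell n shape ↔ ∀ ℓ : Facet n shape, 0 ≤ lam ℓ x := by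
  cases shape with
  | simplex =>
    refine ⟨fun h ℓ => ?_, fun h => ⟨fun i => h (some i), ?_⟩⟩
    · rcases ℓ with _ | i
      · refine (lam_simplex_none x).symm ▸ ?_
        linarith [h.2]
      · exact h.1 i
    · have := h none
      rw [show lam (shape := .simplex) (none : Option (Fin n)) x = _ from lam_simplex_none x] at this
      linarith
  | cube =>
    refine ⟨fun h ℓ => ?_, fun h i => ⟨h (i, true), ?_⟩⟩
    · obtain ⟨i, b⟩ := ℓ
      cases b
      · have := (h i).2
        simp only [lam_cube_false]; linarith
      · exact (h i).1
    · have := h (i, false)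
      simp only [lam_cube_false] at this; linarith

/-- The sum of all facet functions, a constant. -/
def facetSum (n : ℕ) : CellShape → ℕ
  | .simplex => 1
  | .cube => n

theorem sum_lam {n : ℕ} {shape : CellShape} (x : Eu n) :
    ∑ ℓ : Facet n shape, lam ℓ x = facetSum n shape := by
  cases shape with
  | simplex =>
    refine (Fintype.sum_option (fun ℓ : Option (Fin n) => lam (shape := .simplex) ℓ x)).trans ?_
    rw [lam_simplex_none]
    simp [facetSum]
  | cube =>
    refine (Fintype.sum_prod_type (fun ℓ : Fin n × Bool => lam (shape := .cube) ℓ x)).trans ?_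
    simp [facetSum]

theorem lam_ext {n : ℕ} {shape : CellShape} {x y : Eu n}
    (h : ∀ ℓ : Facet n shape, lam ℓ x = lam ℓ y) : x = y := by
  ext i
  cases shape with
  | simplex => exact h (some i)
  | cube => exact h (i, true)

theorem lam_le_one {n : ℕ} {shape : CellShape} {x : Eu n} (hx : x ∈ refCell n shape)
    (ℓ : Facet n shape) : lam ℓ x ≤ 1 := by
  cases shape with
  | simplex =>
    have h1 : ∑ ℓ : Facet n .simplex, lam ℓ x = 1 := by rw [sum_lam]; simp [facetSum]
    rw [← h1]
    exact Finset.single_le_sum (f := fun ℓ : Facet n .simplex => lam ℓ x)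
      (fun ℓ _ => mem_refCell_iff.1 hx ℓ) (Finset.mem_univ ℓ)
  | cube =>
    obtain ⟨i, b⟩ := ℓ
    cases b
    · simp only [lam_cube_false]; linarith [(hx i).1]
    · exact (hx i).2

theorem affine_combo {n : ℕ} {F : Type*} [AddCommGroup F] [Module ℝ F] (B : Eu n →ᵃ[ℝ] F)
    {a b : ℝ} (hab : a + b = 1) (x y : Eu n) : B (a • x + b • y) = a • B x + b • B y :=
  Convex.combo_affine_apply hab

theorem convex_refCell {n : ℕ} {shape : CellShape} : Convex ℝ (refCell n shape) := by
  intro x hx y hy a b ha hb hab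
  rw [mem_refCell_iff] at hx hy ⊢
  intro ℓ
  rw [affine_combo _ hab]
  exact add_nonneg (mul_nonneg ha (hx ℓ)) (mul_nonneg hb (hy ℓ))

theorem isClosed_refCell {n : ℕ} {shape : CellShape} : IsClosed (refCell n shape) := by
  have : refCell n shape = ⋂ ℓ : Facet n shape, {x | 0 ≤ lam ℓ x} := by
    ext x; simp [mem_refCell_iff]
  rw [this]
  exact isClosed_iInter fun ℓ => isClosed_le continuous_const (continuous_lam ℓ)

theorem coord_mem_Icc_of_mem_refCell {n : ℕ} {shape : CellShape} {x : Eu n}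
    (hx : x ∈ refCell n shape) (i : Fin n) : 0 ≤ x i ∧ x i ≤ 1 := by
  cases shape with
  | simplex => exact ⟨mem_refCell_iff.1 hx (some i), lam_le_one hx (some i)⟩
  | cube => exact hx i

theorem isCompact_refCell {n : ℕ} {shape : CellShape} : IsCompact (refCell n shape) := by
  refine Metric.isCompact_of_isClosed_isBounded isClosed_refCell ?_
  refine (Metric.isBounded_closedBall (x := (0 : Eu n)) (r := √n)).subset fun x hx => ?_
  rw [mem_closedBall_zero_iff, EuclideanSpace.norm_eq]
  refine Real.sqrt_le_sqrt ?_
  calc ∑ i, ‖x i‖ ^ 2 ≤ ∑ _i : Fin n, (1 : ℝ) := Finset.sum_le_sum fun i _ => by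
        have := coord_mem_Icc_of_mem_refCell hx i
        rw [Real.norm_eq_abs, abs_of_nonneg this.1]
        nlinarith
    _ = n := by simp

/-- The vertices of the reference cell. -/
def IsVertex {n : ℕ} (shape : CellShape) (x : Eu n) : Prop :=
  ∀ ℓ : Facet n shape, lam ℓ x = 0 ∨ lam ℓ x = 1

theorem IsVertex.mem {n : ℕ} {shape : CellShape} {x : Eu n} (hx : IsVertex shape x) :
    x ∈ refCell n shape :=
  mem_refCell_iff.2 fun ℓ => by rcases hx ℓ with h | h <;> rw [h]; exact zero_le_one

/-- If `x + v` and `x - v` lie in the cell and `x` in an exposed face, then `x + v` lies in that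
face. -/
theorem add_mem_of_isExposed {n : ℕ} {P f : Set (Eu n)} (hf : IsExposed ℝ P f) {x v : Eu n}
    (hx : x ∈ f) (h1 : x + v ∈ P) (h2 : x - v ∈ P) : x + v ∈ f := by
  obtain ⟨l, rfl⟩ := hf ⟨x, hx⟩
  refine ⟨h1, fun y hy => (hx.2 y hy).trans ?_⟩
  have := hx.2 _ h2
  simp only [map_sub, map_add] at this ⊢
  linarith

theorem affine_add_smul_sub {n : ℕ} (f : Eu n →ᵃ[ℝ] ℝ) (x a b : Eu n) (ε : ℝ) :
    f (x + ε • (a - b)) = f x + ε * (f a - f b) := by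
  have h1 : f (x + ε • (a - b)) = f.linear (ε • (a - b)) + f x := by
    rw [add_comm]; exact f.map_vadd x _
  have h2 : f.linear (a - b) = f a - f b := f.linearMap_vsub a b
  rw [h1, map_smul, h2, smul_eq_mul]
  ring

/-- The vertex of the simplex opposite to a facet. -/
noncomputable def simplexVertex {n : ℕ} : Option (Fin n) → Eu n
  | some i => coordVec i
  | none => 0

theorem lam_simplexVertex {n : ℕ} (ℓ m : Option (Fin n)) :
    lam (shape := .simplex) ℓ (simplexVertex m) = if ℓ = m then 1 else 0 := by
  rcases ℓ with _ | i <;> rcases m with _ | j <;>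
    simp only [lam_simplex_none, lam_simplex_some, simplexVertex] <;> simp [coordVec, eq_comm]

/-- Points that are not vertices are midpoints of segments in the cell. -/
theorem exists_add_sub_mem {n : ℕ} {shape : CellShape} {x : Eu n} (hx : x ∈ refCell n shape)
    (hv : ¬IsVertex shape x) :
    ∃ v : Eu n, v ≠ 0 ∧ x + v ∈ refCell n shape ∧ x - v ∈ refCell n shape := by
  simp only [IsVertex, not_forall, not_or] at hv
  obtain ⟨ℓ, h0, h1⟩ := hv
  have hpos : 0 < lam ℓ x := lt_of_le_of_ne (mem_refCell_iff.1 hx ℓ) (Ne.symm h0)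
  have hlt : lam ℓ x < 1 := lt_of_le_of_ne (lam_le_one hx ℓ) h1
  cases shape with
  | simplex =>
    have hsum : ∑ m : Facet n .simplex, lam m x = 1 := by rw [sum_lam]; simp [facetSum]
    obtain ⟨m, hmℓ, hm⟩ : ∃ m : Facet n .simplex, m ≠ ℓ ∧ 0 < lam m x := by
      by_contra! hcon
      rw [Finset.sum_eq_single ℓ (fun m _ hm => le_antisymm (hcon m hm) (mem_refCell_iff.1 hx m))
        (by simp)] at hsum
      exact hlt.ne hsum
    -- move mass from one barycentric coordinate to another
    set ε := min (lam ℓ x) (lam m x) with hε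
    have hε0 : 0 < ε := lt_min hpos hm
    have hval : ∀ (τ : ℝ) (p : Facet n .simplex), lam p (x + τ • (simplexVertex ℓ - simplexVertex m))
        = lam p x + τ * ((if p = ℓ then 1 else 0) - if p = m then 1 else 0) := by
      intro τ p
      rw [affine_add_smul_sub]
      congr 2
      exact congrArg₂ (· - ·) (lam_simplexVertex p ℓ) (lam_simplexVertex p m)
    have hmem : ∀ τ : ℝ, |τ| ≤ ε → x + τ • (simplexVertex ℓ - simplexVertex m)
        ∈ refCell n .simplex := by
      intro τ hτ
      rw [mem_refCell_iff]
      intro p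
      rw [hval]
      obtain ⟨h1, h2⟩ := abs_le.1 hτ
      have h3 : ε ≤ lam ℓ x := min_le_left _ _
      have h4 : ε ≤ lam m x := min_le_right _ _
      have h5 := mem_refCell_iff.1 hx p
      by_cases hpℓ : p = ℓ
      · subst hpℓ
        rw [if_pos rfl, if_neg (Ne.symm hmℓ)]
        linarith
      · by_cases hpm : p = m
        · subst hpm
          rw [if_neg hpℓ, if_pos rfl]
          linarith
        · rw [if_neg hpℓ, if_neg hpm]
          linarith
    refine ⟨ε • (simplexVertex ℓ - simplexVertex m), fun h => ?_,
      hmem ε (abs_of_pos hε0).le, ?_⟩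
    · have := hval ε ℓ
      rw [h, add_zero, if_pos rfl, if_neg (Ne.symm hmℓ)] at this
      linarith
    · have := hmem (-ε) (by rw [abs_neg, abs_of_pos hε0])
      rwa [neg_smul, ← sub_eq_add_neg] at this
  | cube =>
    obtain ⟨i, b⟩ := ℓ
    have hi : 0 < x i ∧ x i < 1 := by
      cases b
      · simp only [lam_cube_false] at hpos hlt
        constructor <;> linarith
      · exact ⟨hpos, hlt⟩
    set ε := min (x i) (1 - x i) with hε
    have hε0 : 0 < ε := lt_min hi.1 (by linarith [hi.2])
    have hmem : ∀ τ : ℝ, |τ| ≤ ε → x + τ • coordVec i ∈ refCell n .cube := by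
      intro τ hτ j
      obtain ⟨h1, h2⟩ := abs_le.1 hτ
      have h3 : ε ≤ x i := min_le_left _ _
      have h4 : ε ≤ 1 - x i := min_le_right _ _
      by_cases hj : j = i
      · subst hj
        simp only [coordVec, PiLp.add_apply, PiLp.smul_apply, PiLp.single_apply, if_true,
          smul_eq_mul, mul_one]
        constructor <;> linarith
      · simpa [coordVec, hj] using hx j
    refine ⟨ε • coordVec i, fun h => ?_, hmem ε (abs_of_pos hε0).le, ?_⟩
    · have := congrArg (fun v : Eu n => v i) h
      simp [coordVec] at this
      exact hε0.ne' this
    · have := hmem (-ε) (by rw [abs_neg, abs_of_pos hε0])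
      rwa [neg_smul, ← sub_eq_add_neg] at this

/-- A face of the cell is the closed convex hull of the vertices it contains, so affine functions on
it are determined by their values there. -/
theorem eqOn_face_of_vertices {n : ℕ} {shape : CellShape} {f : Set (Eu n)}
    (hf : IsExposed ℝ (refCell n shape) f) {ψ χ : Eu n →ᵃ[ℝ] ℝ}
    (h : ∀ v ∈ f, IsVertex shape v → ψ v = χ v) : ∀ x ∈ f, ψ x = χ x := by
  have hcomp : IsCompact f := hf.isCompact isCompact_refCell
  have hconv : Convex ℝ f := hf.convex convex_refCell
  have hclosed : IsClosed {x | ψ x = χ x} := isClosed_eq ψ.continuous_of_finiteDimensional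
    χ.continuous_of_finiteDimensional
  have hcvx : Convex ℝ {x | ψ x = χ x} := by
    intro x hx y hy a b _ _ hab
    simp only [mem_ofPred_eq] at hx hy ⊢
    rw [affine_combo _ hab, affine_combo _ hab, hx, hy]
  have hsub : closure (convexHull ℝ (f.extremePoints ℝ)) ⊆ {x | ψ x = χ x} := by
    refine closure_minimal (convexHull_min ?_ hcvx) hclosed
    intro v hv
    refine h v hv.1 ?_
    by_contra hnv
    obtain ⟨w, hw0, hw1, hw2⟩ := exists_add_sub_mem (hf.subset hv.1) hnv
    have h1 := add_mem_of_isExposed hf hv.1 hw1 hw2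
    have h2 := add_mem_of_isExposed hf hv.1 (v := -w) (by rwa [← sub_eq_add_neg])
      (by rwa [sub_neg_eq_add])
    have := hv.2 h1 h2 ⟨1 / 2, 1 / 2, by norm_num, by norm_num, by norm_num, by module⟩
    exact hw0 (by simpa using this)
  rw [closure_convexHull_extremePoints hcomp hconv] at hsub
  exact fun x hx => hsub hx

end Nudging

namespace Nudging

open scoped Topology
open Filter

/-- An affine bijection between two faces maps vertices to vertices. -/
theorem isVertex_map {n : ℕ} {shape : CellShape} {f g : Set (Eu n)}
    (hg : IsExposed ℝ (refCell n shape) g) (hf : IsExposed ℝ (refCell n shape) f)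
    {B : Eu n ≃ᵃ[ℝ] Eu n} (hB : B '' f = g) {v : Eu n} (hv : v ∈ f) (hvv : IsVertex shape v) :
    IsVertex shape (B v) := by
  by_contra hn
  have hBv : B v ∈ g := hB ▸ mem_image_of_mem B hv
  obtain ⟨w, hw0, hw1, hw2⟩ := exists_add_sub_mem (hg.subset hBv) hn
  have h1 := add_mem_of_isExposed hg hBv hw1 hw2
  have h2 := add_mem_of_isExposed hg hBv (v := -w) (by rwa [← sub_eq_add_neg])
    (by rwa [sub_neg_eq_add])
  rw [← hB] at h1 h2
  obtain ⟨x, hx, hxw⟩ := h1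
  obtain ⟨y, hy, hyw⟩ := h2
  have hmid : v = (1 / 2 : ℝ) • x + (1 / 2 : ℝ) • y := by
    apply B.injective
    have := affine_combo (B : Eu n →ᵃ[ℝ] Eu n) (a := 1 / 2) (b := 1 / 2) (by norm_num) x y
    simp only [AffineEquiv.coe_toAffineMap] at this
    rw [this, hxw, hyw]
    module
  -- the facet functions of a vertex are extreme values, hence equal at `x` and `y`
  have hxy : x = y := by
    refine lam_ext fun ℓ : Facet n shape => ?_
    have h3 := affine_combo (lam ℓ) (a := 1 / 2) (b := 1 / 2) (by norm_num) x y
    rw [← hmid, smul_eq_mul, smul_eq_mul] at h3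
    have h4 := mem_refCell_iff.1 (hf.subset hx) ℓ
    have h5 := mem_refCell_iff.1 (hf.subset hy) ℓ
    have h6 := lam_le_one (hf.subset hx) ℓ
    have h7 := lam_le_one (hf.subset hy) ℓ
    rcases hvv ℓ with h | h <;> rw [h] at h3 <;> linarith
  apply hw0
  rw [hxy, hyw, add_right_inj] at hxw
  have h8 : (2 : ℝ) • w = 0 := by rw [two_smul]; nth_rw 2 [← hxw]; simp
  simpa using h8

theorem exists_vertex_of_ne {n : ℕ} {shape : CellShape} {f : Set (Eu n)}
    (hf : IsExposed ℝ (refCell n shape) f) {ℓ : Facet n shape} {x y : Eu n} (hx : x ∈ f)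
    (hy : y ∈ f) (hxy : lam ℓ x ≠ lam ℓ y) :
    (∃ v ∈ f, IsVertex shape v ∧ lam ℓ v = 0) ∧ ∃ v ∈ f, IsVertex shape v ∧ lam ℓ v = 1 := by
  constructor
  · by_contra! hcon
    have := eqOn_face_of_vertices hf (ψ := lam ℓ) (χ := AffineMap.const ℝ (Eu n) 1)
      fun v hv hvv => (hvv ℓ).resolve_left (hcon v hv hvv)
    exact hxy ((this x hx).trans (this y hy).symm)
  · by_contra! hcon
    have := eqOn_face_of_vertices hf (ψ := lam ℓ) (χ := AffineMap.const ℝ (Eu n) 0)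
      fun v hv hvv => (hvv ℓ).resolve_right (hcon v hv hvv)
    exact hxy ((this x hx).trans (this y hy).symm)

/-- A facet function that is constant on a face takes the value `0` or `1` there. -/
theorem lam_eq_zero_or_one_of_const {n : ℕ} {shape : CellShape} {f : Set (Eu n)}
    (hf : IsExposed ℝ (refCell n shape) f) {ℓ : Facet n shape} {x : Eu n} (hx : x ∈ f)
    (hc : ∀ y ∈ f, lam ℓ y = lam ℓ x) : lam ℓ x = 0 ∨ lam ℓ x = 1 := by
  by_contra hcon
  have hno : ∀ v ∈ f, ¬IsVertex shape v := fun v hv hvv => hcon (hc v hv ▸ hvv ℓ)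
  have := eqOn_face_of_vertices hf (ψ := AffineMap.const ℝ (Eu n) 0)
    (χ := AffineMap.const ℝ (Eu n) 1) (fun v hv hvv => absurd hvv (hno v hv)) x hx
  simp at this

theorem simplex_vertex_unique {n : ℕ} {v : Eu n} (hv : IsVertex .simplex v)
    {ℓ m : Facet n .simplex} (hℓ : lam ℓ v = 1) (hm : lam m v = 1) : ℓ = m := by
  by_contra hne
  have hsum : ∑ m : Facet n .simplex, lam m v = 1 := by rw [sum_lam]; simp [facetSum]
  have := Finset.add_le_sum (s := Finset.univ) (f := fun m : Facet n .simplex => lam m v)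
    (fun p _ => mem_refCell_iff.1 hv.mem p) (Finset.mem_univ ℓ) (Finset.mem_univ m) hne
  rw [hsum, hℓ, hm] at this
  norm_num at this

/-- Faces of the cube are closed under exchanging single coordinates of their points. -/
theorem cube_update_mem {n : ℕ} {f : Set (Eu n)} (hf : IsExposed ℝ (refCell n .cube) f)
    {p q : Eu n} (hp : p ∈ f) (hq : q ∈ f) (i : Fin n) :
    p + (q i - p i) • coordVec i ∈ f := by
  obtain ⟨l, rfl⟩ := hf ⟨p, hp⟩
  have hmem : ∀ a b : Eu n, a ∈ refCell n .cube → b ∈ refCell n .cube →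
      a + (b i - a i) • coordVec i ∈ refCell n .cube := by
    intro a b ha hb j
    by_cases hj : j = i
    · subst hj
      simpa [coordVec] using hb j
    · simpa [coordVec, hj] using ha j
  have h1 := hp.2 _ (hmem p q hp.1 hq.1)
  have h2 := hq.2 _ (hmem q p hq.1 hp.1)
  refine ⟨hmem p q hp.1 hq.1, fun y hy => (hp.2 y hy).trans ?_⟩
  simp only [map_add, map_smul, smul_eq_mul] at h1 h2 ⊢
  linarith

/-- Distinct facet functions that are not constant on a face differ on it. -/
theorem lam_injective_on_face {n : ℕ} {shape : CellShape} {f : Set (Eu n)}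
    (hf : IsExposed ℝ (refCell n shape) f) {ℓ m : Facet n shape} {x y : Eu n} (hx : x ∈ f)
    (hy : y ∈ f) (hxy : lam ℓ x ≠ lam ℓ y) (h : ∀ z ∈ f, lam ℓ z = lam m z) : ℓ = m := by
  cases shape with
  | simplex =>
    obtain ⟨-, v, hv, hvv, hv1⟩ := exists_vertex_of_ne hf hx hy hxy
    exact simplex_vertex_unique hvv hv1 (h v hv ▸ hv1)
  | cube =>
    obtain ⟨i, b⟩ := ℓ
    obtain ⟨j, c⟩ := m
    have hxi : x i ≠ y i := by
      intro hxi
      apply hxy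
      cases b <;> simp [hxi]
    have h1 := h x hx
    have h2 := h _ (cube_update_mem hf hx hy i)
    by_cases hij : i = j
    · subst hij
      have h3 := h y hy
      cases b <;> cases c <;> simp only [lam_cube_true, lam_cube_false] at h1 h3 <;>
        first | rfl | exact absurd (by linarith) hxi
    · exfalso
      apply hxi
      cases b <;> cases c <;>
        simp [coordVec, Ne.symm hij] at h1 h2 <;> linarith

/-- An affine bijection between two faces permutes the facet functions that are not constant. -/
theorem exists_lam_comp_eq {n : ℕ} {shape : CellShape} {f g : Set (Eu n)}
    (hf : IsExposed ℝ (refCell n shape) f) (hg : IsExposed ℝ (refCell n shape) g)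
    {B : Eu n ≃ᵃ[ℝ] Eu n} (hB : B '' f = g) {ℓ : Facet n shape} {x y : Eu n} (hx : x ∈ g)
    (hy : y ∈ g) (hxy : lam ℓ x ≠ lam ℓ y) :
    ∃ m : Facet n shape, ∀ z ∈ f, lam ℓ (B z) = lam m z := by
  have hBm : ∀ v ∈ f, IsVertex shape v → IsVertex shape (B v) := fun v hv hvv =>
    isVertex_map hg hf hB hv hvv
  have hBs : ∀ w ∈ g, IsVertex shape w → ∃ v ∈ f, IsVertex shape v ∧ B v = w := by
    intro w hw hwv
    have hB' : B.symm '' g = f := by rw [← hB, ← image_comp]; simp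
    refine ⟨B.symm w, hB' ▸ mem_image_of_mem _ hw, isVertex_map hf hg hB' hw hwv, by simp⟩
  obtain ⟨⟨w0, hw0, hw0v, hw00⟩, w1, hw1, hw1v, hw11⟩ := exists_vertex_of_ne hg hx hy hxy
  obtain ⟨p, hp, hpv, rfl⟩ := hBs w0 hw0 hw0v
  obtain ⟨q, hq, hqv, rfl⟩ := hBs w1 hw1 hw1v
  set ψ : Eu n →ᵃ[ℝ] ℝ := (lam ℓ).comp (B : Eu n →ᵃ[ℝ] Eu n) with hψ
  have hψa : ∀ z, ψ z = lam ℓ (B z) := fun z => rfl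
  suffices h : ∃ m : Facet n shape, ∀ v ∈ f, IsVertex shape v → ψ v = lam m v by
    obtain ⟨m, hm⟩ := h
    exact ⟨m, eqOn_face_of_vertices hf hm⟩
  have h01 : ∀ v ∈ f, IsVertex shape v → ψ v = 0 ∨ ψ v = 1 := fun v hv hvv => hBm v hv hvv ℓ
  cases shape with
  | simplex =>
    have hone : ∀ v : Eu n, IsVertex .simplex v → ∃ m : Facet n .simplex, lam m v = 1 := by
      intro v hv
      by_contra! hcon
      have hsum : ∑ m : Facet n .simplex, lam m v = 1 := by rw [sum_lam]; simp [facetSum]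
      rw [Finset.sum_eq_zero fun m _ => (hv m).resolve_right (hcon m)] at hsum
      exact zero_ne_one hsum
    have huniq : ∀ (v w : Eu n) (m : Facet n .simplex), IsVertex .simplex v → IsVertex .simplex w →
        lam m v = 1 → lam m w = 1 → v = w := by
      intro v w m hv hw h1 h2
      refine lam_ext fun p : Facet n .simplex => ?_
      by_cases hpm : p = m
      · rw [hpm, h1, h2]
      · rw [(hv p).resolve_right fun h => hpm (simplex_vertex_unique hv h h1),
          (hw p).resolve_right fun h => hpm (simplex_vertex_unique hw h h2)]
    obtain ⟨m, hm⟩ := hone q hqv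
    refine ⟨m, fun v hv hvv => ?_⟩
    by_cases hvq : v = q
    · rw [hvq, hm, hψa, hw11]
    · rw [(hvv m).resolve_right fun h => hvq (huniq v q m hvv hqv h hm)]
      exact (h01 v hv hvv).resolve_right fun h =>
        hvq (B.injective (huniq _ _ ℓ (hBm v hv hvv) hw1v h hw11))
  | cube =>
    -- changes of single coordinates are additive
    have hcoord : ∀ v : Eu n, IsVertex .cube v → ∀ i, v i = 0 ∨ v i = 1 := fun v hv i => hv (i, true)
    have hvert : ∀ v w : Eu n, IsVertex .cube v → IsVertex .cube w → ∀ i,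
        IsVertex .cube (v + (w i - v i) • coordVec i) := by
      intro v w hv hw i ⟨j, b⟩
      by_cases hj : j = i
      · subst hj
        have := hw (j, b)
        cases b <;> simpa [coordVec] using this
      · have := hv (j, b)
        cases b <;> simpa [coordVec, hj] using this
    have hlin : ∀ (v : Eu n) (τ : ℝ) (i : Fin n),
        ψ (v + τ • coordVec i) = ψ v + τ * ψ.linear (coordVec i) := by
      intro v τ i
      have : ψ (v + τ • coordVec i) = ψ.linear (τ • coordVec i) + ψ v := by
        rw [add_comm]; exact ψ.map_vadd v _
      rw [this, map_smul, smul_eq_mul]; ring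
    have hdiff : ∀ v w : Eu n, ψ w = ψ v + ∑ i, (w i - v i) * ψ.linear (coordVec i) := by
      intro v w
      have h1 : w = v + (w - v) := by abel
      have h2 : ψ (v + (w - v)) = ψ.linear (w - v) + ψ v := by
        rw [add_comm]; exact ψ.map_vadd v _
      conv_lhs => rw [h1]
      rw [h2, ← sum_smul_coordVec (w - v), map_sum, add_comm]
      simp
    have hψp : ψ p = 0 := hw00
    have hψq : ψ q = 1 := hw11
    have hstep : ∀ v ∈ f, IsVertex .cube v → ∀ i,
        (v i - p i) * ψ.linear (coordVec i) = 0 ∨ (v i - p i) * ψ.linear (coordVec i) = 1 := by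
      intro v hv hvv i
      have := h01 _ (cube_update_mem hf hp hv i) (hvert p v hpv hvv i)
      rwa [hlin, hψp, zero_add] at this
    obtain ⟨i, hi⟩ : ∃ i, (q i - p i) * ψ.linear (coordVec i) = 1 := by
      by_contra! hcon
      have := hdiff p q
      rw [Finset.sum_eq_zero fun i _ => (hstep q hq hqv i).resolve_right (hcon i), hψp, hψq] at this
      norm_num at this
    have hval : ∀ v ∈ f, IsVertex .cube v → (v i = q i → ψ v = 1) ∧ (v i = p i → ψ v = 0) := by
      intro v hv hvv
      constructor
      · intro hvi
        refine (h01 v hv hvv).resolve_left fun h0 => ?_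
        have h1 := hdiff p v
        rw [hψp, zero_add, h0] at h1
        have h2 := Finset.single_le_sum (f := fun j => (v j - p j) * ψ.linear (coordVec j))
          (fun j _ => by rcases hstep v hv hvv j with h | h <;> rw [h]; exact zero_le_one)
          (Finset.mem_univ i)
        rw [← h1] at h2
        simp only [hvi, hi] at h2
        norm_num at h2
      · intro hvi
        refine (h01 v hv hvv).resolve_right fun h1 => ?_
        have h2 := h01 _ (cube_update_mem hf hv hq i) (hvert v q hvv hqv i)
        rw [hlin, hvi, hi, h1] at h2
        norm_num at h2
    have hne : q i ≠ p i := fun h => by rw [h, sub_self, zero_mul] at hi; exact zero_ne_one hi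
    rcases hcoord q hqv i with hq0 | hq1
    · have hp1 : p i = 1 := (hcoord p hpv i).resolve_left fun h => hne (hq0.trans h.symm)
      refine ⟨(i, false), fun v hv hvv => ?_⟩
      rcases hcoord v hvv i with h | h
      · rw [(hval v hv hvv).1 (h.trans hq0.symm), lam_cube_false, h]; norm_num
      · rw [(hval v hv hvv).2 (h.trans hp1.symm), lam_cube_false, h]; norm_num
    · have hp0 : p i = 0 := (hcoord p hpv i).resolve_right fun h => hne (hq1.trans h.symm)
      refine ⟨(i, true), fun v hv hvv => ?_⟩
      rcases hcoord v hvv i with h | h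
      · rw [(hval v hv hvv).2 (h.trans hp0.symm), lam_cube_true, h]
      · rw [(hval v hv hvv).1 (h.trans hq1.symm), lam_cube_true, h]

/-- A point of the cell outside a face is separated from it by a facet containing the face. -/
theorem exists_facet_of_notMem_face {n : ℕ} {shape : CellShape} {f : Set (Eu n)}
    (hf : IsExposed ℝ (refCell n shape) f) (hne : f.Nonempty) {a : Eu n}
    (ha : a ∈ refCell n shape) (haf : a ∉ f) :
    ∃ ℓ : Facet n shape, (∀ x ∈ f, lam ℓ x = 0) ∧ 0 < lam ℓ a := by
  by_contra! hcon
  -- a point in the relative interior of the face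
  have hx0 : ∃ x₀ ∈ f, ∀ ℓ : Facet n shape, (∃ x ∈ f, 0 < lam ℓ x) → 0 < lam ℓ x₀ := by
    have hconv : Convex ℝ f := hf.convex convex_refCell
    suffices h : ∀ t : Finset (Facet n shape), ∃ x₀ ∈ f, ∀ ℓ ∈ t, (∃ x ∈ f, 0 < lam ℓ x) →
        0 < lam ℓ x₀ by
      obtain ⟨x₀, hx₀, h⟩ := h Finset.univ
      exact ⟨x₀, hx₀, fun ℓ => h ℓ (Finset.mem_univ ℓ)⟩
    intro t
    induction t using Finset.induction_on with
    | empty => exact ⟨hne.some, hne.some_mem, by simp⟩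
    | insert ℓ t _ ih =>
      obtain ⟨x₀, hx₀, h⟩ := ih
      by_cases hℓ : ∃ x ∈ f, 0 < lam ℓ x
      · obtain ⟨x, hx, hpos⟩ := hℓ
        refine ⟨(1 / 2 : ℝ) • x₀ + (1 / 2 : ℝ) • x,
          hconv hx₀ hx (by norm_num) (by norm_num) (by norm_num), fun m hm hex => ?_⟩
        rw [affine_combo _ (by norm_num), smul_eq_mul, smul_eq_mul]
        have h1 := mem_refCell_iff.1 (hf.subset hx₀) m
        have h2 := mem_refCell_iff.1 (hf.subset hx) m
        rcases Finset.mem_insert.1 hm with rfl | hm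
        · linarith
        · linarith [h m hm hex]
      · refine ⟨x₀, hx₀, fun m hm hex => ?_⟩
        rcases Finset.mem_insert.1 hm with rfl | hm
        · exact absurd hex hℓ
        · exact h m hm hex
  obtain ⟨x₀, hx₀, hx₀pos⟩ := hx0
  -- the segment from `a` to `x₀` can be prolonged beyond `x₀` inside the cell
  obtain ⟨ε, hε, hmem⟩ : ∃ ε : ℝ, 0 < ε ∧ x₀ + ε • (x₀ - a) ∈ refCell n shape := by
    have hev : ∀ᶠ ε in 𝓝[>] (0 : ℝ), ∀ ℓ : Facet n shape, 0 ≤ lam ℓ (x₀ + ε • (x₀ - a)) := by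
      rw [eventually_all]
      intro ℓ
      by_cases hℓ : ∃ x ∈ f, 0 < lam ℓ x
      · have hc : Tendsto (fun ε : ℝ => lam ℓ (x₀ + ε • (x₀ - a))) (𝓝[>] 0) (𝓝 (lam ℓ x₀)) := by
          have : Continuous fun ε : ℝ => lam ℓ (x₀ + ε • (x₀ - a)) :=
            (continuous_lam ℓ).comp (by fun_prop)
          exact (this.tendsto' 0 _ (by simp)).mono_left nhdsWithin_le_nhds
        exact (hc.eventually (lt_mem_nhds (hx₀pos ℓ hℓ))).mono fun _ h => h.le
      · push Not at hℓ
        have h0 : ∀ x ∈ f, lam ℓ x = 0 := fun x hx =>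
          le_antisymm (hℓ x hx) (mem_refCell_iff.1 (hf.subset hx) ℓ)
        filter_upwards [self_mem_nhdsWithin] with ε hε
        rw [affine_add_smul_sub, h0 x₀ hx₀]
        have := hcon ℓ h0
        have : (0 : ℝ) < ε := hε
        nlinarith
    obtain ⟨ε, h1, h2⟩ := (hev.and self_mem_nhdsWithin).exists
    exact ⟨ε, h2, mem_refCell_iff.2 h1⟩
  obtain ⟨l, rfl⟩ := hf hne
  apply haf
  refine ⟨ha, fun y hy => (hx₀.2 y hy).trans ?_⟩
  have := hx₀.2 _ hmem
  simp only [map_add, map_smul, map_sub, smul_eq_mul] at this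
  nlinarith

end Nudging

namespace Nudging

open scoped Topology
open Filter

/-! ### The Lagrange element -/

theorem mem_refPoly_cube_iff {n k : ℕ} {p : MvPolynomial (Fin n) ℝ} :
    p ∈ refPoly n k .cube ↔ ∀ i, MvPolynomial.degreeOf i p ≤ k := by
  refine (MvPolynomial.mem_restrictDegree _ p k).trans ?_
  simp only [MvPolynomial.degreeOf_eq_sup, Finset.sup_le_iff]
  exact ⟨fun h i s hs => h s hs i, fun h s hs i => h i s hs⟩

theorem mem_refPoly_simplex_iff {n k : ℕ} {p : MvPolynomial (Fin n) ℝ} :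
    p ∈ refPoly n k .simplex ↔ p.totalDegree ≤ k :=
  MvPolynomial.mem_restrictTotalDegree _ _ p

theorem mul_mem_refPoly {n k m : ℕ} {shape : CellShape} {p q : MvPolynomial (Fin n) ℝ}
    (hp : p ∈ refPoly n k shape) (hq : q ∈ refPoly n m shape) : p * q ∈ refPoly n (k + m) shape := by
  cases shape with
  | simplex =>
    rw [mem_refPoly_simplex_iff] at *
    exact (MvPolynomial.totalDegree_mul p q).trans (add_le_add hp hq)
  | cube =>
    rw [mem_refPoly_cube_iff] at *
    exact fun i => (MvPolynomial.degreeOf_mul_le i p q).trans (add_le_add (hp i) (hq i))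

theorem refPoly_mono {n k m : ℕ} {shape : CellShape} (h : k ≤ m) :
    refPoly n k shape ≤ refPoly n m shape := by
  intro p hp
  cases shape with
  | simplex =>
    rw [mem_refPoly_simplex_iff] at *
    exact hp.trans h
  | cube =>
    rw [mem_refPoly_cube_iff] at *
    exact fun i => (hp i).trans h

theorem C_mem_refPoly {n k : ℕ} {shape : CellShape} (c : ℝ) :
    MvPolynomial.C c ∈ refPoly n k shape := by
  cases shape with
  | simplex => rw [mem_refPoly_simplex_iff]; simp
  | cube => rw [mem_refPoly_cube_iff]; simp

theorem prod_mem_refPoly {n : ℕ} {shape : CellShape} {ι : Type*} (t : Finset ι) (m : ι → ℕ)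
    (f : ι → MvPolynomial (Fin n) ℝ) (h : ∀ i ∈ t, f i ∈ refPoly n (m i) shape) :
    ∏ i ∈ t, f i ∈ refPoly n (∑ i ∈ t, m i) shape := by
  classical
  induction t using Finset.induction_on with
  | empty => simpa using C_mem_refPoly (n := n) (k := 0) (shape := shape) 1
  | insert i t hi ih =>
    rw [Finset.prod_insert hi, Finset.sum_insert hi]
    exact mul_mem_refPoly (h i (Finset.mem_insert_self i t))
      (ih fun j hj => h j (Finset.mem_insert_of_mem hj))

theorem pow_mem_refPoly {n k : ℕ} {shape : CellShape} {p : MvPolynomial (Fin n) ℝ}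
    (hp : p ∈ refPoly n k shape) (m : ℕ) : p ^ m ∈ refPoly n (m * k) shape := by
  have := prod_mem_refPoly (shape := shape) (Finset.range m) (fun _ => k) (fun _ => p) fun _ _ => hp
  simpa using this

/-- The pull-back of a polynomial of total degree at most `k` under a cell map is in `P_k` resp.
`Q_k`. -/
theorem bind₁_mem_refPoly {n k : ℕ} {shape : CellShape} {F : Fin n → MvPolynomial (Fin n) ℝ}
    (hF : ∀ j, F j ∈ refPoly n 1 shape) {q : MvPolynomial (Fin n) ℝ} (hq : q.totalDegree ≤ k) :
    MvPolynomial.bind₁ F q ∈ refPoly n k shape := by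
  rw [q.as_sum, map_sum]
  refine Submodule.sum_mem _ fun α hα => ?_
  rw [MvPolynomial.bind₁_monomial]
  have h1 := prod_mem_refPoly (shape := shape) α.support (fun i => α i) (fun i => F i ^ α i)
    fun i _ => by simpa using pow_mem_refPoly (hF i) (α i)
  have h2 : ∑ i ∈ α.support, α i ≤ k := (MvPolynomial.le_totalDegree hα).trans hq
  have h3 := mul_mem_refPoly (C_mem_refPoly (n := n) (k := 0) (shape := shape) (q.coeff α)) h1
  rw [zero_add] at h3
  exact refPoly_mono h2 h3

theorem evalE_bind₁ {n : ℕ} (F : Fin n → MvPolynomial (Fin n) ℝ) (q : MvPolynomial (Fin n) ℝ)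
    (x : Eu n) : evalE (MvPolynomial.bind₁ F q) x = evalE q (polyMap F x) := by
  rw [evalE, evalE, MvPolynomial.eval, MvPolynomial.eval₂Hom_bind₁]
  rfl

/-- The exponents of the monomials in `P_k` resp. `Q_k`. -/
def exps (n k : ℕ) : CellShape → Set (Fin n →₀ ℕ)
  | .simplex => {α | (α.sum fun _ e => e) ≤ k}
  | .cube => {α | ∀ i, α i ≤ k}

theorem le_of_mem_exps {n k : ℕ} {shape : CellShape} {α : Fin n →₀ ℕ} (h : α ∈ exps n k shape)
    (i : Fin n) : α i ≤ k := by
  cases shape with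
  | simplex =>
    have h1 : (α.sum fun _ e => e) ≤ k := h
    rw [Finsupp.sum_fintype _ _ fun _ => rfl] at h1
    exact (Finset.single_le_sum (f := fun i => α i) (fun _ _ => Nat.zero_le _)
      (Finset.mem_univ i)).trans h1
  | cube => exact h i

theorem finite_exps (n k : ℕ) (shape : CellShape) : (exps n k shape).Finite := by
  refine ((Set.Finite.pi' fun _ : Fin n => Set.finite_Iic k).preimage
    (f := fun α : Fin n →₀ ℕ => (α : Fin n → ℕ)) DFunLike.coe_injective.injOn).subset ?_
  exact fun α h i => le_of_mem_exps h i

noncomputable instance (n k : ℕ) (shape : CellShape) : Fintype (exps n k shape) :=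
  (finite_exps n k shape).fintype

/-- The monomial basis of `P_k` resp. `Q_k`. -/
noncomputable def refPolyBasis (n k : ℕ) :
    (shape : CellShape) → Module.Basis (exps n k shape) ℝ (refPoly n k shape)
  | .simplex => MvPolynomial.basisRestrictSupport ℝ _
  | .cube => MvPolynomial.basisRestrictSupport ℝ _

instance (n k : ℕ) (shape : CellShape) : Module.Finite ℝ (refPoly n k shape) :=
  Module.Finite.of_basis (refPolyBasis n k shape)

/-- The Lagrange node of the reference cell with index `α`. -/
noncomputable def refNode {n : ℕ} (k : ℕ) (α : Fin n →₀ ℕ) : Eu n :=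
  WithLp.toLp 2 fun i => (α i : ℝ) / k

/-- The Lagrange nodes of degree `k`: the points of the cell at which `k` times each facet function
is an integer. -/
def IsNode {n : ℕ} (k : ℕ) (shape : CellShape) (a : Eu n) : Prop :=
  ∀ ℓ : Facet n shape, ∃ m : ℕ, k * lam ℓ a = m

theorem IsNode.mem {n k : ℕ} {shape : CellShape} (hk : 0 < k) {a : Eu n}
    (ha : IsNode k shape a) : a ∈ refCell n shape := by
  rw [mem_refCell_iff]
  intro ℓ
  obtain ⟨m, hm⟩ := ha ℓ
  have h1 : (0 : ℝ) < k := by exact_mod_cast hk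
  have h2 : (0 : ℝ) ≤ m := by positivity
  rw [← hm] at h2
  exact nonneg_of_mul_nonneg_right h2 h1

theorem isNode_refNode {n k : ℕ} {shape : CellShape} (hk : 0 < k) {α : Fin n →₀ ℕ}
    (hα : α ∈ exps n k shape) : IsNode k shape (refNode k α) := by
  have h1 : (k : ℝ) ≠ 0 := by exact_mod_cast hk.ne'
  intro ℓ
  cases shape with
  | simplex =>
    rcases ℓ with _ | i
    · have h2 : (α.sum fun _ e => e) ≤ k := hα
      rw [Finsupp.sum_fintype _ _ fun _ => rfl] at h2
      refine ⟨k - ∑ i, α i, ?_⟩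
      rw [lam_simplex_none, Nat.cast_sub h2]
      simp only [refNode]
      rw [← Finset.sum_div, Nat.cast_sum]
      field_simp
    · refine ⟨α i, ?_⟩
      rw [lam_simplex_some]
      simp only [refNode]
      field_simp
  | cube =>
    obtain ⟨i, b⟩ := ℓ
    cases b
    · refine ⟨k - α i, ?_⟩
      rw [lam_cube_false, Nat.cast_sub (hα i)]
      simp only [refNode]
      field_simp
    · refine ⟨α i, ?_⟩
      rw [lam_cube_true]
      simp only [refNode]
      field_simp

theorem IsNode.exists_eq {n k : ℕ} {shape : CellShape} (hk : 0 < k) {a : Eu n}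
    (ha : IsNode k shape a) : ∃ α ∈ exps n k shape, a = refNode k α := by
  have h1 : (k : ℝ) ≠ 0 := by exact_mod_cast hk.ne'
  have h0 : (0 : ℝ) < k := by exact_mod_cast hk
  have h2 : ∀ i : Fin n, ∃ m : ℕ, k * a i = m := by
    intro i
    cases shape with
    | simplex => exact ha (some i)
    | cube => exact ha (i, true)
  choose m hm using h2
  refine ⟨Finsupp.equivFunOnFinite.symm m, ?_, ?_⟩
  · cases shape with
    | simplex =>
      change (Finsupp.sum _ _) ≤ k
      rw [Finsupp.sum_fintype _ _ fun _ => rfl]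
      have h3 := (IsNode.mem hk ha).2
      have h4 : ((∑ i, m i : ℕ) : ℝ) ≤ k := by
        push_cast
        rw [← Finset.sum_congr rfl fun i _ => hm i, ← Finset.mul_sum]
        nlinarith
      exact_mod_cast h4
    | cube =>
      intro i
      have h3 := ((IsNode.mem hk ha) i).2
      have h4 : (m i : ℝ) ≤ k := by rw [← hm i]; nlinarith
      exact_mod_cast h4
  · ext i
    simp only [refNode, Finsupp.equivFunOnFinite_symm_apply_apply]
    rw [← hm i]
    field_simp

theorem refNode_injective {n k : ℕ} (hk : 0 < k) :
    Function.Injective (refNode k : (Fin n →₀ ℕ) → Eu n) := by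
  intro α β h
  have h1 : (k : ℝ) ≠ 0 := by exact_mod_cast hk.ne'
  ext i
  have h2 := congrArg (fun v : Eu n => v i) h
  simp only [refNode] at h2
  field_simp at h2
  exact_mod_cast h2

/-- The factor of a Lagrange basis function that belongs to one facet, at which the node and the
argument have the facet coordinates `t` and `s`. -/
noncomputable def nodalFactor (k : ℕ) (t s : ℝ) : ℝ :=
  ∏ j ∈ Finset.range ⌊k * t⌋₊, ((⌊k * t⌋₊ : ℝ) - j)⁻¹ * (k * s - j)

/-- The Lagrange basis polynomial of the node `a`: the product of the linear functions that vanish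
on the hyperplanes, parallel to the facets, through the other nodes that lie between `a` and the
facets, normalized. -/
noncomputable def nodal {n : ℕ} (k : ℕ) (shape : CellShape) (a : Eu n) : MvPolynomial (Fin n) ℝ :=
  ∏ ℓ : Facet n shape, ∏ j ∈ Finset.range ⌊k * lam ℓ a⌋₊,
    MvPolynomial.C ((⌊k * lam ℓ a⌋₊ : ℝ) - j)⁻¹ *
      (MvPolynomial.C (k : ℝ) * facetPoly ℓ - MvPolynomial.C (j : ℝ))

theorem evalE_nodal {n k : ℕ} {shape : CellShape} (a x : Eu n) :
    evalE (nodal k shape a) x = ∏ ℓ : Facet n shape, nodalFactor k (lam ℓ a) (lam ℓ x) := by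
  simp only [← evalE_facetPoly _ x]
  simp only [nodal, evalE, nodalFactor, map_prod, map_mul, map_sub, MvPolynomial.eval_C]

theorem nodalFactor_self {k : ℕ} {t : ℝ} (ht : ∃ m : ℕ, k * t = m) : nodalFactor k t t = 1 := by
  obtain ⟨m, hm⟩ := ht
  rw [nodalFactor, hm, Nat.floor_natCast]
  refine Finset.prod_eq_one fun j hj => inv_mul_cancel₀ ?_
  have : j < m := Finset.mem_range.1 hj
  exact sub_ne_zero.2 (by exact_mod_cast this.ne')

theorem nodalFactor_eq_zero {k : ℕ} {t s : ℝ} {j : ℕ} (hs : k * s = j) (hj : j < ⌊k * t⌋₊) :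
    nodalFactor k t s = 0 :=
  Finset.prod_eq_zero (Finset.mem_range.2 hj) (by rw [hs, sub_self, mul_zero])

theorem evalE_nodal_self {n k : ℕ} {shape : CellShape} {a : Eu n} (ha : IsNode k shape a) :
    evalE (nodal k shape a) a = 1 := by
  rw [evalE_nodal]
  exact Finset.prod_eq_one fun ℓ _ => nodalFactor_self (ha ℓ)

theorem evalE_nodal_of_ne {n k : ℕ} {shape : CellShape} (hk : 0 < k) {a b : Eu n}
    (ha : IsNode k shape a) (hb : IsNode k shape b) (hab : a ≠ b) :
    evalE (nodal k shape a) b = 0 := by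
  have hk0 : (0 : ℝ) < k := by exact_mod_cast hk
  obtain ⟨ℓ, hℓ⟩ : ∃ ℓ : Facet n shape, lam ℓ b < lam ℓ a := by
    by_contra! hcon
    apply hab
    refine lam_ext fun ℓ : Facet n shape => ?_
    have h1 : ∑ ℓ : Facet n shape, lam ℓ a = ∑ ℓ : Facet n shape, lam ℓ b := by
      rw [sum_lam, sum_lam]
    exact (Finset.sum_eq_sum_iff_of_le fun ℓ _ => hcon ℓ).1 h1 ℓ (Finset.mem_univ ℓ)
  rw [evalE_nodal]
  refine Finset.prod_eq_zero (Finset.mem_univ ℓ) ?_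
  obtain ⟨m, hm⟩ := ha ℓ
  obtain ⟨j, hj⟩ := hb ℓ
  refine nodalFactor_eq_zero hj ?_
  rw [hm, Nat.floor_natCast]
  have : (j : ℝ) < m := by rw [← hm, ← hj]; gcongr
  exact_mod_cast this

theorem facetPoly_mem {n : ℕ} {shape : CellShape} (ℓ : Facet n shape) :
    facetPoly ℓ ∈ refPoly n 1 shape := by
  have hX : ∀ i : Fin n, (MvPolynomial.X i : MvPolynomial (Fin n) ℝ) ∈ refPoly n 1 shape := by
    intro i
    cases shape with
    | simplex => rw [mem_refPoly_simplex_iff, MvPolynomial.totalDegree_X]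
    | cube =>
      rw [mem_refPoly_cube_iff]
      intro j
      rw [MvPolynomial.degreeOf_X]
      split_ifs <;> simp
  have h1 : (1 : MvPolynomial (Fin n) ℝ) ∈ refPoly n 1 shape := by
    simpa using C_mem_refPoly (n := n) (k := 1) (shape := shape) 1
  cases shape with
  | simplex =>
    rcases ℓ with _ | i
    · exact Submodule.sub_mem _ h1 (Submodule.sum_mem _ fun i _ => hX i)
    · exact hX i
  | cube =>
    obtain ⟨i, b⟩ := ℓ
    cases b
    · exact Submodule.sub_mem _ h1 (hX i)
    · exact hX i

theorem degreeOf_facetPoly_of_ne {n : ℕ} {i j : Fin n} (b : Bool) (hij : i ≠ j) :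
    MvPolynomial.degreeOf i (facetPoly (shape := .cube) (j, b)) = 0 := by
  cases b
  · refine Nat.le_zero.1 ((MvPolynomial.degreeOf_sub_le i _ _).trans ?_)
    rw [MvPolynomial.degreeOf_one, MvPolynomial.degreeOf_X_of_ne hij]
    simp
  · exact MvPolynomial.degreeOf_X_of_ne hij

/-- At a node, the multiplicities of the linear factors of the basis function add up to the degree that
the barycentric coordinates predict. -/
theorem floor_sum_eq {n k : ℕ} {shape : CellShape} {a : Eu n} (ha : IsNode k shape a)
    (t : Finset (Facet n shape)) :
    ((∑ ℓ ∈ t, ⌊k * lam ℓ a⌋₊ : ℕ) : ℝ) = k * ∑ ℓ ∈ t, lam ℓ a := by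
  push_cast
  rw [Finset.mul_sum]
  refine Finset.sum_congr rfl fun ℓ _ => ?_
  obtain ⟨m, hm⟩ := ha ℓ
  rw [hm, Nat.floor_natCast]

theorem nodal_mem {n k : ℕ} {shape : CellShape} {a : Eu n} (ha : IsNode k shape a) :
    nodal k shape a ∈ refPoly n k shape := by
  have hfac : ∀ (ℓ : Facet n shape) (c : ℝ) (j : ℕ), MvPolynomial.C c *
      (MvPolynomial.C (k : ℝ) * facetPoly ℓ - MvPolynomial.C (j : ℝ)) ∈ refPoly n 1 shape := by
    intro ℓ c j
    rw [← MvPolynomial.smul_eq_C_mul, ← MvPolynomial.smul_eq_C_mul]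
    exact Submodule.smul_mem _ _ (Submodule.sub_mem _ (Submodule.smul_mem _ _ (facetPoly_mem ℓ))
      (C_mem_refPoly _))
  cases shape with
  | simplex =>
    have h1 := prod_mem_refPoly (shape := .simplex) Finset.univ
      (fun ℓ : Facet n .simplex => ⌊k * lam ℓ a⌋₊) _
      fun ℓ _ => by
        simpa using prod_mem_refPoly (shape := .simplex) (Finset.range ⌊k * lam ℓ a⌋₊)
          (fun _ => 1) _ fun j _ => hfac ℓ ((⌊k * lam ℓ a⌋₊ : ℝ) - j)⁻¹ j
    have h2 : ∑ ℓ : Facet n .simplex, ⌊k * lam ℓ a⌋₊ = k := by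
      have := floor_sum_eq ha Finset.univ
      rw [sum_lam] at this
      simp only [facetSum, Nat.cast_one, mul_one] at this
      exact_mod_cast this
    rwa [h2] at h1
  | cube =>
    rw [mem_refPoly_cube_iff]
    intro i
    have hz : ∀ (j : Fin n) (b : Bool) (m : ℕ) (c : ℝ), i ≠ j → MvPolynomial.degreeOf i
        (MvPolynomial.C c * (MvPolynomial.C (k : ℝ) * facetPoly (shape := .cube) (j, b)
          - MvPolynomial.C (m : ℝ))) ≤ 0 := by
      intro j b m c hij
      refine (MvPolynomial.degreeOf_C_mul_le _ _ _).trans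
        ((MvPolynomial.degreeOf_sub_le _ _ _).trans ?_)
      rw [MvPolynomial.degreeOf_C, max_eq_left (Nat.zero_le _)]
      refine (MvPolynomial.degreeOf_C_mul_le _ _ _).trans ?_
      rw [degreeOf_facetPoly_of_ne b hij]
    have h1 : ∀ ℓ : Fin n × Bool, MvPolynomial.degreeOf i
        (∏ j ∈ Finset.range ⌊k * lam (shape := .cube) ℓ a⌋₊,
          MvPolynomial.C ((⌊k * lam (shape := .cube) ℓ a⌋₊ : ℝ) - j)⁻¹ *
            (MvPolynomial.C (k : ℝ) * facetPoly (shape := .cube) ℓ - MvPolynomial.C (j : ℝ)))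
        ≤ if ℓ.1 = i then ⌊k * lam (shape := .cube) ℓ a⌋₊ else 0 := by
      rintro ⟨j, b⟩
      refine (MvPolynomial.degreeOf_prod_le _ _ _).trans ?_
      split_ifs with h
      · refine (Finset.sum_le_card_nsmul _ _ 1 fun m _ =>
          mem_refPoly_cube_iff.1 (hfac (j, b) _ m) i).trans ?_
        simp
      · exact (Finset.sum_le_card_nsmul _ _ 0 fun m _ => hz j b m _ (Ne.symm h)).trans (by simp)
    refine (MvPolynomial.degreeOf_prod_le _ _ _).trans
      ((Finset.sum_le_sum fun ℓ _ => h1 ℓ).trans ?_)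
    have h2 : ∑ ℓ : Fin n × Bool, (if ℓ.1 = i then ⌊k * lam (shape := .cube) ℓ a⌋₊ else 0)
        = ⌊k * lam (shape := .cube) (i, true) a⌋₊ + ⌊k * lam (shape := .cube) (i, false) a⌋₊ := by
      rw [Fintype.sum_prod_type, Finset.sum_eq_single i]
      · simp
      · intro j _ hj
        simp [hj]
      · simp
    refine (h2.trans ?_).le
    obtain ⟨m, hm⟩ := ha (i, true)
    obtain ⟨m', hm'⟩ := ha (i, false)
    rw [hm, hm', Nat.floor_natCast, Nat.floor_natCast]
    rw [lam_cube_true] at hm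
    rw [lam_cube_false] at hm'
    have : ((m + m' : ℕ) : ℝ) = k := by push_cast; linarith
    exact_mod_cast this

theorem evalE_sum {n : ℕ} {ι : Type*} (t : Finset ι) (p : ι → MvPolynomial (Fin n) ℝ) (x : Eu n) :
    evalE (∑ i ∈ t, p i) x = ∑ i ∈ t, evalE (p i) x := map_sum _ _ _

theorem evalE_smul {n : ℕ} (c : ℝ) (p : MvPolynomial (Fin n) ℝ) (x : Eu n) :
    evalE (c • p) x = c * evalE p x := MvPolynomial.smul_eval _ _ _

/-- The Lagrange interpolation polynomial of the nodal values `ξ`. -/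
noncomputable def interp {n : ℕ} (k : ℕ) (shape : CellShape) (ξ : Eu n → ℝ) :
    MvPolynomial (Fin n) ℝ :=
  ∑ α : exps n k shape, ξ (refNode k α) • nodal k shape (refNode k α)

theorem interp_mem {n k : ℕ} {shape : CellShape} (hk : 0 < k) (ξ : Eu n → ℝ) :
    interp k shape ξ ∈ refPoly n k shape :=
  Submodule.sum_mem _ fun α _ => Submodule.smul_mem _ _ (nodal_mem (isNode_refNode hk α.2))

theorem evalE_interp {n k : ℕ} {shape : CellShape} (ξ : Eu n → ℝ) (x : Eu n) :
    evalE (interp k shape ξ) x = ∑ α : exps n k shape,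
      ξ (refNode k α) * evalE (nodal k shape (refNode k α)) x := by
  rw [interp, evalE_sum]
  exact Finset.sum_congr rfl fun α _ => evalE_smul _ _ _

theorem evalE_interp_node {n k : ℕ} {shape : CellShape} (hk : 0 < k) (ξ : Eu n → ℝ) {a : Eu n}
    (ha : IsNode k shape a) : evalE (interp k shape ξ) a = ξ a := by
  obtain ⟨α, hα, rfl⟩ := ha.exists_eq hk
  rw [evalE_interp, Finset.sum_eq_single (⟨α, hα⟩ : exps n k shape)]
  · rw [evalE_nodal_self ha, mul_one]
  · intro β _ hβ
    rw [evalE_nodal_of_ne hk (isNode_refNode hk β.2) ha, mul_zero]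
    exact fun h => hβ (Subtype.ext (refNode_injective hk h))
  · simp

/-- Interpolation reproduces `P_k` resp. `Q_k`: evaluation at the nodes is a surjection between
spaces of the same dimension. -/
theorem interp_evalE {n k : ℕ} {shape : CellShape} (hk : 0 < k) {p : MvPolynomial (Fin n) ℝ}
    (hp : p ∈ refPoly n k shape) : interp k shape (evalE p) = p := by
  let E : refPoly n k shape →ₗ[ℝ] (exps n k shape → ℝ) :=
    { toFun := fun p α => evalE p.1 (refNode k α)
      map_add' := fun p q => by ext α; exact evalE_add _ _ _
      map_smul' := fun c p => by ext α; exact evalE_smul _ _ _ }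
  have hsurj : Function.Surjective E := by
    intro y
    classical
    let ξ : Eu n → ℝ := fun x => ∑ β : exps n k shape, if refNode k β = x then y β else 0
    refine ⟨⟨interp k shape ξ, interp_mem hk ξ⟩, ?_⟩
    ext α
    refine (evalE_interp_node hk ξ (isNode_refNode hk α.2)).trans ?_
    simp only [ξ]
    rw [Finset.sum_eq_single α (fun β _ hβ => if_neg fun h => hβ
      (Subtype.ext (refNode_injective hk h))) (by simp), if_pos rfl]
  have hdim : Module.finrank ℝ (refPoly n k shape) = Module.finrank ℝ (exps n k shape → ℝ) := by
    rw [Module.finrank_eq_card_basis (refPolyBasis n k shape), Module.finrank_fintype_fun_eq_card]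
  have hinj := (LinearMap.injective_iff_surjective_of_finrank_eq_finrank hdim).2 hsurj
  have := @hinj ⟨interp k shape (evalE p), interp_mem hk _⟩ ⟨p, hp⟩ (by
    ext α
    exact evalE_interp_node hk _ (isNode_refNode hk α.2))
  exact congrArg Subtype.val this

/-- A basis function vanishes on the faces that do not contain its node. -/
theorem evalE_nodal_of_notMem_face {n k : ℕ} {shape : CellShape} (hk : 0 < k) {a : Eu n}
    (ha : IsNode k shape a) {f : Set (Eu n)} (hf : IsExposed ℝ (refCell n shape) f) (haf : a ∉ f)
    {x : Eu n} (hx : x ∈ f) : evalE (nodal k shape a) x = 0 := by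
  obtain ⟨ℓ, h0, hpos⟩ := exists_facet_of_notMem_face hf ⟨x, hx⟩ (ha.mem hk) haf
  rw [evalE_nodal]
  refine Finset.prod_eq_zero (Finset.mem_univ ℓ) ?_
  obtain ⟨m, hm⟩ := ha ℓ
  refine nodalFactor_eq_zero (j := 0) (by rw [h0 x hx]; simp) ?_
  rw [hm, Nat.floor_natCast]
  have hk0 : (0 : ℝ) < k := by exact_mod_cast hk
  have : (0 : ℝ) < m := by rw [← hm]; positivity
  exact_mod_cast this

/-- The identification of two faces of the reference cell carries nodes to nodes. -/
theorem IsNode.map {n k : ℕ} {shape : CellShape} {f g : Set (Eu n)}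
    (hf : IsExposed ℝ (refCell n shape) f) (hg : IsExposed ℝ (refCell n shape) g)
    {B : Eu n ≃ᵃ[ℝ] Eu n} (hB : B '' f = g) {a : Eu n} (haf : a ∈ f) (ha : IsNode k shape a) :
    IsNode k shape (B a) := by
  intro ℓ
  have hBa : B a ∈ g := hB ▸ mem_image_of_mem B haf
  by_cases hc : ∀ y ∈ g, lam ℓ y = lam ℓ (B a)
  · rcases lam_eq_zero_or_one_of_const hg hBa hc with h | h
    · exact ⟨0, by rw [h]; simp⟩
    · exact ⟨k, by rw [h, mul_one]⟩
  · push Not at hc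
    obtain ⟨y, hy, hne⟩ := hc
    obtain ⟨m, hm⟩ := exists_lam_comp_eq hf hg hB hy hBa hne
    rw [hm a haf]
    exact ha m

/-- The traces of corresponding basis functions on corresponding faces agree. -/
theorem evalE_nodal_map {n k : ℕ} {shape : CellShape} {f g : Set (Eu n)}
    (hf : IsExposed ℝ (refCell n shape) f) (hg : IsExposed ℝ (refCell n shape) g)
    {B : Eu n ≃ᵃ[ℝ] Eu n} (hB : B '' f = g) {a x : Eu n} (haf : a ∈ f) (hxf : x ∈ f) :
    evalE (nodal k shape (B a)) (B x) = evalE (nodal k shape a) x := by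
  classical
  have hB' : B.symm '' g = f := by rw [← hB, ← image_comp]; simp
  have hmem : ∀ z ∈ f, B z ∈ g := fun z hz => hB ▸ mem_image_of_mem B hz
  -- facets whose function is constant on the face contribute the factor `1`
  let N : Set (Eu n) → Finset (Facet n shape) := fun t =>
    Finset.univ.filter fun ℓ => ∃ y ∈ t, ∃ z ∈ t, lam ℓ y ≠ lam ℓ z
  have hone : ∀ t : Set (Eu n), IsExposed ℝ (refCell n shape) t → ∀ b ∈ t, ∀ y ∈ t,
      evalE (nodal k shape b) y = ∏ ℓ ∈ N t, nodalFactor k (lam ℓ b) (lam ℓ y) := by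
    intro t ht b hb y hy
    rw [evalE_nodal]
    refine (Finset.prod_subset (Finset.subset_univ _) fun ℓ _ hℓ => ?_).symm
    have hc : ∀ y ∈ t, ∀ z ∈ t, lam ℓ y = lam ℓ z := by
      by_contra hcon
      push Not at hcon
      exact hℓ (Finset.mem_filter.2 ⟨Finset.mem_univ _, hcon⟩)
    rw [hc y hy b hb]
    refine nodalFactor_self ?_
    rcases lam_eq_zero_or_one_of_const ht hb (fun y hy => hc y hy b hb) with h | h
    · exact ⟨0, by rw [h]; simp⟩
    · exact ⟨k, by rw [h, mul_one]⟩
  rw [hone g hg _ (hmem a haf) _ (hmem x hxf), hone f hf _ haf _ hxf]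
  have hex : ∀ ℓ : Facet n shape, ∃ m : Facet n shape, ℓ ∈ N g →
      ∀ z ∈ f, lam ℓ (B z) = lam m z := by
    intro ℓ
    by_cases hℓ : ℓ ∈ N g
    · obtain ⟨-, y, hy, z, hz, hne⟩ := Finset.mem_filter.1 hℓ
      obtain ⟨m, hm⟩ := exists_lam_comp_eq hf hg hB hy hz hne
      exact ⟨m, fun _ => hm⟩
    · exact ⟨ℓ, fun h => absurd h hℓ⟩
  choose σ hσ using hex
  refine Finset.prod_bij (fun ℓ _ => σ ℓ) ?_ ?_ ?_ ?_
  · intro ℓ hℓ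
    obtain ⟨-, y, hy, z, hz, hne⟩ := Finset.mem_filter.1 hℓ
    rw [← hB] at hy hz
    obtain ⟨y, hy, rfl⟩ := hy
    obtain ⟨z, hz, rfl⟩ := hz
    rw [hσ ℓ hℓ y hy, hσ ℓ hℓ z hz] at hne
    exact Finset.mem_filter.2 ⟨Finset.mem_univ _, y, hy, z, hz, hne⟩
  · intro ℓ hℓ m hm h
    obtain ⟨-, y, hy, z, hz, hne⟩ := Finset.mem_filter.1 hℓ
    refine lam_injective_on_face hg hy hz hne fun w hw => ?_
    rw [← hB] at hw
    obtain ⟨w, hw, rfl⟩ := hw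
    rw [hσ ℓ hℓ w hw, hσ m hm w hw, h]
  · intro m hm
    obtain ⟨-, y, hy, z, hz, hne⟩ := Finset.mem_filter.1 hm
    obtain ⟨ℓ, hℓ⟩ := exists_lam_comp_eq hg hf hB' hy hz hne
    have hℓ' : ∀ w ∈ f, lam ℓ (B w) = lam m w := by
      intro w hw
      have := hℓ (B w) (hmem w hw)
      rw [← this, B.symm_apply_apply]
    have hℓN : ℓ ∈ N g := by
      refine Finset.mem_filter.2 ⟨Finset.mem_univ _, B y, hmem y hy, B z, hmem z hz, ?_⟩
      rwa [hℓ' y hy, hℓ' z hz]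
    refine ⟨ℓ, hℓN, ?_⟩
    refine (lam_injective_on_face hf hy hz hne fun w hw => ?_).symm
    rw [← hℓ' w hw, hσ ℓ hℓN w hw]
  · intro ℓ hℓ
    rw [hσ ℓ hℓ a haf, hσ ℓ hℓ x hxf]

/-- Interpolants with the same nodal values on corresponding faces agree there. -/
theorem evalE_interp_map {n k : ℕ} {shape : CellShape} (hk : 0 < k) {f g : Set (Eu n)}
    (hf : IsExposed ℝ (refCell n shape) f) (hg : IsExposed ℝ (refCell n shape) g)
    {B : Eu n ≃ᵃ[ℝ] Eu n} (hB : B '' f = g) {ξ η : Eu n → ℝ}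
    (h : ∀ a ∈ f, η (B a) = ξ a) {x : Eu n} (hx : x ∈ f) :
    evalE (interp k shape η) (B x) = evalE (interp k shape ξ) x := by
  classical
  have hB' : B.symm '' g = f := by rw [← hB, ← image_comp]; simp
  have hmem : ∀ z ∈ f, B z ∈ g := fun z hz => hB ▸ mem_image_of_mem B hz
  let N : Set (Eu n) → Finset (exps n k shape) := fun t =>
    Finset.univ.filter fun α => refNode k α.1 ∈ t
  have hsum : ∀ (t : Set (Eu n)) (ξ : Eu n → ℝ), IsExposed ℝ (refCell n shape) t → ∀ y ∈ t,
      evalE (interp k shape ξ) y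
        = ∑ α ∈ N t, ξ (refNode k α.1) * evalE (nodal k shape (refNode k α.1)) y := by
    intro t ξ ht y hy
    rw [evalE_interp]
    refine (Finset.sum_subset (Finset.subset_univ _) fun α _ hα => ?_).symm
    rw [evalE_nodal_of_notMem_face hk (isNode_refNode hk α.2) ht
      (fun h => hα (Finset.mem_filter.2 ⟨Finset.mem_univ _, h⟩)) hy, mul_zero]
  rw [hsum f ξ hf x hx, hsum g η hg _ (hmem x hx)]
  have hex : ∀ α ∈ N f, ∃ β : exps n k shape, refNode k β.1 = B (refNode k α.1) := by
    intro α hα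
    obtain ⟨β, hβ, h⟩ := (IsNode.map hf hg hB (Finset.mem_filter.1 hα).2
      (isNode_refNode hk α.2)).exists_eq hk
    exact ⟨⟨β, hβ⟩, h.symm⟩
  choose! σ hσ using hex
  symm
  refine Finset.sum_bij (fun α _ => σ α) ?_ ?_ ?_ ?_
  · intro α hα
    refine Finset.mem_filter.2 ⟨Finset.mem_univ _, ?_⟩
    rw [hσ α hα]
    exact hmem _ (Finset.mem_filter.1 hα).2
  · intro α hα β hβ h
    have h1 := hσ α hα
    rw [h, hσ β hβ] at h1
    exact (Subtype.ext (refNode_injective hk (B.injective h1))).symm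
  · intro β hβ
    have hβg := (Finset.mem_filter.1 hβ).2
    obtain ⟨α, hα, h⟩ := (IsNode.map hg hf hB' hβg (isNode_refNode hk β.2)).exists_eq hk
    have hαN : (⟨α, hα⟩ : exps n k shape) ∈ N f := by
      refine Finset.mem_filter.2 ⟨Finset.mem_univ _, ?_⟩
      rw [← h, ← hB']
      exact mem_image_of_mem _ hβg
    refine ⟨⟨α, hα⟩, hαN, Subtype.ext (refNode_injective hk ?_)⟩
    rw [hσ _ hαN, ← h, B.apply_symm_apply]
  · intro α hα
    have hαf := (Finset.mem_filter.1 hα).2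
    rw [hσ α hα, h _ hαf, evalE_nodal_map hf hg hB hαf hx]

end Nudging

namespace Nudging

open scoped Topology
open Filter

/-! ### Geometry of regular meshes -/

theorem interior_refCell_nonempty {n : ℕ} {shape : CellShape} :
    (interior (refCell n shape)).Nonempty := by
  refine ⟨WithLp.toLp 2 fun _ => ((n : ℝ) + 2)⁻¹, ?_⟩
  have hn : (0 : ℝ) < (n : ℝ) + 2 := by positivity
  have hopen : IsOpen {x : Eu n | ∀ ℓ : Facet n shape, 0 < lam ℓ x} := by
    simp only [ofPred_forall]
    exact isOpen_iInter_of_finite fun ℓ => isOpen_lt continuous_const (continuous_lam ℓ)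
  refine interior_maximal (fun x hx => mem_refCell_iff.2 fun ℓ => (hx ℓ).le) hopen ?_
  intro ℓ
  cases shape with
  | simplex =>
    rcases ℓ with _ | i
    · rw [lam_simplex_none]
      simp only [Finset.sum_const, Finset.card_univ, Fintype.card_fin, nsmul_eq_mul]
      rw [← div_eq_mul_inv, sub_pos, div_lt_one hn]
      linarith
    · rw [lam_simplex_some]
      positivity
  | cube =>
    obtain ⟨i, b⟩ := ℓ
    cases b
    · rw [lam_cube_false, sub_pos]
      exact inv_lt_one_of_one_lt₀ (by linarith [n.cast_nonneg (α := ℝ)])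
    · rw [lam_cube_true]
      positivity

theorem closure_interior_refCell {n : ℕ} {shape : CellShape} :
    closure (interior (refCell n shape)) = refCell n shape := by
  rw [convex_refCell.closure_interior_eq_closure_of_nonempty_interior interior_refCell_nonempty,
    isClosed_refCell.closure_eq]

theorem zero_mem_refCell {n : ℕ} {shape : CellShape} : (0 : Eu n) ∈ refCell n shape := by
  cases shape with
  | simplex => exact ⟨fun i => le_rfl, by simp⟩
  | cube => exact fun i => ⟨le_rfl, by simp⟩

theorem contDiff_polyMap {n : ℕ} (P : Fin n → MvPolynomial (Fin n) ℝ) :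
    ContDiff ℝ 1 (polyMap P) := by
  rw [contDiff_euclidean]
  exact fun j => (contDiff_evalE (P j)).of_le (by exact_mod_cast le_top)

/-- A lower Lipschitz bound is inherited by the derivative. -/
theorem le_norm_fderiv_of_le {n : ℕ} {F : Eu n → Eu n} {F' : Eu n →L[ℝ] Eu n} {S : Set (Eu n)}
    {c : ℝ} (h : ∀ x ∈ S, ∀ y ∈ S, c * ‖x - y‖ ≤ ‖F x - F y‖) {x : Eu n} (hx : x ∈ interior S)
    (hF : HasFDerivAt F F' x) (v : Eu n) : c * ‖v‖ ≤ ‖F' v‖ := by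
  have hlim := (hF.hasLineDerivAt v).tendsto_slope_zero.norm
  refine ge_of_tendsto hlim ?_
  have hc : Tendsto (fun t : ℝ => x + t • v) (𝓝[≠] 0) (𝓝 x) := by
    have : Continuous fun t : ℝ => x + t • v := by fun_prop
    exact (this.tendsto' 0 _ (by simp)).mono_left nhdsWithin_le_nhds
  filter_upwards [hc.eventually (mem_interior_iff_mem_nhds.1 hx), self_mem_nhdsWithin] with t ht ht0
  have h1 := h _ ht x (interior_subset hx)
  have h2 : x + t • v - x = t • v := by abel
  rw [h2, norm_smul] at h1
  rw [norm_smul, norm_inv]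
  have h3 : 0 < ‖t‖ := norm_pos_iff.2 ht0
  rw [inv_mul_eq_div, le_div_iff₀ h3]
  linarith

/-- A linear map that expands by at least the factor `c` multiplies volumes by at least `c ^ n`. -/
theorem pow_le_abs_det {n : ℕ} {L : Eu n →L[ℝ] Eu n} {c : ℝ} (hc : 0 < c)
    (h : ∀ v, c * ‖v‖ ≤ ‖L v‖) : c ^ n ≤ |L.det| := by
  have hinj : Function.Injective L := by
    refine (injective_iff_map_eq_zero L).2 fun v hv => ?_
    have := h v
    rw [hv, norm_zero] at this
    exact norm_le_zero_iff.1 (nonpos_of_mul_nonpos_right this hc)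
  have hsurj : Function.Surjective L :=
    (LinearMap.injective_iff_surjective (f := (L : Eu n →ₗ[ℝ] Eu n))).1 hinj
  have hsub : Metric.ball (0 : Eu n) c ⊆ L '' Metric.ball 0 1 := by
    intro y hy
    obtain ⟨v, rfl⟩ := hsurj y
    refine ⟨v, ?_, rfl⟩
    rw [mem_ball_zero_iff] at hy ⊢
    by_contra! hv
    nlinarith [h v]
  have h1 := measure_mono (μ := volume) hsub
  rw [Measure.addHaar_image_continuousLinearMap, Measure.addHaar_ball_of_pos _ _ hc,
    finrank_euclideanSpace_fin] at h1
  have h2 : volume (Metric.ball (0 : Eu n) 1) ≠ 0 := (Metric.measure_ball_pos _ _ one_pos).ne'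
  have h3 : volume (Metric.ball (0 : Eu n) 1) ≠ ⊤ := measure_ball_lt_top.ne
  rw [ENNReal.mul_le_mul_iff_left h2 h3] at h1
  exact (ENNReal.ofReal_le_ofReal_iff (abs_nonneg _)).1 h1

namespace Mesh

variable {n : ℕ} {Ω : Set (Eu n)} {shape : CellShape}

theorem contDiff_map (M : Mesh Ω shape) (c : Fin M.card) : ContDiff ℝ 1 (M.map c) :=
  contDiff_polyMap _

theorem isCompact_cell (M : Mesh Ω shape) (c : Fin M.card) : IsCompact (M.cell c) :=
  isCompact_refCell.image (M.contDiff_map c).continuous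

theorem iUnion_cell (M : Mesh Ω shape) : ⋃ c, M.cell c = closure Ω := M.cover

theorem cell_subset (M : Mesh Ω shape) (c : Fin M.card) : M.cell c ⊆ closure Ω := by
  rw [← M.iUnion_cell]; exact subset_iUnion _ c

theorem exists_mem_cell (M : Mesh Ω shape) {x : Eu n} (hx : x ∈ closure Ω) :
    ∃ c, x ∈ M.cell c := by
  rw [← M.iUnion_cell] at hx
  exact mem_iUnion.1 hx

theorem diam_cell_le (M : Mesh Ω shape) (c : Fin M.card) : Metric.diam (M.cell c) ≤ M.size :=
  le_ciSup (f := fun c => Metric.diam (M.cell c)) (Set.finite_range _).bddAbove c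

theorem dist_le_size (M : Mesh Ω shape) {c : Fin M.card} {x y : Eu n} (hx : x ∈ M.cell c)
    (hy : y ∈ M.cell c) : ‖x - y‖ ≤ M.size := by
  rw [← dist_eq_norm]
  exact (Metric.dist_le_diam_of_mem (M.isCompact_cell c).isBounded hx hy).trans (M.diam_cell_le c)

/-- The cell without its boundary, and without the boundary points of `Ω` that lie in the interior
of `closure Ω`. -/
def inner (M : Mesh Ω shape) (c : Fin M.card) : Set (Eu n) :=
  M.map c '' interior (refCell n shape) ∩ Ω

theorem inner_subset (M : Mesh Ω shape) (c : Fin M.card) : M.inner c ⊆ Ω := inter_subset_right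

theorem inner_subset_cell (M : Mesh Ω shape) (c : Fin M.card) : M.inner c ⊆ M.cell c :=
  inter_subset_left.trans (image_mono interior_subset)

theorem pairwise_disjoint_inner (M : Mesh Ω shape) :
    Pairwise (Function.onFun Disjoint M.inner) := fun c d hcd =>
  (M.disjoint c d hcd).mono inter_subset_left inter_subset_left

variable {M : Mesh Ω shape} {κ : ℝ}

/-- A mesh of a nonempty open set in positive dimension has a nondegenerate cell, so all cells of a
regular mesh are nondegenerate. -/
theorem IsRegular.pos (hM : M.IsRegular κ) (hn : 1 ≤ n) (hΩ : IsOpen Ω) (hne : Ω.Nonempty) :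
    0 < κ ∧ 0 < M.size := by
  have hsize : 0 < M.size := by
    by_contra! hcon
    have hfin : Ω.Finite := by
      refine (Set.finite_iUnion (f := fun c => M.cell c) fun c => ?_).subset
        (subset_closure.trans M.iUnion_cell.symm.subset)
      refine Set.Subsingleton.finite fun x hx y hy => ?_
      have := (M.dist_le_size hx hy).trans hcon
      exact sub_eq_zero.1 (norm_le_zero_iff.1 this)
    have : Nonempty (Fin n) := ⟨⟨0, hn⟩⟩
    exact (hΩ.measure_pos volume hne).ne' (hfin.measure_zero volume)
  refine ⟨?_, hsize⟩
  obtain ⟨x, hx⟩ := hne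
  obtain ⟨c, -⟩ := M.exists_mem_cell (subset_closure hx)
  by_contra! hκ
  have := hM.quasiUniform c
  have := mul_nonpos_of_nonpos_of_nonneg hκ (Metric.diam_nonneg (s := M.cell c))
  linarith

theorem IsRegular.le_norm_map_sub (hM : M.IsRegular κ) (hκ : 0 < κ) (c : Fin M.card) :
    ∀ x ∈ refCell n shape, ∀ y ∈ refCell n shape,
      M.size / κ ^ 2 * ‖x - y‖ ≤ ‖M.map c x - M.map c y‖ := by
  intro x hx y hy
  have h1 := hM.shapeRegular c x hx y hy
  have h2 := mul_le_mul_of_nonneg_right (hM.quasiUniform c) (norm_nonneg (x - y))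
  rw [div_mul_eq_mul_div, div_le_iff₀ (by positivity)]
  nlinarith

theorem IsRegular.injOn (hM : M.IsRegular κ) (hκ : 0 < κ) (hh : 0 < M.size) (c : Fin M.card) :
    InjOn (M.map c) (refCell n shape) := by
  intro x hx y hy hxy
  have h1 := hM.le_norm_map_sub hκ c x hx y hy
  rw [hxy, sub_self, norm_zero] at h1
  have h2 : 0 < M.size / κ ^ 2 := by positivity
  exact sub_eq_zero.1 (norm_le_zero_iff.1 (nonpos_of_mul_nonpos_right h1 h2))

theorem hasFDerivAt_map (M : Mesh Ω shape) (c : Fin M.card) (x : Eu n) :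
    HasFDerivAt (M.map c) (fderiv ℝ (M.map c) x) x :=
  ((M.contDiff_map c).differentiable one_ne_zero x).hasFDerivAt

theorem IsRegular.isOpen_image (hM : M.IsRegular κ) (hκ : 0 < κ) (hh : 0 < M.size)
    (c : Fin M.card) : IsOpen (M.map c '' interior (refCell n shape)) := by
  rw [isOpen_iff_mem_nhds]
  rintro _ ⟨x, hx, rfl⟩
  have hlow := le_norm_fderiv_of_le (hM.le_norm_map_sub hκ c) hx (M.hasFDerivAt_map c x)
  have hc : 0 < M.size / κ ^ 2 := by positivity
  have hinj : LinearMap.ker (fderiv ℝ (M.map c) x : Eu n →ₗ[ℝ] Eu n) = ⊥ := by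
    refine LinearMap.ker_eq_bot'.2 fun v hv => ?_
    have h1 := hlow v
    rw [show fderiv ℝ (M.map c) x v = 0 from hv, norm_zero] at h1
    exact norm_le_zero_iff.1 (nonpos_of_mul_nonpos_right h1 hc)
  have hsurj : LinearMap.range (fderiv ℝ (M.map c) x : Eu n →ₗ[ℝ] Eu n) = ⊤ :=
    LinearMap.ker_eq_bot_iff_range_eq_top.1 hinj
  have hstrict : HasStrictFDerivAt (M.map c) (fderiv ℝ (M.map c) x) x :=
    (M.contDiff_map c).contDiffAt.hasStrictFDerivAt one_ne_zero
  rw [← hstrict.map_nhds_eq_of_surj hsurj]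
  exact image_mem_map (isOpen_interior.mem_nhds hx)

theorem IsRegular.isOpen_inner (hM : M.IsRegular κ) (hκ : 0 < κ) (hh : 0 < M.size)
    (hΩ : IsOpen Ω) (c : Fin M.card) : IsOpen (M.inner c) :=
  (hM.isOpen_image hκ hh c).inter hΩ

/-- Up to a null set, a cell is the image of the interior of the reference cell, intersected with `Ω`:
the cell map is `C¹`, and the frontiers of the reference cell and of `Ω` are null sets. -/
theorem volume_cell_diff_inner (M : Mesh Ω shape) (hΩ : volume (frontier Ω) = 0)
    (hΩo : IsOpen Ω) (c : Fin M.card) : volume (M.cell c \ M.inner c) = 0 := by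
  have h1 : M.cell c \ M.inner c ⊆ M.map c '' frontier (refCell n shape) ∪ frontier Ω := by
    rintro _ ⟨⟨x, hx, rfl⟩, hn⟩
    by_cases hxΩ : M.map c x ∈ Ω
    · left
      refine mem_image_of_mem _ ⟨subset_closure hx, fun hxi => hn ⟨mem_image_of_mem _ hxi, hxΩ⟩⟩
    · right
      exact ⟨M.cell_subset c (mem_image_of_mem _ hx), by rwa [hΩo.interior_eq]⟩
  refine measure_mono_null h1 (measure_union_null ?_ hΩ)
  refine addHaar_image_eq_zero_of_differentiableOn_of_addHaar_eq_zero volume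
    ((M.contDiff_map c).differentiable one_ne_zero).differentiableOn ?_
  exact convex_refCell.addHaar_frontier volume

theorem iUnion_inner_ae_eq (M : Mesh Ω shape) (hΩ : volume (frontier Ω) = 0) (hΩo : IsOpen Ω) :
    (⋃ c, M.inner c : Set (Eu n)) =ᵐ[volume] Ω := by
  refine LE.le.eventuallyLE (iUnion_subset fun c => M.inner_subset c) |>.antisymm ?_
  refine ae_le_set.2 (measure_mono_null (t := ⋃ c, M.cell c \ M.inner c) ?_
    (measure_iUnion_null fun c => M.volume_cell_diff_inner hΩ hΩo c))
  rintro x ⟨hx, hn⟩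
  obtain ⟨c, hc⟩ := M.exists_mem_cell (subset_closure hx)
  exact mem_iUnion.2 ⟨c, hc, fun h => hn (mem_iUnion.2 ⟨c, h⟩)⟩

/-- Integrals over `Ω` are sums of integrals over the cells. -/
theorem IsRegular.lintegral_eq_sum (hM : M.IsRegular κ) (hκ : 0 < κ) (hh : 0 < M.size)
    (hΩ : volume (frontier Ω) = 0) (hΩo : IsOpen Ω) (g : Eu n → ℝ≥0∞) :
    ∫⁻ x in Ω, g x = ∑ c, ∫⁻ x in M.inner c, g x := by
  rw [← setLIntegral_congr (M.iUnion_inner_ae_eq hΩ hΩo),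
    lintegral_iUnion (fun c => (hM.isOpen_inner hκ hh hΩo c).measurableSet)
      M.pairwise_disjoint_inner, tsum_fintype]

/-- The change of variables to the reference cell, as an inequality. -/
theorem IsRegular.le_lintegral_inner (hM : M.IsRegular κ) (hκ : 0 < κ) (hh : 0 < M.size)
    (hΩ : volume (frontier Ω) = 0) (hΩo : IsOpen Ω) (c : Fin M.card) (g : Eu n → ℝ≥0∞) :
    ENNReal.ofReal ((M.size / κ ^ 2) ^ n) * ∫⁻ x in interior (refCell n shape), g (M.map c x)
      ≤ ∫⁻ x in M.inner c, g x := by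
  have hc : 0 < M.size / κ ^ 2 := by positivity
  have h1 : (M.inner c : Set (Eu n)) =ᵐ[volume] M.map c '' interior (refCell n shape) := by
    refine LE.le.eventuallyLE inter_subset_left |>.antisymm ?_
    refine ae_le_set.2 (measure_mono_null (sdiff_subset_sdiff_left ?_)
      (M.volume_cell_diff_inner hΩ hΩo c))
    exact image_mono interior_subset
  rw [setLIntegral_congr h1, lintegral_image_eq_lintegral_abs_det_fderiv_mul volume
    isOpen_interior.measurableSet (fun x _ => (M.hasFDerivAt_map c x).hasFDerivWithinAt)
    ((hM.injOn hκ hh c).mono interior_subset)]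
  rw [← lintegral_const_mul' _ _ ENNReal.ofReal_ne_top]
  refine setLIntegral_mono' isOpen_interior.measurableSet fun x hx => ?_
  gcongr
  exact pow_le_abs_det hc (le_norm_fderiv_of_le (hM.le_norm_map_sub hκ c) hx (M.hasFDerivAt_map c x))

theorem volume_inner_le (M : Mesh Ω shape) (hh : 0 < M.size) (c : Fin M.card) :
    volume (M.inner c) ≤ ENNReal.ofReal ((2 * M.size) ^ n) * volume (Metric.ball (0 : Eu n) 1) := by
  have hsub : M.inner c ⊆ Metric.ball (M.map c 0) (2 * M.size) := by
    intro x hx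
    have := M.dist_le_size (M.inner_subset_cell c hx) (mem_image_of_mem (M.map c) zero_mem_refCell)
    rw [mem_ball_iff_norm]
    linarith
  refine (measure_mono hsub).trans ?_
  rw [Measure.addHaar_ball_of_pos _ _ (by positivity), finrank_euclideanSpace_fin]

/-- The number of cells near a point is bounded, because the cells are disjoint and have volume at
least a multiple of `hⁿ`. -/
theorem IsRegular.exists_packing (n : ℕ) (shape : CellShape) (κ R : ℝ) (hR : 0 < R) :
    ∃ N : ℕ, ∀ (Ω : Set (Eu n)) (M : Mesh Ω shape), M.IsRegular κ → 0 < κ → 0 < M.size →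
      volume (frontier Ω) = 0 → IsOpen Ω → ∀ (y : Eu n) (t : Finset (Fin M.card)),
        (∀ c ∈ t, M.map c 0 ∈ Metric.ball y (R * M.size)) → t.card ≤ N := by
  set V := volume (interior (refCell n shape)) with hV
  set B := volume (Metric.ball (0 : Eu n) 1) with hB
  have hV0 : V ≠ 0 := (isOpen_interior.measure_pos volume interior_refCell_nonempty).ne'
  have hVt : V ≠ ⊤ := ((measure_mono interior_subset).trans_lt isCompact_refCell.measure_lt_top).ne
  have hBt : B ≠ ⊤ := measure_ball_lt_top.ne
  refine ⟨⌊((R + 1) * κ ^ 2) ^ n * B.toReal / V.toReal⌋₊, ?_⟩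
  intro Ω M hM hκ hh hΩ hΩo y t ht
  have h1 : ∀ c, ENNReal.ofReal ((M.size / κ ^ 2) ^ n) * V ≤ volume (M.inner c) := by
    intro c
    simpa using hM.le_lintegral_inner hκ hh hΩ hΩo c fun _ => 1
  have h2 : ∑ c ∈ t, volume (M.inner c)
      ≤ ENNReal.ofReal (((R + 1) * M.size) ^ n) * B := by
    rw [← measure_biUnion_finset (fun c _ d _ h => M.pairwise_disjoint_inner h)
      (fun c _ => (hM.isOpen_inner hκ hh hΩo c).measurableSet)]
    have hsub : (⋃ c ∈ t, M.inner c) ⊆ Metric.ball y ((R + 1) * M.size) := by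
      intro x hx
      obtain ⟨c, hc, hx⟩ := mem_iUnion₂.1 hx
      have h3 := M.dist_le_size (M.inner_subset_cell c hx)
        (mem_image_of_mem (M.map c) zero_mem_refCell)
      have h4 := ht c hc
      rw [mem_ball_iff_norm] at h4 ⊢
      have h5 := norm_add_le (x - M.map c 0) (M.map c 0 - y)
      rw [sub_add_sub_cancel] at h5
      linarith
    refine (measure_mono hsub).trans ?_
    rw [Measure.addHaar_ball_of_pos _ _ (by positivity), finrank_euclideanSpace_fin]
  have h3 := (Finset.card_nsmul_le_sum t _ _ fun c _ => h1 c).trans h2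
  have h4 := ENNReal.toReal_mono (ENNReal.mul_ne_top ENNReal.ofReal_ne_top hBt) h3
  rw [nsmul_eq_mul, ENNReal.toReal_mul, ENNReal.toReal_mul, ENNReal.toReal_mul,
    ENNReal.toReal_ofReal (by positivity), ENNReal.toReal_ofReal (by positivity),
    ENNReal.toReal_natCast] at h4
  refine Nat.le_floor ?_
  have hVp : 0 < V.toReal := ENNReal.toReal_pos hV0 hVt
  rw [le_div_iff₀ hVp]
  have h5 : 0 < (M.size / κ ^ 2) ^ n := by positivity
  refine le_of_mul_le_mul_left ?_ h5
  calc (M.size / κ ^ 2) ^ n * (t.card * V.toReal)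
      = t.card * ((M.size / κ ^ 2) ^ n * V.toReal) := by ring
    _ ≤ ((R + 1) * M.size) ^ n * B.toReal := h4
    _ = (M.size / κ ^ 2) ^ n * (((R + 1) * κ ^ 2) ^ n * B.toReal) := by
      rw [← mul_assoc, ← mul_pow]
      congr 2
      field_simp

end Mesh

end Nudging

namespace Nudging

open scoped Topology
open Filter

/-! ### Lipschitz functions and weak derivatives -/

/-- Rademacher's theorem: directional derivatives of a Lipschitz function are weak derivatives. -/
theorem isWeakDeriv_of_lipschitz {n : ℕ} (U : Set (Eu n)) (i : Fin n) {W : Eu n → ℝ} {L : NNReal}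
    (hW : LipschitzWith L W) : IsWeakDeriv U i W fun x => lineDeriv ℝ W x (coordVec i) := by
  intro φ hφ
  obtain ⟨D, hD⟩ := hφ.smooth.lipschitzWith_of_hasCompactSupport hφ.compact (by simp)
  have h1 := hW.integral_lineDeriv_mul_eq (μ := volume) hD hφ.compact (coordVec i)
  have h2 : ∀ x, lineDeriv ℝ φ x (-coordVec i) = -fderiv ℝ φ x (coordVec i) := fun x => by
    rw [(hφ.smooth.differentiable (by simp) x).lineDeriv_eq_fderiv, map_neg]
  simp only [h2, neg_mul, integral_neg] at h1
  rw [setIntegral_eq_integral_of_forall_compl_eq_zero,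
    setIntegral_eq_integral_of_forall_compl_eq_zero, h1, neg_neg]
  · exact integral_congr_ae (.of_forall fun x => mul_comm _ _)
  · intro x hx
    rw [image_eq_zero_of_notMem_tsupport fun h => hx (hφ.support h), mul_zero]
  · intro x hx
    have := image_eq_zero_of_notMem_tsupport fun h => hx ((hφ.partialD i).support h)
    rw [show fderiv ℝ φ x (coordVec i) = 0 from this, mul_zero]

theorem norm_coordVec {n : ℕ} (i : Fin n) : ‖(coordVec i : Eu n)‖ = 1 := by simp [coordVec]

theorem memLp_of_bounded_continuous {n : ℕ} {U : Set (Eu n)} (hU : Bornology.IsBounded U)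
    {f : Eu n → ℝ} (hf : Continuous f) : MemLp f 2 (volume.restrict U) := by
  have hfin : IsFiniteMeasure (volume.restrict (closure U)) :=
    ⟨by rw [Measure.restrict_apply_univ]; exact hU.isCompact_closure.measure_lt_top⟩
  obtain ⟨C, hC⟩ := hU.isCompact_closure.exists_bound_of_continuousOn hf.continuousOn
  have h : MemLp f 2 (volume.restrict (closure U)) :=
    MemLp.of_bound hf.aestronglyMeasurable C
      ((ae_restrict_iff' isClosed_closure.measurableSet).2 (.of_forall fun x hx => hC x hx))
  exact h.mono_measure (Measure.restrict_mono subset_closure le_rfl)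

/-- The weak derivatives of a function that is Lipschitz on an open set are bounded by the Lipschitz
constant. -/
theorem IsWeakDeriv.norm_le_of_lipschitzOn {n : ℕ} {U : Set (Eu n)} (hU : IsOpen U)
    (hUb : Bornology.IsBounded U) {i : Fin n} {v g W : Eu n → ℝ} {L : NNReal}
    (hg : MemLp g 2 (volume.restrict U)) (h : IsWeakDeriv U i v g)
    (hvW : v =ᵐ[volume.restrict U] W) (hW : LipschitzOnWith L W U) :
    ∀ᵐ x ∂(volume.restrict U), ‖g x‖ₑ ≤ L := by
  obtain ⟨W', hW', hWW'⟩ := hW.extend_real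
  have hfin : IsFiniteMeasure (volume.restrict U) :=
    ⟨by rw [Measure.restrict_apply_univ]
        exact (measure_mono subset_closure).trans_lt hUb.isCompact_closure.measure_lt_top⟩
  have hbd : ∀ x, ‖lineDeriv ℝ W' x (coordVec i)‖ ≤ L := fun x => by
    simpa [norm_coordVec] using norm_lineDeriv_le_of_lipschitz ℝ hW' (x₀ := x) (v := coordVec i)
  have hm : MemLp (fun x => lineDeriv ℝ W' x (coordVec i)) 2 (volume.restrict U) :=
    MemLp.of_bound (measurable_lineDeriv hW'.continuous).aestronglyMeasurable L (.of_forall hbd)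
  have h1 := isWeakDeriv_of_lipschitz U i hW'
  have h2 : v =ᵐ[volume.restrict U] W' := by
    filter_upwards [hvW, ae_restrict_mem hU.measurableSet] with x hx hxU
    rw [hx, hWW' hxU]
  filter_upwards [IsWeakDeriv.unique hU hg hm (h.congr h2 (ae_eq_refl _)) h1] with x hx
  rw [hx, ← ofReal_norm, ← ENNReal.ofReal_coe_nnreal]
  exact ENNReal.ofReal_le_ofReal (hbd x)

/-- The weak gradient is determined by the function. -/
theorem toL2_injective {n : ℕ} {Ω : Set (Eu n)} (hΩ : IsOpen Ω) :
    Function.Injective (toL2 Ω) := by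
  refine (injective_iff_map_eq_zero _).2 fun v hv => ?_
  have hg : grad Ω v = 0 := by
    refine Lp.ext ?_
    have h0 : ∀ i, (fun x => grad Ω v x i) =ᵐ[volume.restrict Ω] fun _ => 0 := by
      intro i
      refine IsWeakDeriv.unique hΩ (memLp_coord _ i) MemLp.zero (isWeakDeriv_toL2 v i) ?_
      intro φ _
      rw [hv]
      have : ∫ x in Ω, (0 : L2 Ω) x * fderiv ℝ φ x (coordVec i) = 0 := by
        refine integral_eq_zero_of_ae ?_
        filter_upwards [Lp.coeFn_zero ℝ 2 (volume.restrict Ω)] with x hx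
        rw [hx]
        simp
      rw [this]
      simp
    filter_upwards [eventually_all.2 h0, Lp.coeFn_zero (Eu n) 2 (volume.restrict Ω)] with x hx h
    rw [h]
    ext i
    exact hx i
  apply Subtype.ext
  apply WithLp.ofLp_injective 2
  exact Prod.ext hv hg

theorem norm_sub_le_of_segment {n : ℕ} {w : Eu n → ℝ} (hw : Continuous w) {L : ℝ} {x y : Eu n}
    (h : ∀ z ∈ segment ℝ x y, ∀ᶠ z' in 𝓝 z, ‖w z' - w z‖ ≤ L * ‖z' - z‖) :
    ‖w y - w x‖ ≤ L * ‖y - x‖ := by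
  let p : ℝ → Eu n := fun t => x + t • (y - x)
  have hp : Continuous p := by fun_prop
  have hS : IsClosed {t | ‖w (p t) - w x‖ ≤ L * ‖y - x‖ * t} :=
    isClosed_le ((hw.comp hp).sub continuous_const).norm (by fun_prop)
  have hsub : Icc (0 : ℝ) 1 ⊆ {t | ‖w (p t) - w x‖ ≤ L * ‖y - x‖ * t} := by
    refine (hS.inter isClosed_Icc).Icc_subset_of_forall_mem_nhdsWithin ?_ ?_
    · simp [p]
    · rintro t ⟨ht, ht0, ht1⟩
      have hseg : p t ∈ segment ℝ x y := by
        rw [segment_eq_image']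
        exact ⟨t, ⟨ht0, ht1.le⟩, rfl⟩
      have hev := (hp.tendsto t).eventually (h _ hseg)
      filter_upwards [nhdsWithin_le_nhds hev, self_mem_nhdsWithin] with τ hτ htτ
      have h1 : p τ - p t = (τ - t) • (y - x) := by simp only [p]; module
      rw [h1, norm_smul, Real.norm_of_nonneg (sub_nonneg.2 (le_of_lt htτ))] at hτ
      have h2 := norm_add_le (w (p τ) - w (p t)) (w (p t) - w x)
      rw [sub_add_sub_cancel] at h2
      simp only [mem_ofPred_eq] at ht ⊢
      linarith
  have := hsub (right_mem_Icc.2 zero_le_one)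
  simpa [p] using this

/-- A continuous function that is locally Lipschitz in `Ω`, with a uniform constant, is in
`H¹(Ω)`. -/
theorem exists_h1_of_locallyLipschitz {n : ℕ} {Ω : Set (Eu n)} (hΩ : IsOpen Ω)
    (hΩb : Bornology.IsBounded Ω) {w : Eu n → ℝ} (hw : Continuous w) {L : ℝ} (hL0 : 0 ≤ L)
    (hL : ∀ x ∈ Ω, ∀ᶠ y in 𝓝 x, ‖w y - w x‖ ≤ L * ‖y - x‖) :
    ∃ u : H1 Ω, toL2 Ω u =ᵐ[volume.restrict Ω] w := by
  have hfin : IsFiniteMeasure (volume.restrict Ω) :=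
    ⟨by rw [Measure.restrict_apply_univ]
        exact (measure_mono subset_closure).trans_lt hΩb.isCompact_closure.measure_lt_top⟩
  have hwm : MemLp w 2 (volume.restrict Ω) := memLp_of_bounded_continuous hΩb hw
  let G : Eu n → Eu n := fun x => WithLp.toLp 2 fun i => lineDeriv ℝ w x (coordVec i)
  have hGmeas : Measurable G :=
    (WithLp.measurable_toLp 2 _).comp (measurable_pi_lambda _ fun i => measurable_lineDeriv hw)
  have hGm : MemLp G 2 (volume.restrict Ω) := by
    refine MemLp.of_bound hGmeas.aestronglyMeasurable (√(∑ _i : Fin n, L ^ 2))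
      ((ae_restrict_iff' hΩ.measurableSet).2 (.of_forall fun x hx => ?_))
    rw [EuclideanSpace.norm_eq]
    refine Real.sqrt_le_sqrt (Finset.sum_le_sum fun i _ => ?_)
    have := norm_lineDeriv_le_of_lip' ℝ (v := coordVec i) hL0 (hL x hx)
    rw [norm_coordVec, mul_one] at this
    gcongr
  have hweak : IsWeakGradient Ω (hwm.toLp w) (hGm.toLp G) := by
    intro φ hφ i
    have e1 : ∫ x in Ω, hwm.toLp w x * fderiv ℝ φ x (coordVec i)
        = ∫ x in Ω, w x * fderiv ℝ φ x (coordVec i) :=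
      integral_congr_ae (hwm.coeFn_toLp.mono fun x hx => by simp only [hx])
    have e2 : ∫ x in Ω, hGm.toLp G x i * φ x
        = ∫ x in Ω, lineDeriv ℝ w x (coordVec i) * φ x :=
      integral_congr_ae (hGm.coeFn_toLp.mono fun x hx => by simp only [hx]; rfl)
    rw [e1, e2]
    -- near the support of `φ` the function is Lipschitz
    obtain ⟨δ, hδ, hδΩ⟩ := hφ.compact.exists_thickening_subset_open hΩ hφ.support
    obtain ⟨B, hB⟩ := hΩb.isCompact_closure.exists_bound_of_continuousOn hw.continuousOn
    set S := Metric.thickening (δ / 2) (tsupport φ) with hS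
    have hSΩ : S ⊆ Ω := (Metric.thickening_mono (by linarith) _).trans hδΩ
    have hSo : IsOpen S := Metric.isOpen_thickening
    have hlip : LipschitzOnWith (max L (4 * B / δ)).toNNReal w S := by
      refine LipschitzOnWith.of_dist_le_mul fun x hx y hy => ?_
      rw [Real.coe_toNNReal _ (le_max_of_le_left hL0), dist_eq_norm, dist_eq_norm]
      rcases lt_or_ge ‖x - y‖ (δ / 2) with hxy | hxy
      · have hseg : segment ℝ y x ⊆ Ω := by
          intro z hz
          refine hδΩ ?_
          have hzb := (convex_ball y (δ / 2)).segment_subset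
            (Metric.mem_ball_self (by linarith)) (mem_ball_iff_norm.2 hxy) hz
          obtain ⟨a, ha, hya⟩ := Metric.mem_thickening_iff.1 hy
          refine Metric.mem_thickening_iff.2 ⟨a, ha, ?_⟩
          have := dist_triangle z y a
          rw [Metric.mem_ball] at hzb
          linarith
        refine (norm_sub_le_of_segment hw fun z hz => hL z (hseg hz)).trans ?_
        gcongr
        exact le_max_left _ _
      · have h1 := norm_sub_le (w x) (w y)
        have h2 := hB x (subset_closure (hSΩ hx))
        have h3 := hB y (subset_closure (hSΩ hy))
        calc ‖w x - w y‖ ≤ 2 * B := by linarith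
          _ = 4 * B / δ * (δ / 2) := by field_simp; ring
          _ ≤ max L (4 * B / δ) * ‖x - y‖ := by
            have : 0 ≤ 4 * B / δ := by
              have := (norm_nonneg _).trans h2
              positivity
            gcongr
            exact le_max_right _ _
    obtain ⟨W, hW, hwW⟩ := hlip.extend_real
    have h1 := isWeakDeriv_of_lipschitz Ω i hW φ hφ
    have hsup : tsupport φ ⊆ S := Metric.self_subset_thickening (by linarith) _
    have e3 : ∀ x, w x * fderiv ℝ φ x (coordVec i) = W x * fderiv ℝ φ x (coordVec i) := by
      intro x
      by_cases hx : x ∈ S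
      · rw [hwW hx]
      · have h2 : x ∉ tsupport fun y => fderiv ℝ φ y (coordVec i) :=
          fun h => hx (hsup (tsupport_fderiv_apply_subset ℝ _ h))
        rw [image_eq_zero_of_notMem_tsupport (f := fun y => fderiv ℝ φ y (coordVec i)) h2]
        simp
    have e4 : ∀ x, lineDeriv ℝ w x (coordVec i) * φ x = lineDeriv ℝ W x (coordVec i) * φ x := by
      intro x
      by_cases hx : x ∈ S
      · rw [Filter.EventuallyEq.lineDeriv_eq (hwW.eventuallyEq_of_mem (hSo.mem_nhds hx))]
      · rw [image_eq_zero_of_notMem_tsupport fun h => hx (hsup h)]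
        simp
    simp only [e3, e4]
    exact h1
  exact ⟨⟨WithLp.toLp 2 (hwm.toLp w, hGm.toLp G), hweak⟩, hwm.coeFn_toLp⟩

end Nudging

namespace Nudging

open scoped Topology
open Filter

/-! ### Norm equivalence on the reference cell -/

/-- On the reference cell, the supremum and the Lipschitz constant of a polynomial in `P_k` resp.
`Q_k` are bounded by its `L²` norm. -/
theorem exists_refPoly_bound (n k : ℕ) (shape : CellShape) (hk : 0 < k) :
    ∃ C : NNReal, ∀ p ∈ refPoly n k shape, ∃ N : NNReal,
      (N : ℝ≥0∞) ^ 2 ≤ C * ∫⁻ x in interior (refCell n shape), ‖evalE p x‖ₑ ^ 2 ∧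
      (∀ x ∈ refCell n shape, ‖evalE p x‖ ≤ N) ∧ LipschitzOnWith N (evalE p) (refCell n shape) := by
  set U := interior (refCell n shape) with hU
  have hUb : Bornology.IsBounded U := isCompact_refCell.isBounded.subset interior_subset
  let φ : exps n k shape → Eu n → ℝ := fun α => evalE (nodal k shape (refNode k α))
  have hφm : ∀ α, MemLp (φ α) 2 (volume.restrict U) := fun α => memLp_evalE hUb _
  let T : (exps n k shape → ℝ) →ₗ[ℝ] L2 U :=
    Fintype.linearCombination ℝ fun α => (hφm α).toLp (φ α)
  have hTae : ∀ y, T y =ᵐ[volume.restrict U] fun x => ∑ α, y α * φ α x := by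
    intro y
    have h1 : T y = ∑ α, y α • (hφm α).toLp (φ α) := Fintype.linearCombination_apply _ _ _
    rw [h1]
    refine (Lp.coeFn_finsetSum _ _).trans ?_
    have h2 : ∀ᵐ x ∂(volume.restrict U), ∀ α, (y α • (hφm α).toLp (φ α) : L2 U) x = y α * φ α x := by
      rw [eventually_all]
      intro α
      filter_upwards [Lp.coeFn_smul (y α) ((hφm α).toLp (φ α)), (hφm α).coeFn_toLp] with x h3 h4
      rw [h3, Pi.smul_apply, h4, smul_eq_mul]
    filter_upwards [h2] with x hx
    rw [Finset.sum_apply]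
    exact Finset.sum_congr rfl fun α _ => hx α
  have hφc : ∀ α, Continuous (φ α) := fun α => (contDiff_evalE _).continuous
  have hker : LinearMap.ker T = ⊥ := by
    refine LinearMap.ker_eq_bot'.2 fun y hy => ?_
    have hc : Continuous fun x => ∑ α, y α * φ α x := by fun_prop
    have h1 : (fun x => ∑ α, y α * φ α x) =ᵐ[volume.restrict U] fun _ => (0 : ℝ) := by
      refine (hTae y).symm.trans ?_
      rw [hy]
      exact Lp.coeFn_zero _ _ _
    have h2 := (Measure.eqOn_open_of_ae_eq h1 isOpen_interior hc.continuousOn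
      continuousOn_const).closure hc continuous_const
    rw [hU, closure_interior_refCell] at h2
    funext α
    have hα := isNode_refNode hk α.2
    have h3 := h2 (hα.mem hk)
    simp only at h3
    rw [Finset.sum_eq_single α] at h3
    · simp only [φ] at h3
      rwa [evalE_nodal_self hα, mul_one] at h3
    · intro β _ hβ
      simp only [φ]
      rw [evalE_nodal_of_ne hk (isNode_refNode hk β.2) hα, mul_zero]
      exact fun h => hβ (Subtype.ext (refNode_injective hk h))
    · simp
  obtain ⟨K, -, hK⟩ := T.exists_antilipschitzWith hker
  have hbd : ∀ α, ∃ B : NNReal, ∀ x ∈ refCell n shape, ‖φ α x‖ ≤ B := by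
    intro α
    obtain ⟨B, hB⟩ := isCompact_refCell.exists_bound_of_continuousOn (s := refCell n shape)
      (hφc α).continuousOn
    exact ⟨B.toNNReal, fun x hx => (hB x hx).trans (Real.le_coe_toNNReal B)⟩
  have hlip : ∀ α, ∃ B : NNReal, LipschitzOnWith B (φ α) (refCell n shape) := fun α =>
    ContDiffOn.exists_lipschitzOnWith (n := 1)
      ((contDiff_evalE _).of_le (by exact_mod_cast le_top)).contDiffOn
      one_ne_zero convex_refCell isCompact_refCell
  choose B hB using hbd
  choose B' hB' using hlip
  set A : NNReal := ∑ α, (B α + B' α) with hA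
  refine ⟨(A * K) ^ 2, fun p hp => ?_⟩
  let y : exps n k shape → ℝ := fun α => evalE p (refNode k α)
  have hpy : ∀ x, evalE p x = ∑ α, y α * φ α x := by
    intro x
    conv_lhs => rw [← interp_evalE hk hp, evalE_interp]
  have hy : (‖y‖₊ : ℝ≥0∞) ≤ K * ‖T y‖ₑ := by
    have := hK y 0
    rwa [map_zero, edist_zero_right, edist_zero_right] at this
  have hTy : ‖T y‖ₑ ^ 2 = ∫⁻ x in U, ‖evalE p x‖ₑ ^ 2 := by
    rw [lp_enorm_sq]
    refine lintegral_congr_ae ?_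
    filter_upwards [hTae y] with x hx
    rw [hx, hpy]
  refine ⟨‖y‖₊ * A, ?_, ?_, ?_⟩
  · rw [← hTy]
    push_cast
    calc ((‖y‖₊ : ℝ≥0∞) * A) ^ 2 ≤ (K * ‖T y‖ₑ * A) ^ 2 := by gcongr
      _ = _ := by ring
  · intro x hx
    rw [hpy]
    refine (norm_sum_le _ _).trans ?_
    rw [hA]
    push_cast
    rw [Finset.mul_sum]
    refine Finset.sum_le_sum fun α _ => ?_
    rw [norm_mul]
    refine mul_le_mul (norm_le_pi_norm y α) ?_ (norm_nonneg _) (norm_nonneg _)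
    exact (hB α x hx).trans (le_add_of_nonneg_right (B' α).coe_nonneg)
  · refine LipschitzOnWith.of_dist_le_mul fun x hx z hz => ?_
    rw [dist_eq_norm, hpy, hpy, ← Finset.sum_sub_distrib]
    refine (norm_sum_le _ _).trans ?_
    rw [hA]
    push_cast
    rw [Finset.mul_sum, Finset.sum_mul]
    refine Finset.sum_le_sum fun α _ => ?_
    rw [← mul_sub, norm_mul, mul_assoc]
    refine mul_le_mul (norm_le_pi_norm y α) ?_ (norm_nonneg _) (norm_nonneg _)
    have := (hB' α).dist_le_mul x hx z hz
    rw [dist_eq_norm] at this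
    refine this.trans ?_
    gcongr
    exact le_add_of_nonneg_left (B α).coe_nonneg

namespace Mesh

variable {n : ℕ} {Ω : Set (Eu n)} {shape : CellShape}

/-- The inverse estimate on a cell: for a function that is a polynomial in reference coordinates,
the supremum and `h` times the Lipschitz constant are bounded by `h^{-n/2}` times the `L²` norm. -/
theorem IsRegular.exists_cell_bound (n k : ℕ) (shape : CellShape) (hk : 0 < k) (κ : ℝ) :
    ∃ C : NNReal, ∀ (Ω : Set (Eu n)) (M : Mesh Ω shape), M.IsRegular κ → 0 < κ → 0 < M.size →
      volume (frontier Ω) = 0 → IsOpen Ω → ∀ (c : Fin M.card), ∀ p ∈ refPoly n k shape,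
      ∀ w : Eu n → ℝ, (∀ x ∈ refCell n shape, w (M.map c x) = evalE p x) →
      ∃ N : NNReal, volume (M.inner c) * (N : ℝ≥0∞) ^ 2 ≤ C * ∫⁻ x in M.inner c, ‖w x‖ₑ ^ 2 ∧
        (∀ z ∈ M.cell c, ‖w z‖ ≤ N) ∧
        LipschitzOnWith (N * (κ ^ 2 / M.size).toNNReal) w (M.cell c) := by
  obtain ⟨C, hC⟩ := exists_refPoly_bound n k shape hk
  set V := volume (Metric.ball (0 : Eu n) 1) with hV
  have hVt : V ≠ ⊤ := measure_ball_lt_top.ne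
  refine ⟨((2 * κ ^ 2) ^ n).toNNReal * V.toNNReal * C, ?_⟩
  intro Ω M hM hκ hh hΩ hΩo c p hp w hw
  obtain ⟨N, hN, hsup, hlip⟩ := hC p hp
  refine ⟨N, ?_, ?_, ?_⟩
  · have h1 := hM.le_lintegral_inner hκ hh hΩ hΩo c fun x => ‖w x‖ₑ ^ 2
    have h2 : ∫⁻ x in interior (refCell n shape), ‖w (M.map c x)‖ₑ ^ 2
        = ∫⁻ x in interior (refCell n shape), ‖evalE p x‖ₑ ^ 2 :=
      setLIntegral_congr_fun isOpen_interior.measurableSet fun x hx => by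
        simp only [hw x (interior_subset hx)]
    rw [h2] at h1
    have h3 : ENNReal.ofReal ((2 * M.size) ^ n)
        = ENNReal.ofReal ((2 * κ ^ 2) ^ n) * ENNReal.ofReal ((M.size / κ ^ 2) ^ n) := by
      rw [← ENNReal.ofReal_mul (by positivity), ← mul_pow]
      congr 2
      field_simp
    calc volume (M.inner c) * (N : ℝ≥0∞) ^ 2
        ≤ (ENNReal.ofReal ((2 * M.size) ^ n) * V) * (C *
          ∫⁻ x in interior (refCell n shape), ‖evalE p x‖ₑ ^ 2) := by
          gcongr
          exact M.volume_inner_le hh c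
      _ = ENNReal.ofReal ((2 * κ ^ 2) ^ n) * V * C * (ENNReal.ofReal ((M.size / κ ^ 2) ^ n) *
          ∫⁻ x in interior (refCell n shape), ‖evalE p x‖ₑ ^ 2) := by rw [h3]; ring
      _ ≤ ENNReal.ofReal ((2 * κ ^ 2) ^ n) * V * C * ∫⁻ x in M.inner c, ‖w x‖ₑ ^ 2 := by
          gcongr
      _ = _ := by
        push_cast
        rw [ENNReal.coe_toNNReal hVt]
        rfl
  · rintro _ ⟨x, hx, rfl⟩
    rw [hw x hx]
    exact hsup x hx
  · refine LipschitzOnWith.of_dist_le_mul ?_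
    rintro _ ⟨x, hx, rfl⟩ _ ⟨y, hy, rfl⟩
    rw [hw x hx, hw y hy]
    refine (hlip.dist_le_mul x hx y hy).trans ?_
    have h1 := hM.le_norm_map_sub hκ c x hx y hy
    rw [NNReal.coe_mul, Real.coe_toNNReal _ (by positivity), mul_assoc, dist_eq_norm, dist_eq_norm]
    refine mul_le_mul_of_nonneg_left ?_ N.coe_nonneg
    calc ‖x - y‖ = κ ^ 2 / M.size * (M.size / κ ^ 2 * ‖x - y‖) := by field_simp
      _ ≤ _ := by gcongr

variable {M : Mesh Ω shape} {κ : ℝ}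

/-- The interpolant of point values on the cells, as a function on `closure Ω`; on the intersection
of cells all choices give the same value, see `IsRegular.feInterp_map`. -/
noncomputable def feInterp (M : Mesh Ω shape) (k : ℕ) (ξ : Eu n → ℝ) (x : Eu n) : ℝ :=
  open Classical in
  if h : ∃ (c : Fin M.card) (y : Eu n), y ∈ refCell n shape ∧ M.map c y = x then
    evalE (interp k shape fun a => ξ (M.map h.choose a)) h.choose_spec.choose
  else 0

theorem IsRegular.feInterp_map (hM : M.IsRegular κ) (hκ : 0 < κ) (hh : 0 < M.size) {k : ℕ}
    (hk : 0 < k) (ξ : Eu n → ℝ) (c : Fin M.card) {y : Eu n} (hy : y ∈ refCell n shape) :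
    M.feInterp k ξ (M.map c y) = evalE (interp k shape fun a => ξ (M.map c a)) y := by
  classical
  have h : ∃ (d : Fin M.card) (z : Eu n), z ∈ refCell n shape ∧ M.map d z = M.map c y :=
    ⟨c, y, hy, rfl⟩
  rw [feInterp, dif_pos h]
  set d := h.choose with hd
  obtain ⟨hz, hzy⟩ := h.choose_spec.choose_spec
  set z := h.choose_spec.choose with hzdef
  obtain ⟨f, g, B, hf, hg, hB, hcd, hBF⟩ := M.conforming c d
  have hmem : M.map c y ∈ polyMap (M.poly c) '' f := by
    rw [← hcd]
    exact ⟨mem_image_of_mem _ hy, hzy ▸ mem_image_of_mem _ hz⟩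
  obtain ⟨y', hy', hyy'⟩ := hmem
  have hyf : y' = y := hM.injOn hκ hh c (hf.subset hy') hy hyy'
  subst hyf
  have hBy : B y' ∈ g := hB ▸ mem_image_of_mem B hy'
  have hzB : z = B y' := by
    refine hM.injOn hκ hh d hz (hg.subset hBy) ?_
    rw [hzy]
    exact (hBF y' hy').symm
  rw [hzB]
  refine evalE_interp_map hk hf hg hB (fun a ha => ?_) hy'
  exact congrArg ξ (hBF a ha)

/-- Point values on the nodes define a function in the finite element space. -/
theorem IsRegular.exists_feSpace_interp (hM : M.IsRegular κ) (hκ : 0 < κ) (hh : 0 < M.size)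
    (hΩo : IsOpen Ω) (hΩb : Bornology.IsBounded Ω) {k : ℕ} (hk : 0 < k) (ξ : Eu n → ℝ) :
    ∃ v ∈ M.feSpace k, ∃ w : Eu n → ℝ, toL2 Ω v =ᵐ[volume.restrict Ω] w ∧
      ∀ c, ∀ y ∈ refCell n shape,
        w (M.map c y) = evalE (interp k shape fun a => ξ (M.map c a)) y := by
  have hw := fun (c : Fin M.card) (y : Eu n) (hy : y ∈ refCell n shape) =>
    hM.feInterp_map hκ hh hk ξ c hy
  set w₀ := M.feInterp k ξ with hw₀
  have hc : 0 < M.size / κ ^ 2 := by positivity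
  -- Lipschitz continuity on the cells
  have hlip : ∃ L : NNReal, ∀ c, LipschitzOnWith L w₀ (M.cell c) := by
    have : ∀ c, ∃ L : NNReal, LipschitzOnWith L w₀ (M.cell c) := by
      intro c
      obtain ⟨K, hK⟩ := ContDiffOn.exists_lipschitzOnWith (n := 1)
        (f := evalE (interp k shape fun a => ξ (M.map c a)))
        ((contDiff_evalE _).of_le (by exact_mod_cast le_top)).contDiffOn
        one_ne_zero (convex_refCell (n := n) (shape := shape)) isCompact_refCell
      refine ⟨K * (κ ^ 2 / M.size).toNNReal, LipschitzOnWith.of_dist_le_mul ?_⟩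
      rintro _ ⟨x, hx, rfl⟩ _ ⟨y, hy, rfl⟩
      rw [hw c x hx, hw c y hy]
      refine (hK.dist_le_mul x hx y hy).trans ?_
      have h1 := hM.le_norm_map_sub hκ c x hx y hy
      rw [NNReal.coe_mul, Real.coe_toNNReal _ (by positivity), mul_assoc, dist_eq_norm,
        dist_eq_norm]
      refine mul_le_mul_of_nonneg_left ?_ K.coe_nonneg
      calc ‖x - y‖ = κ ^ 2 / M.size * (M.size / κ ^ 2 * ‖x - y‖) := by field_simp
        _ ≤ _ := by gcongr
    choose L hL using this
    exact ⟨∑ c, L c, fun c => (hL c).weaken (Finset.single_le_sum (f := L) (fun _ _ => zero_le)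
      (Finset.mem_univ c))⟩
  obtain ⟨L, hL⟩ := hlip
  -- near a point, all points lie in cells that contain the point
  have hnear : ∀ x, ∀ᶠ y in 𝓝 x, ∀ c, y ∈ M.cell c → x ∈ M.cell c := by
    intro x
    rw [eventually_all]
    intro c
    by_cases hx : x ∈ M.cell c
    · exact .of_forall fun y _ => hx
    · filter_upwards [(M.isCompact_cell c).isClosed.isOpen_compl.mem_nhds hx] with y hy hyc
      exact absurd hyc hy
  have hlocal : ∀ x, ∀ᶠ y in 𝓝 x, y ∈ closure Ω → ‖w₀ y - w₀ x‖ ≤ L * ‖y - x‖ := by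
    intro x
    filter_upwards [hnear x] with y hy hyΩ
    obtain ⟨c, hc⟩ := M.exists_mem_cell hyΩ
    have := (hL c).dist_le_mul y hc x (hy c hc)
    rwa [dist_eq_norm, dist_eq_norm] at this
  have hcont : ContinuousOn w₀ (closure Ω) := by
    intro x hx
    rw [ContinuousWithinAt, tendsto_iff_norm_sub_tendsto_zero]
    have h0 : Tendsto (fun y => L * ‖y - x‖) (𝓝[closure Ω] x) (𝓝 0) := by
      have : Continuous fun y => L * ‖y - x‖ := by fun_prop
      exact (this.tendsto' x 0 (by simp)).mono_left nhdsWithin_le_nhds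
    refine squeeze_zero' (.of_forall fun y => norm_nonneg _) ?_ h0
    filter_upwards [nhdsWithin_le_nhds (hlocal x), self_mem_nhdsWithin] with y hy hyΩ
    exact hy hyΩ
  obtain ⟨w, hwr⟩ := ContinuousMap.exists_restrict_eq isClosed_closure
    (⟨(closure Ω).domRestrict w₀, hcont.domRestrict⟩ : C(closure Ω, ℝ))
  have hww : ∀ x ∈ closure Ω, w x = w₀ x := fun x hx => DFunLike.congr_fun hwr ⟨x, hx⟩
  have hwmap : ∀ c, ∀ y ∈ refCell n shape,
      w (M.map c y) = evalE (interp k shape fun a => ξ (M.map c a)) y := by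
    intro c y hy
    rw [hww _ (M.cell_subset c (mem_image_of_mem _ hy)), hw c y hy]
  obtain ⟨u, hu⟩ := exists_h1_of_locallyLipschitz hΩo hΩb w.continuous L.coe_nonneg fun x hx => by
    filter_upwards [hlocal x, hΩo.mem_nhds hx] with y hy hyΩ
    rw [hww y (subset_closure hyΩ), hww x (subset_closure hx)]
    exact hy (subset_closure hyΩ)
  exact ⟨u, ⟨w, w.continuous.continuousOn, fun c => ⟨_, interp_mem hk _, hwmap c⟩, hu⟩, w, hu, hwmap⟩

/-- Continuous representatives of a function in `H¹(Ω)` agree on `closure Ω`. -/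
theorem eqOn_closure_of_ae_eq (hΩo : IsOpen Ω) {w w' : Eu n → ℝ} (hw : ContinuousOn w (closure Ω))
    (hw' : ContinuousOn w' (closure Ω)) (h : w =ᵐ[volume.restrict Ω] w') :
    EqOn w w' (closure Ω) :=
  (Measure.eqOn_open_of_ae_eq h hΩo (hw.mono subset_closure)
    (hw'.mono subset_closure)).of_subset_closure hw hw' subset_closure le_rfl

/-- The finite element space is finite-dimensional: its functions are determined by their values at
the nodes. -/
theorem finiteDimensional_feSpace (M : Mesh Ω shape) (hΩo : IsOpen Ω) {k : ℕ} (hk : 0 < k) :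
    FiniteDimensional ℝ (M.feSpace k) := by
  have hex : ∀ v : M.feSpace k, ∃ w : Eu n → ℝ, ContinuousOn w (closure Ω) ∧
      (∀ c, ∃ p ∈ refPoly n k shape, ∀ x ∈ refCell n shape, w (M.map c x) = evalE p x) ∧
      toL2 Ω v =ᵐ[volume.restrict Ω] w := fun v => v.2
  choose w hwc hwp hwae using hex
  have hnode : ∀ (c : Fin M.card) (α : exps n k shape), M.map c (refNode k α) ∈ closure Ω :=
    fun c α => M.cell_subset c (mem_image_of_mem _ ((isNode_refNode hk α.2).mem hk))
  let T : M.feSpace k →ₗ[ℝ] (Fin M.card → exps n k shape → ℝ) :=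
    { toFun := fun v c α => w v (M.map c (refNode k α))
      map_add' := by
        intro u v
        ext c α
        refine eqOn_closure_of_ae_eq hΩo (hwc (u + v)) ((hwc u).add (hwc v)) ?_ (hnode c α)
        refine (hwae (u + v)).symm.trans ?_
        rw [Submodule.coe_add, map_add]
        exact (Lp.coeFn_add _ _).trans ((hwae u).add (hwae v))
      map_smul' := by
        intro a v
        ext c α
        refine eqOn_closure_of_ae_eq hΩo (hwc (a • v)) ((hwc v).const_smul a) ?_ (hnode c α)
        refine (hwae (a • v)).symm.trans ?_
        rw [Submodule.coe_smul, map_smul]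
        exact (Lp.coeFn_smul _ _).trans ((hwae v).const_smul a) }
  refine FiniteDimensional.of_injective T ((injective_iff_map_eq_zero T).2 fun v hv => ?_)
  have h0 : ∀ x ∈ closure Ω, w v x = 0 := by
    intro x hx
    obtain ⟨c, y, hy, rfl⟩ := M.exists_mem_cell hx
    obtain ⟨p, hp, hwpx⟩ := hwp v c
    rw [hwpx y hy, ← interp_evalE hk hp, evalE_interp]
    refine Finset.sum_eq_zero fun α _ => ?_
    rw [← hwpx _ ((isNode_refNode hk α.2).mem hk)]
    have : w v (M.map c (refNode k α)) = 0 := congrFun (congrFun hv c) α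
    rw [this, zero_mul]
  apply Subtype.ext
  apply toL2_injective hΩo
  rw [Submodule.coe_zero, map_zero]
  refine Lp.ext ((hwae v).trans ?_)
  filter_upwards [ae_restrict_mem hΩo.measurableSet, Lp.coeFn_zero ℝ 2 (volume.restrict Ω)]
    with x hx h
  rw [h, h0 x (subset_closure hx)]
  rfl

end Mesh

end Nudging

namespace Nudging

open scoped Topology
open Filter

/-! ### The inverse inequality and quasi-interpolation -/

theorem evalE_sub {n : ℕ} (p q : MvPolynomial (Fin n) ℝ) (x : Eu n) :
    evalE (p - q) x = evalE p x - evalE q x := map_sub _ _ _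

theorem enorm_sq_eq_ofReal (x : ℝ) : ‖x‖ₑ ^ 2 = ENNReal.ofReal (x ^ 2) := by
  rw [Real.enorm_eq_ofReal_abs, ← ENNReal.ofReal_pow (abs_nonneg x), sq_abs]

theorem enorm_sub_sq_le (a b c : ℝ) : ‖a - b‖ₑ ^ 2 ≤ 2 * ‖a - c‖ₑ ^ 2 + 2 * ‖b - c‖ₑ ^ 2 := by
  rw [enorm_sq_eq_ofReal, enorm_sq_eq_ofReal, enorm_sq_eq_ofReal,
    show (2 : ℝ≥0∞) = ENNReal.ofReal 2 by simp, ← ENNReal.ofReal_mul (by norm_num),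
    ← ENNReal.ofReal_mul (by norm_num), ← ENNReal.ofReal_add (by positivity) (by positivity)]
  exact ENNReal.ofReal_le_ofReal (by nlinarith [sq_nonneg (a - c + (b - c))])

theorem lintegral_enorm_sub_sq_le {α : Type*} [MeasurableSpace α] {μ : Measure α} {f g k : α → ℝ}
    (hf : AEMeasurable (fun x => f x - k x) μ) :
    ∫⁻ x, ‖f x - g x‖ₑ ^ 2 ∂μ
      ≤ 2 * ∫⁻ x, ‖f x - k x‖ₑ ^ 2 ∂μ + 2 * ∫⁻ x, ‖g x - k x‖ₑ ^ 2 ∂μ := by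
  rw [← lintegral_const_mul' _ _ (by norm_num), ← lintegral_const_mul' _ _ (by norm_num),
    ← lintegral_add_left' ((hf.enorm.pow_const 2).const_mul 2)]
  exact lintegral_mono fun x => enorm_sub_sq_le _ _ _

theorem l2vec_enorm_sq {n : ℕ} {Ω : Set (Eu n)} (f : L2vec Ω) :
    ‖f‖ₑ ^ 2 = ∑ i, ∫⁻ x in Ω, ‖f x i‖ₑ ^ 2 := by
  have h1 : ‖f‖ₑ ^ 2 = ∫⁻ x in Ω, ‖f x‖ₑ ^ 2 := by
    rw [Lp.enorm_def, eLpNorm_eq_lintegral_rpow_enorm_toReal (by norm_num) (by norm_num),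
      ← ENNReal.rpow_two, ← ENNReal.rpow_mul]
    simp
  rw [h1, ← lintegral_finsetSum' _ fun i _ => ((memLp_coord f i).1.aemeasurable.enorm.pow_const 2)]
  refine lintegral_congr fun x => ?_
  rw [← ofReal_norm, ← ENNReal.ofReal_pow (norm_nonneg _), EuclideanSpace.norm_sq_eq,
    ENNReal.ofReal_sum_of_nonneg fun i _ => by positivity]
  refine Finset.sum_congr rfl fun i _ => ?_
  rw [enorm_sq_eq_ofReal, Real.norm_eq_abs, sq_abs]

namespace Mesh

variable {n : ℕ} {shape : CellShape}

/-- The inverse inequality on one cell, for any function that agrees there with a polynomial in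
reference coordinates: the equivalence of norms on the reference cell bounds its Lipschitz constant. -/
theorem IsRegular.exists_cell_grad_bound (n k : ℕ) (shape : CellShape) (hk : 0 < k) (κ : ℝ) :
    ∃ C : NNReal, ∀ (Ω : Set (Eu n)) (M : Mesh Ω shape), M.IsRegular κ → 0 < κ → 0 < M.size →
      volume (frontier Ω) = 0 → IsOpen Ω → Bornology.IsBounded Ω → ∀ (c : Fin M.card),
      ∀ p ∈ refPoly n k shape, ∀ w : Eu n → ℝ,
      (∀ x ∈ refCell n shape, w (M.map c x) = evalE p x) →
      ∀ (i : Fin n) (f g : Eu n → ℝ), IsWeakDeriv (M.inner c) i f g →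
      MemLp g 2 (volume.restrict (M.inner c)) → f =ᵐ[volume.restrict (M.inner c)] w →
      ∫⁻ x in M.inner c, ‖g x‖ₑ ^ 2
        ≤ ENNReal.ofReal (C / M.size ^ 2) * ∫⁻ x in M.inner c, ‖w x‖ₑ ^ 2 := by
  obtain ⟨C, hC⟩ := IsRegular.exists_cell_bound n k shape hk κ
  refine ⟨(κ ^ 4).toNNReal * C, ?_⟩
  intro Ω M hM hκ hh hΩ hΩo hΩb c p hp w hw i f g hfg hg hfw
  obtain ⟨N, hN, -, hlip⟩ := hC Ω M hM hκ hh hΩ hΩo c p hp w hw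
  have h1 := hfg.norm_le_of_lipschitzOn (hM.isOpen_inner hκ hh hΩo c)
    (hΩb.subset (M.inner_subset c)) hg hfw (hlip.mono (M.inner_subset_cell c))
  calc ∫⁻ x in M.inner c, ‖g x‖ₑ ^ 2
      ≤ ∫⁻ _x in M.inner c, ((N * (κ ^ 2 / M.size).toNNReal : NNReal) : ℝ≥0∞) ^ 2 :=
        lintegral_mono_ae (h1.mono fun x hx => by gcongr)
    _ = ENNReal.ofReal ((κ ^ 2 / M.size) ^ 2) * (volume (M.inner c) * (N : ℝ≥0∞) ^ 2) := by
        rw [setLIntegral_const, ENNReal.ofReal_pow (by positivity)]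
        push_cast
        rw [ENNReal.ofReal]
        ring
    _ ≤ ENNReal.ofReal ((κ ^ 2 / M.size) ^ 2) * (C * ∫⁻ x in M.inner c, ‖w x‖ₑ ^ 2) := by
        gcongr
    _ = _ := by
        rw [← mul_assoc, ← ENNReal.ofReal_coe_nnreal (p := C),
          ← ENNReal.ofReal_mul (by positivity)]
        congr 2
        rw [NNReal.coe_mul, Real.coe_toNNReal _ (by positivity)]
        field_simp

/-- The inverse inequality on the finite element space. -/
theorem IsRegular.exists_inverse_inequality (n k : ℕ) (shape : CellShape) (hk : 0 < k) (κ : ℝ) :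
    ∃ C : NNReal, ∀ (Ω : Set (Eu n)) (M : Mesh Ω shape), M.IsRegular κ → 0 < κ → 0 < M.size →
      volume (frontier Ω) = 0 → IsOpen Ω → Bornology.IsBounded Ω → ∀ v ∈ M.feSpace k,
      ‖grad Ω v‖ₑ ^ 2 ≤ ENNReal.ofReal (C / M.size ^ 2) * ‖toL2 Ω v‖ₑ ^ 2 := by
  obtain ⟨C, hC⟩ := IsRegular.exists_cell_grad_bound n k shape hk κ
  refine ⟨n * C, ?_⟩
  intro Ω M hM hκ hh hΩ hΩo hΩb v hv
  obtain ⟨w, -, hwp, hvw⟩ := hv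
  have hi : ∀ i, ∫⁻ x in Ω, ‖grad Ω v x i‖ₑ ^ 2
      ≤ ENNReal.ofReal (C / M.size ^ 2) * ‖toL2 Ω v‖ₑ ^ 2 := by
    intro i
    rw [lp_enorm_sq, hM.lintegral_eq_sum hκ hh hΩ hΩo, hM.lintegral_eq_sum hκ hh hΩ hΩo,
      Finset.mul_sum]
    refine Finset.sum_le_sum fun c _ => ?_
    obtain ⟨p, hp, hpw⟩ := hwp c
    have hle : volume.restrict (M.inner c) ≤ volume.restrict Ω :=
      Measure.restrict_mono (M.inner_subset c) le_rfl
    have hae := hvw.filter_mono (ae_mono hle)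
    rw [lintegral_congr_ae (μ := volume.restrict (M.inner c)) (f := fun x => ‖toL2 Ω v x‖ₑ ^ 2)
      (g := fun x => ‖w x‖ₑ ^ 2) (hae.mono fun x hx => by simp only [hx])]
    exact hC Ω M hM hκ hh hΩ hΩo hΩb c p hp w hpw i _ _
      ((isWeakDeriv_toL2 v i).mono hΩo.measurableSet (M.inner_subset c))
      ((memLp_coord _ i).mono_measure hle) hae
  rw [l2vec_enorm_sq]
  refine (Finset.sum_le_sum fun i _ => hi i).trans ?_
  rw [Finset.sum_const, Finset.card_univ, Fintype.card_fin, nsmul_eq_mul, ← mul_assoc]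
  refine mul_le_mul_left (le_of_eq ?_) _
  rw [← ENNReal.ofReal_natCast, ← ENNReal.ofReal_mul (by positivity)]
  congr 1
  push_cast
  ring

set_option maxHeartbeats 1600000 in
/-- Quasi-interpolation. The values at the nodes of the finite element function are those of the
local polynomials `q c`; the errors on a cell are controlled by the errors of the polynomials of the
cell and of the cells `σ c α` that share a node with it. -/
theorem IsRegular.exists_quasi_interpolant (n k : ℕ) (shape : CellShape) (hk : 0 < k) (κ : ℝ) :
    ∃ C : NNReal, ∀ (Ω : Set (Eu n)) (M : Mesh Ω shape), M.IsRegular κ → 0 < κ → 0 < M.size →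
      volume (frontier Ω) = 0 → IsOpen Ω → Bornology.IsBounded Ω → ∀ (v : H1 Ω)
      (q : Fin M.card → MvPolynomial (Fin n) ℝ) (E E' : Fin M.card → ℝ≥0∞),
      (∀ c, (q c).totalDegree ≤ k) →
      (∀ c, ∫⁻ x in Ω ∩ Metric.ball (M.map c 0) (3 * M.size),
        ‖toL2 Ω v x - evalE (q c) x‖ₑ ^ 2 ≤ E c) →
      (∀ c i, ∫⁻ x in Ω ∩ Metric.ball (M.map c 0) (3 * M.size),
        ‖grad Ω v x i - evalE (MvPolynomial.pderiv i (q c)) x‖ₑ ^ 2 ≤ E' c) →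
      ∃ vh ∈ M.feSpace k, ∃ σ : Fin M.card → exps n k shape → Fin M.card,
        (∀ c α, ‖M.map (σ c α) 0 - M.map c 0‖ ≤ 2 * M.size) ∧
        ∀ c, ∫⁻ x in M.inner c, ‖toL2 Ω v x - toL2 Ω vh x‖ₑ ^ 2 ≤ C * (E c + ∑ α, E (σ c α)) ∧
          ∀ i, ∫⁻ x in M.inner c, ‖grad Ω v x i - grad Ω vh x i‖ₑ ^ 2
            ≤ 2 * E' c + ENNReal.ofReal (C / M.size ^ 2) * (E c + ∑ α, E (σ c α)) := by
  obtain ⟨C₁, hC₁⟩ := IsRegular.exists_cell_bound n k shape hk κ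
  obtain ⟨C₂, hC₂⟩ := IsRegular.exists_cell_grad_bound n k shape hk κ
  -- a bound for the basis functions
  have hΦ : ∃ Φ : NNReal, ∀ (α : exps n k shape), ∀ x ∈ refCell n shape,
      ‖evalE (nodal k shape (refNode k α)) x‖ ≤ Φ := by
    have : ∀ α : exps n k shape, ∃ B : NNReal, ∀ x ∈ refCell n shape,
        ‖evalE (nodal k shape (refNode k α)) x‖ ≤ B := by
      intro α
      obtain ⟨B, hB⟩ := isCompact_refCell.exists_bound_of_continuousOn (s := refCell n shape)
        (contDiff_evalE (nodal k shape (refNode k α))).continuous.continuousOn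
      exact ⟨B.toNNReal, fun x hx => (hB x hx).trans (Real.le_coe_toNNReal B)⟩
    choose B hB using this
    exact ⟨∑ α, B α, fun α x hx => (hB α x hx).trans (by
      exact_mod_cast Finset.single_le_sum (f := B) (fun _ _ => zero_le) (Finset.mem_univ α))⟩
  obtain ⟨Φ, hΦ⟩ := hΦ
  set m := Fintype.card (exps n k shape) with hm
  set C₃ : NNReal := Φ ^ 2 * m * (C₁ * (2 * (m + 1))) with hC₃
  refine ⟨2 + 2 * C₃ + 2 * (C₂ * C₃), ?_⟩
  intro Ω M hM hκ hh hΩ hΩo hΩb v q E E' hq hE hE'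
  by_cases hcard : IsEmpty (Fin M.card)
  · exact ⟨0, Submodule.zero_mem _, fun c => isEmptyElim c, fun c => isEmptyElim c,
      fun c => isEmptyElim c⟩
  obtain ⟨c₀⟩ := not_isEmpty_iff.1 hcard
  -- the cell whose polynomial provides the value at a point
  obtain ⟨cs, hcs⟩ : ∃ cs : Eu n → Fin M.card, ∀ x c, x ∈ M.cell c → x ∈ M.cell (cs x) := by
    classical
    refine ⟨fun x => if h : ∃ d, x ∈ M.cell d then h.choose else c₀, fun x c hx => ?_⟩
    have h : ∃ d, x ∈ M.cell d := ⟨c, hx⟩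
    simp only [dif_pos h]
    exact h.choose_spec
  obtain ⟨vh, hvh, w, hvw, hw⟩ := hM.exists_feSpace_interp hκ hh hΩo hΩb hk
    fun x => evalE (q (cs x)) x
  have hnode : ∀ (c : Fin M.card) (α : exps n k shape), M.map c (refNode k α) ∈ M.cell c :=
    fun c α => mem_image_of_mem _ ((isNode_refNode hk α.2).mem hk)
  let σ : Fin M.card → exps n k shape → Fin M.card := fun c α => cs (M.map c (refNode k α))
  have hσ : ∀ c α, M.map c (refNode k α) ∈ M.cell (σ c α) := fun c α => hcs _ c (hnode c α)
  refine ⟨vh, hvh, σ, ?_, fun c => ?_⟩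
  · intro c α
    have h1 := M.dist_le_size (mem_image_of_mem (M.map (σ c α)) zero_mem_refCell) (hσ c α)
    have h2 := M.dist_le_size (hnode c α) (mem_image_of_mem (M.map c) zero_mem_refCell)
    have h3 := norm_add_le (M.map (σ c α) 0 - M.map c (refNode k α))
      (M.map c (refNode k α) - M.map c 0)
    rw [sub_add_sub_cancel] at h3
    linarith
  set U := M.inner c with hU
  have hUΩ : U ⊆ Ω := M.inner_subset c
  have hle : volume.restrict U ≤ volume.restrict Ω := Measure.restrict_mono hUΩ le_rfl
  have hUb : Bornology.IsBounded U := hΩb.subset hUΩ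
  have hsubσ : ∀ α, U ⊆ Ω ∩ Metric.ball (M.map (σ c α) 0) (3 * M.size) := by
    intro α x hx
    refine ⟨hUΩ hx, mem_ball_iff_norm.2 ?_⟩
    have h1 := M.dist_le_size (hσ c α) (mem_image_of_mem (M.map (σ c α)) zero_mem_refCell)
    have h2 := M.dist_le_size (M.inner_subset_cell c hx) (hnode c α)
    have h3 := norm_add_le (x - M.map c (refNode k α)) (M.map c (refNode k α) - M.map (σ c α) 0)
    rw [sub_add_sub_cancel] at h3
    linarith
  have hsub : U ⊆ Ω ∩ Metric.ball (M.map c 0) (3 * M.size) := by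
    intro x hx
    refine ⟨hUΩ hx, mem_ball_iff_norm.2 ?_⟩
    have h1 := M.dist_le_size (M.inner_subset_cell c hx)
      (mem_image_of_mem (M.map c) zero_mem_refCell)
    linarith
  have hEc : ∫⁻ x in U, ‖toL2 Ω v x - evalE (q c) x‖ₑ ^ 2 ≤ E c :=
    (lintegral_mono_set hsub).trans (hE c)
  have hEσ : ∀ α, ∫⁻ x in U, ‖toL2 Ω v x - evalE (q (σ c α)) x‖ₑ ^ 2 ≤ E (σ c α) := fun α =>
    (lintegral_mono_set (hsubσ α)).trans (hE _)
  have hvm : MemLp (toL2 Ω v) 2 (volume.restrict U) := (Lp.memLp _).mono_measure hle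
  have hqm : ∀ p : MvPolynomial (Fin n) ℝ, MemLp (evalE p) 2 (volume.restrict U) := fun p =>
    memLp_evalE hUb p
  -- the differences of the local polynomials at the nodes
  let δ : exps n k shape → ℝ := fun α =>
    evalE (q (σ c α)) (M.map c (refNode k α)) - evalE (q c) (M.map c (refNode k α))
  have hδ : ∀ α, volume U * ‖δ α‖ₑ ^ 2 ≤ C₁ * (2 * (E c + E (σ c α))) := by
    intro α
    have hpoly : MvPolynomial.bind₁ (M.poly c) (q (σ c α) - q c) ∈ refPoly n k shape :=
      bind₁_mem_refPoly (M.poly_mem c) ((MvPolynomial.totalDegree_sub _ _).trans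
        (max_le (hq _) (hq _)))
    obtain ⟨N, hN, hsup, -⟩ := hC₁ Ω M hM hκ hh hΩ hΩo c _ hpoly (evalE (q (σ c α) - q c))
      fun x _ => (evalE_bind₁ _ _ _).symm
    have h1 : ‖δ α‖ₑ ≤ N := by
      have := hsup _ (hnode c α)
      rw [evalE_sub] at this
      rw [← ofReal_norm, ← ENNReal.ofReal_coe_nnreal]
      exact ENNReal.ofReal_le_ofReal this
    have h2 : ∫⁻ x in U, ‖evalE (q (σ c α) - q c) x‖ₑ ^ 2 ≤ 2 * (E c + E (σ c α)) := by
      have h3 := lintegral_enorm_sub_sq_le (μ := volume.restrict U) (f := evalE (q (σ c α)))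
        (g := evalE (q c)) (k := toL2 Ω v) ((hqm _).sub hvm).1.aemeasurable
      simp only [evalE_sub]
      refine h3.trans ?_
      rw [mul_add, add_comm]
      simp only [enorm_sub_rev _ (toL2 Ω v _)]
      gcongr
      exact hEσ α
    calc volume U * ‖δ α‖ₑ ^ 2 ≤ volume U * (N : ℝ≥0∞) ^ 2 := by gcongr
      _ ≤ C₁ * ∫⁻ x in U, ‖evalE (q (σ c α) - q c) x‖ₑ ^ 2 := hN
      _ ≤ _ := by gcongr
  -- the difference of the interpolant and the local polynomial
  let W : Eu n → ℝ := fun x => w x - evalE (q c) x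
  set D : MvPolynomial (Fin n) ℝ := interp k shape (fun a => evalE (q (cs (M.map c a))) (M.map c a))
    - MvPolynomial.bind₁ (M.poly c) (q c) with hD
  have hDm : D ∈ refPoly n k shape :=
    Submodule.sub_mem _ (interp_mem hk _) (bind₁_mem_refPoly (M.poly_mem c) (hq c))
  have hWD : ∀ x ∈ refCell n shape, W (M.map c x) = evalE D x := by
    intro x hx
    rw [hD, evalE_sub, evalE_bind₁]
    simp only [W]
    rw [hw c x hx]
    rfl
  have hDx : ∀ x ∈ refCell n shape, ‖evalE D x‖ₑ ^ 2
      ≤ (Φ ^ 2 * m : NNReal) * ∑ α, ‖δ α‖ₑ ^ 2 := by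
    intro x hx
    have h1 : evalE D x = ∑ α, δ α * evalE (nodal k shape (refNode k α)) x := by
      rw [← interp_evalE hk hDm, evalE_interp]
      refine Finset.sum_congr rfl fun α _ => ?_
      congr 1
      rw [hD, evalE_sub, evalE_bind₁, evalE_interp_node hk _ (isNode_refNode hk α.2)]
      rfl
    have h2 : evalE D x ^ 2 ≤ Φ ^ 2 * m * ∑ α, δ α ^ 2 := by
      rw [h1]
      refine (sq_sum_le_card_mul_sum_sq (α := ℝ)).trans ?_
      rw [Finset.card_univ, ← hm, mul_comm ((Φ : ℝ) ^ 2), mul_assoc]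
      have hm0 : (0 : ℝ) ≤ m := Nat.cast_nonneg m
      refine mul_le_mul_of_nonneg_left ?_ hm0
      rw [Finset.mul_sum]
      refine Finset.sum_le_sum fun α _ => ?_
      rw [mul_pow, mul_comm]
      refine mul_le_mul_of_nonneg_right ?_ (sq_nonneg _)
      rw [← sq_abs, ← Real.norm_eq_abs]
      exact pow_le_pow_left₀ (norm_nonneg _) (hΦ α x hx) 2
    simp only [enorm_sq_eq_ofReal]
    rw [← ENNReal.ofReal_coe_nnreal, ← ENNReal.ofReal_sum_of_nonneg fun α _ => sq_nonneg _,
      ← ENNReal.ofReal_mul (NNReal.coe_nonneg _)]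
    exact ENNReal.ofReal_le_ofReal (by push_cast; exact h2)
  set S := E c + ∑ α, E (σ c α) with hS
  have hW : ∫⁻ x in U, ‖W x‖ₑ ^ 2 ≤ C₃ * S := by
    calc ∫⁻ x in U, ‖W x‖ₑ ^ 2
        ≤ ∫⁻ _x in U, (Φ ^ 2 * m : NNReal) * ∑ α, ‖δ α‖ₑ ^ 2 := by
          refine setLIntegral_mono' (hM.isOpen_inner hκ hh hΩo c).measurableSet fun x hx => ?_
          obtain ⟨y, hy, rfl⟩ := M.inner_subset_cell c hx
          rw [hWD y hy]
          exact hDx y hy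
      _ = (Φ ^ 2 * m : NNReal) * ∑ α, volume U * ‖δ α‖ₑ ^ 2 := by
          rw [setLIntegral_const, ← Finset.mul_sum]
          ring
      _ ≤ (Φ ^ 2 * m : NNReal) * ∑ α, C₁ * (2 * (E c + E (σ c α))) := by
          exact mul_le_mul_right (Finset.sum_le_sum fun α _ => hδ α) _
      _ = (Φ ^ 2 * m : NNReal) * (C₁ * (2 * (m * E c + ∑ α, E (σ c α)))) := by
          rw [← Finset.mul_sum, ← Finset.mul_sum, Finset.sum_add_distrib, Finset.sum_const,
            Finset.card_univ, nsmul_eq_mul]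
      _ ≤ (Φ ^ 2 * m : NNReal) * (C₁ * (2 * ((m + 1) * S))) := by
          gcongr
          rw [hS, mul_add]
          gcongr
          · exact le_self_add
          · exact le_mul_of_one_le_left zero_le le_add_self
      _ = C₃ * S := by
          rw [hC₃]
          push_cast
          ring
  have hvhW : (fun x => toL2 Ω vh x - evalE (q c) x) =ᵐ[volume.restrict U] W := by
    filter_upwards [hvw.filter_mono (ae_mono hle)] with x hx
    simp only [W, hx]
  constructor
  · calc ∫⁻ x in U, ‖toL2 Ω v x - toL2 Ω vh x‖ₑ ^ 2
        ≤ 2 * (∫⁻ x in U, ‖toL2 Ω v x - evalE (q c) x‖ₑ ^ 2)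
          + 2 * ∫⁻ x in U, ‖toL2 Ω vh x - evalE (q c) x‖ₑ ^ 2 :=
          lintegral_enorm_sub_sq_le (hvm.sub (hqm _)).1.aemeasurable
      _ ≤ 2 * S + 2 * (C₃ * S) := by
          rw [lintegral_congr_ae (μ := volume.restrict U)
            (f := fun x => ‖toL2 Ω vh x - evalE (q c) x‖ₑ ^ 2) (g := fun x => ‖W x‖ₑ ^ 2)
            (hvhW.mono fun x hx => congrArg (fun y : ℝ => ‖y‖ₑ ^ 2) hx)]
          gcongr
          exact hEc.trans le_self_add
      _ ≤ _ := by
          push_cast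
          rw [add_mul, add_mul, mul_assoc]
          exact le_self_add
  · intro i
    have hgm : ∀ u : H1 Ω, MemLp (fun x => grad Ω u x i) 2 (volume.restrict U) := fun u =>
      (memLp_coord _ i).mono_measure hle
    have hwd := (((isWeakDeriv_toL2 vh i).mono hΩo.measurableSet hUΩ).sub
      ((Lp.memLp _).mono_measure hle) (hqm (q c)) (hgm vh) (hqm _) (isWeakDeriv_evalE U i (q c)))
    have h1 := hC₂ Ω M hM hκ hh hΩ hΩo hΩb c D hDm W hWD i _ _ hwd ((hgm vh).sub (hqm _)) hvhW
    calc ∫⁻ x in U, ‖grad Ω v x i - grad Ω vh x i‖ₑ ^ 2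
        ≤ 2 * (∫⁻ x in U, ‖grad Ω v x i - evalE (MvPolynomial.pderiv i (q c)) x‖ₑ ^ 2)
          + 2 * ∫⁻ x in U, ‖grad Ω vh x i - evalE (MvPolynomial.pderiv i (q c)) x‖ₑ ^ 2 :=
          lintegral_enorm_sub_sq_le ((hgm v).sub (hqm _)).1.aemeasurable
      _ ≤ 2 * E' c + 2 * (ENNReal.ofReal (C₂ / M.size ^ 2) * (C₃ * S)) := by
          gcongr
          · exact (lintegral_mono_set hsub).trans (hE' c i)
          · exact h1.trans (by gcongr)
      _ = 2 * E' c + ENNReal.ofReal ((2 * (C₂ * C₃) : NNReal) / M.size ^ 2) * S := by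
          have : ENNReal.ofReal ((2 * (C₂ * C₃) : NNReal) / M.size ^ 2)
              = 2 * ENNReal.ofReal (C₂ / M.size ^ 2) * C₃ := by
            rw [← ENNReal.ofReal_coe_nnreal (p := C₃),
              show (2 : ℝ≥0∞) = ENNReal.ofReal 2 by simp, ← ENNReal.ofReal_mul (by norm_num),
              ← ENNReal.ofReal_mul (by positivity)]
            congr 1
            push_cast
            ring
          rw [this]
          ring
      _ ≤ _ := by
          gcongr
          exact le_add_self

end Mesh

end Nudging

namespace Nudging

open scoped Topology
open Filter

/-! ### Approximation in the finite element space -/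

/-- As `sobolevSq` is an infimum over families of weak derivatives, a bound for each family is enough. -/
theorem le_mul_sobolevSq {n : ℕ} {Ω : Set (Eu n)} {r c : ℝ} (hc : 0 < c) {u : L2 Ω} {X : ℝ≥0∞}
    (h : ∀ D : (j : ℕ) → (Fin j → Fin n) → L2 Ω,
      (∀ j ≤ ⌊r⌋₊, ∀ I : Fin j → Fin n, IsWeakPartial Ω I u (D j I)) →
      X ≤ ENNReal.ofReal c * sobolevExpr Ω r D) :
    X ≤ ENNReal.ofReal c * sobolevSq Ω r u := by
  have hc0 : ENNReal.ofReal c ≠ 0 := (ENNReal.ofReal_pos.2 hc).ne'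
  have h1 : X / ENNReal.ofReal c ≤ sobolevSq Ω r u := by
    refine le_iInf₂ fun D hD => ?_
    have := h D hD
    rw [mul_comm] at this
    exact ENNReal.div_le_of_le_mul this
  rw [mul_comm]
  exact (ENNReal.div_le_iff hc0 ENNReal.ofReal_ne_top).1 h1

theorem enorm_add_sq_le {E : Type*} [SeminormedAddCommGroup E] (a b : E) :
    ‖a + b‖ₑ ^ 2 ≤ 2 * ‖a‖ₑ ^ 2 + 2 * ‖b‖ₑ ^ 2 := by
  rw [← ofReal_norm, ← ofReal_norm, ← ofReal_norm, ← ENNReal.ofReal_pow (norm_nonneg _),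
    ← ENNReal.ofReal_pow (norm_nonneg _), ← ENNReal.ofReal_pow (norm_nonneg _),
    show (2 : ℝ≥0∞) = ENNReal.ofReal 2 by simp, ← ENNReal.ofReal_mul (by norm_num),
    ← ENNReal.ofReal_mul (by norm_num), ← ENNReal.ofReal_add (by positivity) (by positivity)]
  refine ENNReal.ofReal_le_ofReal ?_
  nlinarith [norm_add_le a b, norm_nonneg a, norm_nonneg b, norm_nonneg (a + b),
    sq_nonneg (‖a‖ - ‖b‖)]

/-- The lower-order part of the Sobolev norm controls the `H¹` norm. -/
theorem enorm_sq_le_sobolevExpr {n : ℕ} {Ω : Set (Eu n)} (hΩ : IsOpen Ω) {s : ℝ} (hs : 0 < s)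
    (v : H1 Ω) {D : (j : ℕ) → (Fin j → Fin n) → L2 Ω}
    (hD : ∀ j ≤ ⌊1 + s⌋₊, ∀ I : Fin j → Fin n, IsWeakPartial Ω I (toL2 Ω v) (D j I)) :
    ‖toL2 Ω v‖ₑ ^ 2 ≤ sobolevExpr Ω (1 + s) D ∧
      ‖grad Ω v‖ₑ ^ 2 ≤ n * sobolevExpr Ω (1 + s) D := by
  have hm : 1 ≤ ⌊1 + s⌋₊ := Nat.le_floor (by push_cast; linarith)
  obtain ⟨V, -, -, -, hV0, hV1, hVD⟩ := exists_weakDeriv_family hΩ v hm hD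
  have hle : ∀ j ≤ ⌊1 + s⌋₊, ∀ I : Fin j → Fin n,
      ∫⁻ x in Ω, ‖D j I x‖ₑ ^ 2 ≤ sobolevExpr Ω (1 + s) D := by
    intro j hj I
    rw [← lp_enorm_sq]
    have h1 := Finset.single_le_sum (f := fun I : Fin j → Fin n => ‖D j I‖ₑ ^ 2)
      (fun _ _ => zero_le) (Finset.mem_univ I)
    have h2 := Finset.single_le_sum (f := fun j => ∑ I : Fin j → Fin n, ‖D j I‖ₑ ^ 2)
      (fun _ _ => zero_le) (Finset.mem_range.2 (Nat.lt_succ_of_le hj))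
    exact (h1.trans h2).trans le_self_add
  constructor
  · obtain ⟨I, hI⟩ := hVD 0
    rw [lp_enorm_sq, lintegral_congr_ae (μ := volume.restrict Ω) (g := fun x => ‖V 0 x‖ₑ ^ 2)
      (hV0.mono fun x hx => by simp only [hx]), hI]
    exact hle _ (Nat.zero_le _) I
  · rw [l2vec_enorm_sq]
    refine (Finset.sum_le_card_nsmul _ _ (sobolevExpr Ω (1 + s) D) fun i _ => ?_).trans ?_
    · obtain ⟨I, hI⟩ := hVD {i}
      rw [lintegral_congr_ae (μ := volume.restrict Ω) (g := fun x => ‖V {i} x‖ₑ ^ 2)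
        ((hV1 i).mono fun x hx => by simp only [hx]), hI]
      exact hle _ hm I
    · rw [Finset.card_univ, Fintype.card_fin, nsmul_eq_mul]

namespace Mesh

variable {n : ℕ} {Ω : Set (Eu n)} {shape : CellShape}

theorem map_zero_mem (M : Mesh Ω shape) (c : Fin M.card) : M.map c 0 ∈ closure Ω :=
  M.cell_subset c (mem_image_of_mem _ zero_mem_refCell)

/-- The balls around the cells overlap only finitely often. -/
theorem sum_lintegral_ball_le (M : Mesh Ω shape) {R : ℝ} {N : ℕ}
    (hN : ∀ (y : Eu n) (t : Finset (Fin M.card)),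
      (∀ c ∈ t, M.map c 0 ∈ Metric.ball y R) → t.card ≤ N) {G : Eu n → ℝ≥0∞} (hG : Measurable G) :
    ∑ c, ∫⁻ x in Ω ∩ Metric.ball (M.map c 0) R, G x ≤ N * ∫⁻ x in Ω, G x := by
  classical
  have h1 : ∀ c, ∫⁻ x in Ω ∩ Metric.ball (M.map c 0) R, G x
      = ∫⁻ x in Ω, (Metric.ball (M.map c 0) R).indicator G x := by
    intro c
    rw [setLIntegral_indicator Metric.isOpen_ball.measurableSet, inter_comm]
  simp only [h1]
  rw [← lintegral_finsetSum _ fun c _ => hG.indicator Metric.isOpen_ball.measurableSet,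
    ← lintegral_const_mul _ hG]
  refine lintegral_mono fun x => ?_
  simp only [indicator_apply]
  rw [← Finset.sum_filter, Finset.sum_const, nsmul_eq_mul]
  gcongr
  refine hN x _ fun c hc => ?_
  exact Metric.mem_ball_comm.1 (Finset.mem_filter.1 hc).2

set_option maxHeartbeats 1600000 in
/-- Approximation by finite element functions. For coarse meshes, the zero function will do. -/
theorem exists_approx (hΩ : IsBoundedLipschitzDomain Ω) {s : ℝ} (hs : 0 < s) {k : ℕ}
    (hsk : ⌈s⌉₊ ≤ k) (shape : CellShape) (κ : ℝ) :
    ∃ C : ℝ, 0 < C ∧ ∀ M : Mesh Ω shape, M.IsRegular κ → 0 < κ → 0 < M.size →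
      ∀ (v : H1 Ω) (D : (j : ℕ) → (Fin j → Fin n) → L2 Ω),
      (∀ j ≤ ⌊1 + s⌋₊, ∀ I : Fin j → Fin n, IsWeakPartial Ω I (toL2 Ω v) (D j I)) →
      ∃ vh ∈ M.feSpace k,
        ‖toL2 Ω (v - vh)‖ₑ ^ 2
          ≤ ENNReal.ofReal (C * M.size ^ (2 * (1 + s))) * sobolevExpr Ω (1 + s) D ∧
        ‖grad Ω (v - vh)‖ₑ ^ 2
          ≤ ENNReal.ofReal (C * M.size ^ (2 * s)) * sobolevExpr Ω (1 + s) D := by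
  have hk : 0 < k := (Nat.ceil_pos.2 hs).trans_le hsk
  obtain ⟨h₀, R, C, hh₀, hR, hC0, hloc⟩ := hΩ.exists_local_poly hs
  obtain ⟨C₁, hC₁⟩ := IsRegular.exists_quasi_interpolant n k shape hk κ
  obtain ⟨N, hN⟩ := IsRegular.exists_packing n shape κ (R + 2) (by linarith)
  obtain ⟨m, hm⟩ : ∃ m, m = Fintype.card (exps n k shape) := ⟨_, rfl⟩
  obtain ⟨A, hA⟩ : ∃ A : ℝ, A = C₁ * (C * (m + 1)) * N := ⟨_, rfl⟩
  have hA0 : 0 ≤ A := by rw [hA]; positivity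
  refine ⟨A + n * (2 * C * N + A) + h₀ ^ (-(2 * (1 + s))) + n * h₀ ^ (-(2 * s)), by positivity, ?_⟩
  intro M hM hκ hh v D hD
  obtain ⟨S, hS⟩ : ∃ S, S = sobolevExpr Ω (1 + s) D := ⟨_, rfl⟩
  rw [← hS]
  have hterm : 0 < h₀ ^ (-(2 * (1 + s))) ∧ 0 < h₀ ^ (-(2 * s)) := ⟨by positivity, by positivity⟩
  rcases lt_or_ge M.size h₀ with hlt | hge
  · obtain ⟨G, hGm, hGS, hG⟩ := hloc v D hD
    rw [← hS] at hGS
    have hG' := fun c => hG (M.map c 0) (M.map_zero_mem c) M.size hh hlt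
    choose q hq hq0 hq1 using hG'
    obtain ⟨g, hg⟩ : ∃ g : Fin M.card → ℝ≥0∞, ∀ c,
        g c = ∫⁻ x in Ω ∩ Metric.ball (M.map c 0) ((R + 2) * M.size), G x := ⟨_, fun _ => rfl⟩
    have hgsum : ∑ c, g c ≤ N * S := by
      simp only [hg]
      exact (M.sum_lintegral_ball_le (hN Ω M hM hκ hh hΩ.volume_frontier hΩ.isOpen) hGm).trans
        (by gcongr)
    have hex := hC₁ Ω M hM hκ hh hΩ.volume_frontier hΩ.isOpen hΩ.isBounded v q
      (fun c => ENNReal.ofReal (C * M.size ^ (2 * (1 + s)))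
        * ∫⁻ x in Ω ∩ Metric.ball (M.map c 0) (R * M.size), G x)
      (fun c => ENNReal.ofReal (C * M.size ^ (2 * s))
        * ∫⁻ x in Ω ∩ Metric.ball (M.map c 0) (R * M.size), G x)
      (fun c => (hq c).trans hsk) hq0 hq1
    obtain ⟨vh, hvh, σ, hσ, hest⟩ := hex
    have hball : ∀ (c d : Fin M.card), ‖M.map d 0 - M.map c 0‖ ≤ 2 * M.size →
        ∫⁻ x in Ω ∩ Metric.ball (M.map d 0) (R * M.size), G x ≤ g c := by
      intro c d hcd
      rw [hg]
      refine lintegral_mono_set (inter_subset_inter_right _ fun x hx => ?_)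
      rw [mem_ball_iff_norm] at hx ⊢
      have := norm_add_le (x - M.map d 0) (M.map d 0 - M.map c 0)
      rw [sub_add_sub_cancel] at this
      linarith
    have hself : ∀ c, ∫⁻ x in Ω ∩ Metric.ball (M.map c 0) (R * M.size), G x ≤ g c := fun c =>
      hball c c (by rw [sub_self, norm_zero]; positivity)
    have hsum : ∀ (e : ℝ) (c : Fin M.card),
        ENNReal.ofReal (C * e) * (∫⁻ x in Ω ∩ Metric.ball (M.map c 0) (R * M.size), G x)
          + ∑ α, ENNReal.ofReal (C * e) * ∫⁻ x in Ω ∩ Metric.ball (M.map (σ c α) 0) (R * M.size), G x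
        ≤ ENNReal.ofReal (C * e) * ((m + 1) * g c) := by
      intro e c
      rw [← Finset.mul_sum, ← mul_add]
      gcongr
      rw [add_mul, one_mul, add_comm]
      refine add_le_add ?_ (hself c)
      refine (Finset.sum_le_card_nsmul _ _ (g c) fun α _ => hball c _ (hσ c α)).trans ?_
      rw [Finset.card_univ, nsmul_eq_mul, hm]
    refine ⟨vh, hvh, ?_, ?_⟩
    · have h1 : ‖toL2 Ω (v - vh)‖ₑ ^ 2 = ∫⁻ x in Ω, ‖toL2 Ω v x - toL2 Ω vh x‖ₑ ^ 2 := by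
        rw [map_sub, lp_enorm_sq]
        refine lintegral_congr_ae ?_
        filter_upwards [Lp.coeFn_sub (toL2 Ω v) (toL2 Ω vh)] with x hx
        rw [hx, Pi.sub_apply]
      rw [h1, hM.lintegral_eq_sum hκ hh hΩ.volume_frontier hΩ.isOpen]
      calc ∑ c, ∫⁻ x in M.inner c, ‖toL2 Ω v x - toL2 Ω vh x‖ₑ ^ 2
          ≤ ∑ c, C₁ * (ENNReal.ofReal (C * M.size ^ (2 * (1 + s))) * ((m + 1) * g c)) :=
            Finset.sum_le_sum fun c _ => (hest c).1.trans (by gcongr; exact hsum _ c)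
        _ = C₁ * ENNReal.ofReal (C * M.size ^ (2 * (1 + s))) * (m + 1) * ∑ c, g c := by
            rw [Finset.mul_sum]
            exact Finset.sum_congr rfl fun c _ => by ring
        _ ≤ C₁ * ENNReal.ofReal (C * M.size ^ (2 * (1 + s))) * (m + 1) * (N * S) := by gcongr
        _ = ENNReal.ofReal (A * M.size ^ (2 * (1 + s))) * S := by
            have : ENNReal.ofReal (A * M.size ^ (2 * (1 + s)))
                = C₁ * ENNReal.ofReal (C * M.size ^ (2 * (1 + s))) * (m + 1) * N := by
              rw [← ENNReal.ofReal_coe_nnreal, ← ENNReal.ofReal_natCast m,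
                ← ENNReal.ofReal_natCast N, ← ENNReal.ofReal_one,
                ← ENNReal.ofReal_add (by positivity) (by positivity),
                ← ENNReal.ofReal_mul (by positivity), ← ENNReal.ofReal_mul (by positivity),
                ← ENNReal.ofReal_mul (by positivity), hA]
              congr 1
              ring
            rw [this]
            ring
        _ ≤ _ := by
            gcongr
            have : 0 ≤ n * (2 * C * N + A) := by positivity
            have : 0 ≤ n * h₀ ^ (-(2 * s)) := by positivity
            linarith [hterm.1]
    · have h1 : ∀ i, ∫⁻ x in Ω, ‖grad Ω (v - vh) x i‖ₑ ^ 2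
          = ∫⁻ x in Ω, ‖grad Ω v x i - grad Ω vh x i‖ₑ ^ 2 := by
        intro i
        rw [map_sub]
        refine lintegral_congr_ae ?_
        filter_upwards [Lp.coeFn_sub (grad Ω v) (grad Ω vh)] with x hx
        rw [hx, Pi.sub_apply, PiLp.sub_apply]
      have hpow : M.size ^ (2 * (1 + s)) = M.size ^ 2 * M.size ^ (2 * s) := by
        rw [mul_add, mul_one, Real.rpow_add hh, Real.rpow_two]
      have h2 : ∀ i, ∫⁻ x in Ω, ‖grad Ω v x i - grad Ω vh x i‖ₑ ^ 2
          ≤ ENNReal.ofReal ((2 * C * N + A) * M.size ^ (2 * s)) * S := by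
        intro i
        rw [hM.lintegral_eq_sum hκ hh hΩ.volume_frontier hΩ.isOpen]
        calc ∑ c, ∫⁻ x in M.inner c, ‖grad Ω v x i - grad Ω vh x i‖ₑ ^ 2
            ≤ ∑ c, (2 * (ENNReal.ofReal (C * M.size ^ (2 * s)) * g c)
              + ENNReal.ofReal (C₁ / M.size ^ 2)
                * (ENNReal.ofReal (C * M.size ^ (2 * (1 + s))) * ((m + 1) * g c))) :=
              Finset.sum_le_sum fun c _ => ((hest c).2 i).trans (by
                gcongr
                · exact hself c
                · exact hsum _ c)
          _ = (2 * ENNReal.ofReal (C * M.size ^ (2 * s)) + ENNReal.ofReal (C₁ / M.size ^ 2)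
                * ENNReal.ofReal (C * M.size ^ (2 * (1 + s))) * (m + 1)) * ∑ c, g c := by
              rw [Finset.mul_sum]
              exact Finset.sum_congr rfl fun c _ => by ring
          _ ≤ (2 * ENNReal.ofReal (C * M.size ^ (2 * s)) + ENNReal.ofReal (C₁ / M.size ^ 2)
                * ENNReal.ofReal (C * M.size ^ (2 * (1 + s))) * (m + 1)) * (N * S) := by gcongr
          _ = _ := by
              rw [← mul_assoc]
              congr 1
              rw [show (2 : ℝ≥0∞) = ENNReal.ofReal 2 by simp, ← ENNReal.ofReal_natCast m,
                ← ENNReal.ofReal_natCast N, ← ENNReal.ofReal_one,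
                ← ENNReal.ofReal_add (by positivity) (by positivity),
                ← ENNReal.ofReal_mul (by positivity), ← ENNReal.ofReal_mul (by positivity),
                ← ENNReal.ofReal_mul (by positivity),
                ← ENNReal.ofReal_add (by positivity) (by positivity),
                ← ENNReal.ofReal_mul (by positivity), hA, hpow]
              congr 1
              field_simp
      rw [l2vec_enorm_sq]
      refine (Finset.sum_le_card_nsmul _ _ _ fun i _ => (h1 i).trans_le (h2 i)).trans ?_
      rw [Finset.card_univ, Fintype.card_fin, nsmul_eq_mul, ← mul_assoc, ← ENNReal.ofReal_natCast n,
        ← ENNReal.ofReal_mul (by positivity), ← mul_assoc]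
      gcongr
      have : 0 ≤ n * h₀ ^ (-(2 * s)) := by positivity
      linarith [hterm.1]
  · have hone : ∀ e : ℝ, 0 ≤ e → 1 ≤ h₀ ^ (-e) * M.size ^ e := by
      intro e he
      have h1 : h₀ ^ e ≤ M.size ^ e := Real.rpow_le_rpow hh₀.le hge he
      rw [Real.rpow_neg hh₀.le, inv_mul_eq_div, one_le_div (by positivity)]
      exact h1
    obtain ⟨h1, h2⟩ := enorm_sq_le_sobolevExpr hΩ.isOpen hs v hD
    rw [← hS] at h1 h2
    refine ⟨0, Submodule.zero_mem _, ?_, ?_⟩ <;> rw [sub_zero]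
    · refine h1.trans (le_mul_of_one_le_left zero_le ?_)
      rw [← ENNReal.ofReal_one]
      refine ENNReal.ofReal_le_ofReal ((hone (2 * (1 + s)) (by positivity)).trans ?_)
      gcongr
      have : 0 ≤ n * (2 * C * N + A) := by positivity
      have : 0 ≤ n * h₀ ^ (-(2 * s)) := by positivity
      linarith
    · refine h2.trans ?_
      gcongr
      rw [← ENNReal.ofReal_natCast]
      refine ENNReal.ofReal_le_ofReal ?_
      calc (n : ℝ) = n * 1 := (mul_one _).symm
        _ ≤ n * (h₀ ^ (-(2 * s)) * M.size ^ (2 * s)) := by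
          gcongr
          exact hone _ (by positivity)
        _ = n * h₀ ^ (-(2 * s)) * M.size ^ (2 * s) := by ring
        _ ≤ _ := by
          gcongr
          have : 0 ≤ n * (2 * C * N + A) := by positivity
          linarith [hterm.1]

set_option maxHeartbeats 800000 in
/-- The error of the `L²` projection onto the finite element space; the gradient is estimated with
the inverse inequality. -/
theorem exists_projection_error (hΩ : IsBoundedLipschitzDomain Ω) {s : ℝ} (hs : 0 < s) {k : ℕ}
    (hsk : ⌈s⌉₊ ≤ k) (shape : CellShape) (κ : ℝ) :
    ∃ C : ℝ, 0 < C ∧ ∀ M : Mesh Ω shape, M.IsRegular κ → 0 < κ → 0 < M.size →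
      ∀ v : H1 Ω, ∀ p ∈ M.feSpace k, (∀ z ∈ M.feSpace k, ⟪toL2 Ω (v - p), toL2 Ω z⟫_ℝ = 0) →
        ‖toL2 Ω (v - p)‖ₑ ^ 2
          ≤ ENNReal.ofReal (C * M.size ^ (2 * (1 + s))) * sobolevSq Ω (1 + s) (toL2 Ω v) ∧
        ‖grad Ω (v - p)‖ₑ ^ 2
          ≤ ENNReal.ofReal (C * M.size ^ (2 * s)) * sobolevSq Ω (1 + s) (toL2 Ω v) := by
  have hk : 0 < k := (Nat.ceil_pos.2 hs).trans_le hsk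
  obtain ⟨C, hC, happ⟩ := exists_approx hΩ hs hsk shape κ
  obtain ⟨C₁, hC₁⟩ := IsRegular.exists_inverse_inequality n k shape hk κ
  refine ⟨2 * C + 2 * (C₁ * C), by positivity, ?_⟩
  intro M hM hκ hh v p hp horth
  have hpyth : ∀ vh ∈ M.feSpace k, ‖toL2 Ω (v - p)‖ₑ ≤ ‖toL2 Ω (v - vh)‖ₑ ∧
      ‖toL2 Ω (p - vh)‖ₑ ≤ ‖toL2 Ω (v - vh)‖ₑ := by
    intro vh hvh
    have h1 : toL2 Ω (v - vh) = toL2 Ω (v - p) + toL2 Ω (p - vh) := by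
      rw [← map_add, sub_add_sub_cancel]
    have h2 := norm_add_sq_eq_norm_sq_add_norm_sq_real
      (horth (p - vh) (Submodule.sub_mem _ hp hvh))
    rw [← h1] at h2
    have h3 : ‖toL2 Ω (v - p)‖ ≤ ‖toL2 Ω (v - vh)‖ := (mul_self_le_mul_self_iff (norm_nonneg _)
      (norm_nonneg _)).2 (h2 ▸ le_add_of_nonneg_right (mul_self_nonneg _))
    have h4 : ‖toL2 Ω (p - vh)‖ ≤ ‖toL2 Ω (v - vh)‖ := (mul_self_le_mul_self_iff (norm_nonneg _)
      (norm_nonneg _)).2 (h2 ▸ le_add_of_nonneg_left (mul_self_nonneg _))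
    simp only [← ofReal_norm]
    exact ⟨ENNReal.ofReal_le_ofReal h3, ENNReal.ofReal_le_ofReal h4⟩
  constructor
  · refine le_mul_sobolevSq (by positivity) fun D hD => ?_
    obtain ⟨vh, hvh, h1, -⟩ := happ M hM hκ hh v D hD
    calc ‖toL2 Ω (v - p)‖ₑ ^ 2 ≤ ‖toL2 Ω (v - vh)‖ₑ ^ 2 := by gcongr; exact (hpyth vh hvh).1
      _ ≤ _ := h1
      _ ≤ _ := by
        gcongr
        have : 0 ≤ C₁ * C := by positivity
        linarith
  · refine le_mul_sobolevSq (by positivity) fun D hD => ?_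
    obtain ⟨vh, hvh, h1, h2⟩ := happ M hM hκ hh v D hD
    have h3 : grad Ω (v - p) = grad Ω (v - vh) + grad Ω (vh - p) := by
      rw [← map_add, sub_add_sub_cancel]
    have h4 := hC₁ Ω M hM hκ hh hΩ.volume_frontier hΩ.isOpen hΩ.isBounded (vh - p)
      (Submodule.sub_mem _ hvh hp)
    have h5 : ‖toL2 Ω (vh - p)‖ₑ ≤ ‖toL2 Ω (v - vh)‖ₑ := by
      rw [← neg_sub p vh, map_neg, enorm_neg]
      exact (hpyth vh hvh).2
    have hpow : M.size ^ (2 * (1 + s)) = M.size ^ 2 * M.size ^ (2 * s) := by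
      rw [mul_add, mul_one, Real.rpow_add hh, Real.rpow_two]
    rw [h3]
    calc _ ≤ 2 * ‖grad Ω (v - vh)‖ₑ ^ 2 + 2 * ‖grad Ω (vh - p)‖ₑ ^ 2 := enorm_add_sq_le _ _
      _ ≤ 2 * (ENNReal.ofReal (C * M.size ^ (2 * s)) * sobolevExpr Ω (1 + s) D)
          + 2 * (ENNReal.ofReal (C₁ / M.size ^ 2) * (ENNReal.ofReal (C * M.size ^ (2 * (1 + s)))
            * sobolevExpr Ω (1 + s) D)) := by
          gcongr
          exact h4.trans (by gcongr; exact (pow_le_pow_left' h5 2).trans h1)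
      _ = _ := by
          rw [← mul_assoc, ← mul_assoc, ← mul_assoc, ← add_mul]
          congr 1
          rw [show (2 : ℝ≥0∞) = ENNReal.ofReal 2 by simp, ← ENNReal.ofReal_mul (by positivity),
            ← ENNReal.ofReal_mul (by positivity), ← ENNReal.ofReal_mul (by positivity),
            ← ENNReal.ofReal_add (by positivity) (by positivity), hpow]
          congr 1
          field_simp

end Mesh

end Nudging

namespace Nudging

open scoped Topology
open Filter

/-! ### The bilinear form -/

theorem IsConductivity.exists_bound {n : ℕ} {Ω : Set (Eu n)} {A : Eu n → Eu n →L[ℝ] Eu n}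
    (hA : IsConductivity Ω A) (hΩ : Bornology.IsBounded Ω) :
    ∃ Λ : ℝ, 0 < Λ ∧ ∀ x ∈ Ω, ‖A x‖ ≤ Λ := by
  rcases Ω.eq_empty_or_nonempty with rfl | ⟨x₀, hx₀⟩
  · exact ⟨1, one_pos, by simp⟩
  obtain ⟨K, hK⟩ := hA.lipschitz
  refine ⟨‖A x₀‖ + K * Metric.diam Ω + 1, by positivity, fun x hx => ?_⟩
  have h1 := hK.dist_le_mul x hx x₀ hx₀
  have h2 := mul_le_mul_of_nonneg_left (Metric.dist_le_diam_of_mem hΩ hx hx₀) K.coe_nonneg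
  have h3 := norm_add_le (A x - A x₀) (A x₀)
  rw [sub_add_cancel] at h3
  rw [dist_eq_norm] at h1
  linarith

section aForm

variable {n : ℕ} {Ω : Set (Eu n)} {A : Eu n → Eu n →L[ℝ] Eu n}

theorem IsConductivity.integrable (hA : IsConductivity Ω A) (hΩo : IsOpen Ω)
    (hΩ : Bornology.IsBounded Ω) (u v : H1 Ω) :
    Integrable (fun x => ⟪A x (grad Ω u x), grad Ω v x⟫_ℝ) (volume.restrict Ω) := by
  obtain ⟨Λ, -, hΛ⟩ := hA.exists_bound hΩ
  obtain ⟨K, hK⟩ := hA.lipschitz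
  have hm : AEStronglyMeasurable A (volume.restrict Ω) :=
    hK.continuousOn.aestronglyMeasurable hΩo.measurableSet
  have h1 : MemLp (fun x => A x (grad Ω u x)) 2 (volume.restrict Ω) := by
    refine MemLp.of_le_mul (c := Λ) (Lp.memLp (grad Ω u))
      ((ContinuousLinearMap.id ℝ (Eu n →L[ℝ] Eu n)).aestronglyMeasurable_comp₂ hm
        (Lp.memLp (grad Ω u)).1) ?_
    filter_upwards [ae_restrict_mem hΩo.measurableSet] with x hx
    exact (A x).le_of_opNorm_le (hΛ x hx) _
  refine (L2.integrable_inner (𝕜 := ℝ) (h1.toLp _) (grad Ω v)).congr ?_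
  filter_upwards [h1.coeFn_toLp] with x hx
  rw [hx]

theorem IsConductivity.aForm_symm (hA : IsConductivity Ω A) (hΩo : IsOpen Ω) (u v : H1 Ω) :
    aForm Ω A u v = aForm Ω A v u :=
  setIntegral_congr_fun hΩo.measurableSet fun x hx => by
    rw [hA.symm x hx, real_inner_comm]

theorem IsConductivity.aForm_sub_left (hA : IsConductivity Ω A) (hΩo : IsOpen Ω)
    (hΩ : Bornology.IsBounded Ω) (u v w : H1 Ω) :
    aForm Ω A (u - v) w = aForm Ω A u w - aForm Ω A v w := by
  have h1 := integral_sub (hA.integrable hΩo hΩ u w) (hA.integrable hΩo hΩ v w)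
  have h2 : grad Ω (u - v) = grad Ω u - grad Ω v := map_sub _ _ _
  refine Eq.trans (integral_congr_ae ?_) h1
  filter_upwards [Lp.coeFn_sub (grad Ω u) (grad Ω v)] with x hx
  rw [h2, hx, Pi.sub_apply, map_sub, inner_sub_left]

theorem IsConductivity.aForm_self_nonneg (hA : IsConductivity Ω A) (hΩo : IsOpen Ω) (u : H1 Ω) :
    0 ≤ aForm Ω A u u := by
  obtain ⟨α, hα, h⟩ := hA.elliptic
  exact setIntegral_nonneg hΩo.measurableSet fun x hx =>
    (by positivity : 0 ≤ α * ‖grad Ω u x‖ ^ 2).trans (h x hx _)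

theorem aForm_self_le {Λ : ℝ} (hΛ : ∀ x ∈ Ω, ‖A x‖ ≤ Λ) (hA : IsConductivity Ω A)
    (hΩo : IsOpen Ω) (hΩ : Bornology.IsBounded Ω) (u : H1 Ω) :
    aForm Ω A u u ≤ Λ * ‖grad Ω u‖ ^ 2 := by
  have h1 : ‖grad Ω u‖ ^ 2 = ∫ x in Ω, ⟪grad Ω u x, grad Ω u x⟫_ℝ := by
    rw [← real_inner_self_eq_norm_sq, L2.inner_def]
  rw [h1, ← integral_const_mul]
  refine setIntegral_mono_on (hA.integrable hΩo hΩ u u)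
    ((L2.integrable_inner (𝕜 := ℝ) (grad Ω u) (grad Ω u)).const_mul Λ) hΩo.measurableSet
    fun x hx => ?_
  calc ⟪A x (grad Ω u x), grad Ω u x⟫_ℝ ≤ ‖A x (grad Ω u x)‖ * ‖grad Ω u x‖ :=
        real_inner_le_norm _ _
    _ ≤ Λ * ‖grad Ω u x‖ * ‖grad Ω u x‖ := by
        gcongr
        exact (A x).le_of_opNorm_le (hΛ x hx) _
    _ = _ := by rw [real_inner_self_eq_norm_sq]; ring

end aForm

end Nudging

namespace Nudging

open scoped Topology
open Filter

/-! ### The energy argument -/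

theorem integral_mul_primitive {φ : ℝ → ℝ} {t : ℝ} (hφ : IntervalIntegrable φ volume 0 t) :
    IntervalIntegrable (fun τ => φ τ * ∫ σ in (0 : ℝ)..τ, φ σ) volume 0 t ∧
      ∫ τ in (0 : ℝ)..t, φ τ * ∫ σ in (0 : ℝ)..τ, φ σ = (∫ σ in (0 : ℝ)..t, φ σ) ^ 2 / 2 := by
  have hac := hφ.absolutelyContinuousOnInterval_intervalIntegral (c := 0) (by simp)
  refine ⟨hφ.mul_continuousOn hac.continuousOn, ?_⟩
  have h1 := hac.integral_deriv_mul_eq_sub hac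
  have h2 : ∫ τ in (0 : ℝ)..t, (deriv (fun τ => ∫ σ in (0 : ℝ)..τ, φ σ) τ * ∫ σ in (0 : ℝ)..τ, φ σ)
        + (∫ σ in (0 : ℝ)..τ, φ σ) * deriv (fun τ => ∫ σ in (0 : ℝ)..τ, φ σ) τ
      = ∫ τ in (0 : ℝ)..t, 2 * (φ τ * ∫ σ in (0 : ℝ)..τ, φ σ) := by
    refine intervalIntegral.integral_congr_ae ?_
    filter_upwards [hφ.ae_hasDerivAt_integral] with τ hτ hmem
    rw [(hτ (uIoc_subset_uIcc hmem) 0 (by simp)).deriv]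
    ring
  rw [h2, intervalIntegral.integral_const_mul] at h1
  simp only [intervalIntegral.integral_same] at h1
  linarith

/-- If `X ≤ ψ + B` where `ψ` is integrable with nonpositive integral, then `∫ X ≤ ∫ B`. The
inequality is stated without subtraction, and no measurability of `X` and `B` is needed. -/
theorem lintegral_le_of_integral_nonpos {α : Type*} [MeasurableSpace α] {m : Measure α}
    {ψ : α → ℝ} (hψ : Integrable ψ m) (hψ0 : ∫ x, ψ x ∂m ≤ 0) {X B : α → ℝ≥0∞}
    (h : ∀ᵐ x ∂m, X x + ENNReal.ofReal (-ψ x) ≤ ENNReal.ofReal (ψ x) + B x) :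
    ∫⁻ x, X x ∂m ≤ ∫⁻ x, B x ∂m := by
  have hn : Integrable (fun x => -ψ x) m := hψ.neg
  have h1 := lintegral_mono_ae h
  rw [lintegral_add_right' _ hn.1.aemeasurable.ennreal_ofReal,
    lintegral_add_left' hψ.1.aemeasurable.ennreal_ofReal] at h1
  have hf : ∀ {χ : α → ℝ}, Integrable χ m → ∫⁻ x, ENNReal.ofReal (χ x) ∂m ≠ ⊤ := fun hχ =>
    (hχ.lintegral_lt_top).ne
  have h2 : ∫⁻ x, ENNReal.ofReal (ψ x) ∂m ≤ ∫⁻ x, ENNReal.ofReal (-ψ x) ∂m := by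
    rw [integral_eq_lintegral_pos_part_sub_lintegral_neg_part hψ, sub_nonpos] at hψ0
    exact (ENNReal.toReal_le_toReal (hf hψ) (hf hn)).1 hψ0
  have h3 : ∫⁻ x, X x ∂m + ∫⁻ x, ENNReal.ofReal (-ψ x) ∂m
      ≤ ∫⁻ x, B x ∂m + ∫⁻ x, ENNReal.ofReal (-ψ x) ∂m :=
    h1.trans (by rw [add_comm]; gcongr)
  exact (ENNReal.add_le_add_iff_right (hf hn)).1 h3

/-- A basis, orthonormal in a weaker inner product, of a finite-dimensional subspace. -/
theorem exists_orthonormal_map {E F : Type*} [NormedAddCommGroup E] [NormedSpace ℝ E]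
    [NormedAddCommGroup F] [InnerProductSpace ℝ F] (J : E →L[ℝ] F) (V : Submodule ℝ E)
    [FiniteDimensional ℝ V] :
    ∃ (N : ℕ) (b : Fin N → E), (∀ i, b i ∈ V) ∧ Orthonormal ℝ (fun i => J (b i)) ∧
      ∀ z ∈ V, J z ∈ Submodule.span ℝ (range fun i => J (b i)) := by
  obtain ⟨W, hW⟩ : ∃ W : Submodule ℝ F, W = V.map (J : E →ₗ[ℝ] F) := ⟨_, rfl⟩
  have hfin : FiniteDimensional ℝ W := hW ▸ inferInstance
  obtain ⟨N, o, -⟩ : ∃ (N : ℕ) (_ : OrthonormalBasis (Fin N) ℝ W), True :=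
    ⟨_, stdOrthonormalBasis ℝ W, trivial⟩
  have hmem : ∀ i, ∃ y ∈ V, J y = o i := fun i => by
    have h1 : ((o i : W) : F) ∈ V.map (J : E →ₗ[ℝ] F) := hW ▸ (o i).2
    exact Submodule.mem_map.1 h1
  choose b hbV hb using hmem
  have hb' : (fun i => J (b i)) = fun i => ((o i : W) : F) := funext hb
  refine ⟨N, b, hbV, ?_, fun z hz => ?_⟩
  · rw [hb']
    exact o.orthonormal.comp_linearIsometry W.subtypeₗᵢ
  · have hz' : J z ∈ W := hW ▸ Submodule.mem_map_of_mem hz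
    have h2 := congrArg Subtype.val (o.sum_repr ⟨J z, hz'⟩)
    simp only [Submodule.coe_sum, Submodule.coe_smul] at h2
    rw [← h2]
    exact Submodule.sum_mem _ fun i _ =>
      Submodule.smul_mem _ _ (Submodule.subset_span ⟨i, hb i⟩)

theorem intervalIntegrable_of_memLp {E : Type*} [NormedAddCommGroup E] {φ : ℝ → E} {T t : ℝ}
    (h : MemLp φ 2 (timeMeasure T)) (ht : t ∈ Icc 0 T) : IntervalIntegrable φ volume 0 t := by
  have hfin : IsFiniteMeasure (timeMeasure T) :=
    ⟨by rw [Measure.restrict_apply_univ]; exact measure_Ioo_lt_top⟩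
  have h1 : IntegrableOn φ (Ioo 0 T) volume := h.integrable (by norm_num)
  rw [intervalIntegrable_iff_integrableOn_Ioo_of_le ht.1]
  exact h1.mono_set (Ioo_subset_Ioo_right ht.2)

section Galerkin

variable {E F : Type*} [NormedAddCommGroup E] [NormedSpace ℝ E]
  [NormedAddCommGroup F] [InnerProductSpace ℝ F]

/-- Subtracting the weak forms of the two initial value problems: for fixed `b`, the number
`⟪J (u_h - u), J b⟫` is a primitive of an integrable function and vanishes at time `0`. -/
theorem exists_coordinate {J : E →L[ℝ] F} [CompleteSpace F] {T : ℝ}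
    {u uh duh : ℝ → E} {du : ℝ → StrongDual ℝ E}
    (hdu : MemLp du 2 (timeMeasure T))
    (hu : ∀ᵐ τ ∂(timeMeasure T), (innerSL ℝ (J (u τ))).comp J = ∫ σ in (0 : ℝ)..τ, du σ)
    (hduh : MemLp duh 2 (timeMeasure T))
    (huh : ∀ τ ∈ Icc 0 T, J (uh τ) = ∫ σ in (0 : ℝ)..τ, J (duh σ)) (b : E) :
    (∀ τ ∈ Icc 0 T, IntervalIntegrable (fun τ => ⟪J (duh τ), J b⟫_ℝ - du τ b) volume 0 τ) ∧
      ∀ᵐ τ ∂(timeMeasure T),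
        ∫ σ in (0 : ℝ)..τ, (⟪J (duh σ), J b⟫_ℝ - du σ b) = ⟪J (uh τ - u τ), J b⟫_ℝ := by
  have hint0 : ∀ τ ∈ Icc 0 T, IntervalIntegrable (fun τ => J (duh τ)) volume 0 τ :=
    fun τ hτ => by
      have h1 := intervalIntegrable_of_memLp hduh hτ
      rw [intervalIntegrable_iff] at h1 ⊢
      exact J.integrable_comp h1
  have hint1 : ∀ τ ∈ Icc 0 T,
      IntervalIntegrable (fun τ => ⟪J (duh τ), J b⟫_ℝ) volume 0 τ := fun τ hτ => by
    have h1 := hint0 τ hτ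
    rw [intervalIntegrable_iff] at h1 ⊢
    refine ((innerSL ℝ (J b)).integrable_comp h1).congr (.of_forall fun σ => ?_)
    exact real_inner_comm _ _
  have hint2 : ∀ τ ∈ Icc 0 T, IntervalIntegrable (fun τ => du τ b) volume 0 τ :=
    fun τ hτ => by
      have h1 := intervalIntegrable_of_memLp hdu hτ
      rw [intervalIntegrable_iff] at h1 ⊢
      exact (ContinuousLinearMap.apply ℝ ℝ b).integrable_comp h1
  refine ⟨fun τ hτ => (hint1 τ hτ).sub (hint2 τ hτ), ?_⟩
  filter_upwards [hu, ae_restrict_mem measurableSet_Ioo] with τ hτ hmem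
  have hτT := Ioo_subset_Icc_self hmem
  rw [intervalIntegral.integral_sub (hint1 τ hτT) (hint2 τ hτT), map_sub, inner_sub_left]
  congr 1
  · rw [huh τ hτT, real_inner_comm]
    refine Eq.trans ?_ ((innerSL ℝ (J b)).intervalIntegral_comp_comm (hint0 τ hτT))
    exact intervalIntegral.integral_congr fun σ _ => real_inner_comm _ _
  · have h3 := DFunLike.congr_fun hτ b
    rw [← ContinuousLinearMap.intervalIntegral_apply
      (intervalIntegrable_of_memLp hdu hτT) b]
    exact h3.symm

/-- The error of a Galerkin scheme for `u' + 𝔟(u, ·) = ℓ`, `u(0) = 0`, is bounded, in the energy norm,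
by the error of the projection that is orthogonal in the pivot space. With `θ` the difference of `u_h` and the projection of `u`, and `c_i` the coordinates of `θ` in an
orthonormal basis, both equations give `∑ c_i' c_i = -𝔟(u_h - u, θ)`. -/
theorem lintegral_galerkin_error_le [CompleteSpace F] {J : E →L[ℝ] F} {T : ℝ}
    {𝔟 : E → E → ℝ} (hsymm : ∀ v w, 𝔟 v w = 𝔟 w v)
    (hsub : ∀ v w z, 𝔟 (v - w) z = 𝔟 v z - 𝔟 w z) (hnn : ∀ v, 0 ≤ 𝔟 v v)
    {V : Submodule ℝ E} [FiniteDimensional ℝ V] {ℓ : ℝ → E → ℝ}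
    {u uh duh : ℝ → E} {du : ℝ → StrongDual ℝ E}
    (hdu : MemLp du 2 (timeMeasure T))
    (hu : ∀ᵐ τ ∂(timeMeasure T), (innerSL ℝ (J (u τ))).comp J = ∫ σ in (0 : ℝ)..τ, du σ)
    (hueq : ∀ᵐ τ ∂(timeMeasure T), ∀ v, du τ v + 𝔟 (u τ) v = ℓ τ v)
    (huhV : ∀ τ ∈ Icc 0 T, uh τ ∈ V) (hduh : MemLp duh 2 (timeMeasure T))
    (huh : ∀ τ ∈ Icc 0 T, J (uh τ) = ∫ σ in (0 : ℝ)..τ, J (duh σ))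
    (huheq : ∀ᵐ τ ∂(timeMeasure T), ∀ v ∈ V, ⟪J (duh τ), J v⟫_ℝ + 𝔟 (uh τ) v = ℓ τ v)
    {B : E → ℝ≥0∞}
    (hB : ∀ v : E, ∀ p ∈ V, (∀ z ∈ V, ⟪J (v - p), J z⟫_ℝ = 0) →
      ENNReal.ofReal (𝔟 (v - p) (v - p)) ≤ B v)
    {t : ℝ} (ht : t ∈ Icc 0 T) :
    (∫⁻ τ in Ioo 0 t, ENNReal.ofReal (𝔟 (uh τ - u τ) (uh τ - u τ)))
      ≤ ∫⁻ τ in Ioo 0 t, B (u τ) := by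
  obtain ⟨N, b, hbV, hbo, hbspan⟩ := exists_orthonormal_map J V
  have hcoord := fun i => exists_coordinate hdu hu hduh huh (b i)
  -- the derivatives of the coordinates of `θ`, and the coordinates
  obtain ⟨φ, hφdef⟩ : ∃ φ : Fin N → ℝ → ℝ, φ = fun i τ => ⟪J (duh τ), J (b i)⟫_ℝ - du τ (b i) :=
    ⟨_, rfl⟩
  obtain ⟨c, hcdef⟩ : ∃ c : Fin N → ℝ → ℝ, c = fun i τ => ∫ σ in (0 : ℝ)..τ, φ i σ := ⟨_, rfl⟩
  have hle : volume.restrict (Ioo 0 t) ≤ timeMeasure T :=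
    Measure.restrict_mono (Ioo_subset_Ioo_right ht.2) le_rfl
  have hc : ∀ᵐ τ ∂(volume.restrict (Ioo 0 t)), ∀ i, c i τ = ⟪J (uh τ - u τ), J (b i)⟫_ℝ := by
    rw [ae_all_iff]
    intro i
    filter_upwards [(hcoord i).2.filter_mono (ae_mono hle)] with τ hτ
    rw [hcdef, hφdef]
    exact hτ
  have hprim : ∀ i, IntervalIntegrable (fun τ => φ i τ * c i τ) volume 0 t ∧
      ∫ τ in (0 : ℝ)..t, φ i τ * c i τ = (∫ σ in (0 : ℝ)..t, φ i σ) ^ 2 / 2 := fun i => by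
    rw [hcdef]
    refine integral_mul_primitive ?_
    rw [hφdef]
    exact (hcoord i).1 t ht
  have hψI : ∀ i, Integrable (fun τ => φ i τ * c i τ) (volume.restrict (Ioo 0 t)) := fun i =>
    (intervalIntegrable_iff_integrableOn_Ioo_of_le ht.1).1 (hprim i).1
  have hψ : Integrable (fun τ => -2 * ∑ i, φ i τ * c i τ) (volume.restrict (Ioo 0 t)) :=
    (integrable_finsetSum _ fun i _ => hψI i).const_mul _
  have hψ0 : ∫ τ in Ioo 0 t, -2 * ∑ i, φ i τ * c i τ ≤ 0 := by
    rw [integral_const_mul, integral_finsetSum _ fun i _ => hψI i]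
    have : 0 ≤ ∑ i, ∫ τ in Ioo 0 t, φ i τ * c i τ := by
      refine Finset.sum_nonneg fun i _ => ?_
      rw [← integral_Ioc_eq_integral_Ioo, ← intervalIntegral.integral_of_le ht.1, (hprim i).2]
      positivity
    linarith
  refine lintegral_le_of_integral_nonpos hψ hψ0 ?_
  filter_upwards [hc, hueq.filter_mono (ae_mono hle), huheq.filter_mono (ae_mono hle),
    ae_restrict_mem measurableSet_Ioo] with τ hcτ hu hh hmem
  obtain ⟨e, he⟩ : ∃ e, e = uh τ - u τ := ⟨_, rfl⟩
  obtain ⟨θ, hθ⟩ : ∃ θ : E, θ = ∑ i, c i τ • b i := ⟨_, rfl⟩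
  rw [← he] at hcτ ⊢
  have hθV : θ ∈ V := by
    rw [hθ]
    exact Submodule.sum_mem _ fun i _ => Submodule.smul_mem _ _ (hbV i)
  have huhτ : uh τ ∈ V := huhV τ ⟨hmem.1.le, hmem.2.le.trans ht.2⟩
  have hsum : ∑ i, φ i τ * c i τ = -𝔟 e θ := by
    have h1 : ⟪J (duh τ), J θ⟫_ℝ - du τ θ = ∑ i, φ i τ * c i τ := by
      rw [hθ, map_sum, map_sum, inner_sum, ← Finset.sum_sub_distrib]
      refine Finset.sum_congr rfl fun i _ => ?_
      rw [map_smul, map_smul, inner_smul_right, smul_eq_mul, hφdef]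
      ring
    have h2 := hh θ hθV
    have h3 := hu θ
    rw [← h1, he, hsub]
    linarith
  -- `θ - e` is the error of the projection of `u`
  have hp : u τ - (uh τ - θ) = θ - e := by rw [he]; abel
  have hρ := hB (u τ) (uh τ - θ) (Submodule.sub_mem _ huhτ hθV) fun z hz => by
    rw [hp]
    refine Submodule.span_induction (p := fun y _ => ⟪J (θ - e), y⟫_ℝ = 0) ?_ (by simp) ?_ ?_
      (hbspan z hz)
    · rintro _ ⟨i, rfl⟩
      have h1 : J θ = ∑ j, c j τ • J (b j) := by rw [hθ, map_sum]; simp only [map_smul]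
      have h2 := hbo.inner_left_fintype (fun i => c i τ) i
      simp only [conj_trivial] at h2
      rw [map_sub, inner_sub_left, ← hcτ i, h1, h2, sub_self]
    · intro x y _ _ hx hy
      rw [inner_add_right, hx, hy, add_zero]
    · intro a x _ hx
      rw [inner_smul_right, hx, mul_zero]
  rw [hp] at hρ
  have hexp : 𝔟 (θ - e) (θ - e) = 𝔟 θ θ - 2 * 𝔟 e θ + 𝔟 e e := by
    rw [hsub, hsymm θ (θ - e), hsymm e (θ - e), hsub, hsub, hsymm θ e]
    ring
  have hee := hnn e
  have hθθ := hnn θ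
  have hρρ := hnn (θ - e)
  refine le_trans ?_ (add_le_add_right hρ _)
  rw [hsum]
  rcases le_total 0 (𝔟 e θ) with h0 | h0
  · rw [ENNReal.ofReal_of_nonpos (p := -(-2 * -𝔟 e θ)) (by linarith), add_zero,
      ← ENNReal.ofReal_add (by linarith) hρρ]
    exact ENNReal.ofReal_le_ofReal (by linarith)
  · rw [ENNReal.ofReal_of_nonpos (p := -2 * -𝔟 e θ) (by linarith), zero_add,
      ← ENNReal.ofReal_add hee (by linarith)]
    exact ENNReal.ofReal_le_ofReal (by linarith)

end Galerkin

set_option maxHeartbeats 1600000 in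
/-- The error of the scheme is bounded by the error of the `L²` projection of the nudged solution, in
the energy norm of `a(v, w) + μ (L v, L w)_Y`. The exact data `ν_H` enter both equations in the same
way and cancel. -/
theorem lintegral_error_le {n : ℕ} {Ω : Set (Eu n)} (hΩo : IsOpen Ω) (hΩ : Bornology.IsBounded Ω)
    {A : Eu n → Eu n →L[ℝ] Eu n} (hA : IsConductivity Ω A) {T μ : ℝ} (hμ : 0 ≤ μ)
    {f : ℝ → HNeg1 Ω} {g : ℝ → HNegHalfBdry Ω}
    {Y : Type*} [NormedAddCommGroup Y] [InnerProductSpace ℝ Y] {L : H1 Ω →L[ℝ] Y} {νH : ℝ → Y}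
    {V : Submodule ℝ (H1 Ω)} [FiniteDimensional ℝ V] {u uh : ℝ → H1 Ω}
    (hu : SolvesNudged Ω A T f g L μ νH u) (huh : SolvesSemiDiscrete Ω A T f g L μ νH V uh)
    {B : H1 Ω → ℝ≥0∞}
    (hB : ∀ v : H1 Ω, ∀ p ∈ V, (∀ z ∈ V, ⟪toL2 Ω (v - p), toL2 Ω z⟫_ℝ = 0) →
      ENNReal.ofReal (aForm Ω A (v - p) (v - p) + μ * ‖L (v - p)‖ ^ 2) ≤ B v)
    {t : ℝ} (ht : t ∈ Icc 0 T) :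
    (∫⁻ τ in Ioo 0 t, ENNReal.ofReal (aForm Ω A (uh τ - u τ) (uh τ - u τ)))
        + ENNReal.ofReal μ * ∫⁻ τ in Ioo 0 t, ‖L (uh τ - u τ)‖ₑ ^ 2
      ≤ ∫⁻ τ in Ioo 0 t, B (u τ) := by
  obtain ⟨du, htraj, hueq⟩ := hu
  obtain ⟨huhV, duh, -, hduh, huhint, huheq⟩ := huh
  have hX : ∀ v : H1 Ω, ENNReal.ofReal (aForm Ω A v v) + ENNReal.ofReal μ * ‖L v‖ₑ ^ 2
      = ENNReal.ofReal (aForm Ω A v v + μ * ⟪L v, L v⟫_ℝ) := fun v => by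
    rw [real_inner_self_eq_norm_sq, ENNReal.ofReal_add (hA.aForm_self_nonneg hΩo v)
      (by positivity), ENNReal.ofReal_mul hμ, ENNReal.ofReal_pow (norm_nonneg _), ofReal_norm]
  rw [← lintegral_const_mul' _ _ ENNReal.ofReal_ne_top]
  refine (le_lintegral_add _ _).trans ?_
  simp only [hX]
  refine lintegral_galerkin_error_le (J := toL2 Ω)
    (𝔟 := fun v w => aForm Ω A v w + μ * ⟪L v, L w⟫_ℝ)
    (ℓ := fun τ v => f τ v + (g τ : HNeg1 Ω) v + μ * ⟪νH τ, L v⟫_ℝ)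
    (fun v w => by rw [hA.aForm_symm hΩo, real_inner_comm])
    (fun v w z => by rw [hA.aForm_sub_left hΩo hΩ, map_sub, inner_sub_left]; ring)
    (fun v => ?_) htraj.memLp_deriv ?_ ?_ huhV hduh huhint ?_ (fun v p hp h => ?_) ht
  · have h1 := hA.aForm_self_nonneg hΩo v
    have h2 : 0 ≤ ⟪L v, L v⟫_ℝ := real_inner_self_nonneg
    positivity
  · filter_upwards [htraj.eq_integral] with τ hτ
    have h0 : pivot Ω 0 = 0 := by rw [pivot, map_zero, ContinuousLinearMap.zero_comp]
    rw [h0, zero_add] at hτ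
    exact hτ
  · filter_upwards [hueq] with τ hτ v
    rw [← hτ v, inner_sub_left]
    ring
  · filter_upwards [huheq] with τ hτ v hv
    rw [← hτ v hv, inner_sub_left]
    ring
  · rw [real_inner_self_eq_norm_sq]
    exact hB v p hp h

end Nudging

namespace Nudging

theorem ofReal_energy_le {Λ C_S C μ h s x y : ℝ} {S : ℝ≥0∞} (hΛ : 0 ≤ Λ) (hC_S : 0 ≤ C_S)
    (hC : 0 ≤ C) (hμ : 0 ≤ μ) (hh : 0 < h) (hx : 0 ≤ x) (hy : 0 ≤ y)
    (h1 : ENNReal.ofReal x ≤ ENNReal.ofReal (C * h ^ (2 * (1 + s))) * S)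
    (h2 : ENNReal.ofReal y ≤ ENNReal.ofReal (C * h ^ (2 * s)) * S) :
    ENNReal.ofReal (Λ * y + μ * (C_S * x))
      ≤ ENNReal.ofReal (C * (Λ + C_S) * h ^ (2 * s) * (1 + μ * h ^ 2)) * S := by
  have hpow : h ^ (2 * (1 + s)) = h ^ 2 * h ^ (2 * s) := by
    rw [mul_add, mul_one, Real.rpow_add hh, Real.rpow_two]
  rw [hpow] at h1
  have hsz : 0 < h ^ (2 * s) := Real.rpow_pos_of_pos hh _
  calc ENNReal.ofReal (Λ * y + μ * (C_S * x))
      = ENNReal.ofReal Λ * ENNReal.ofReal y + ENNReal.ofReal (μ * C_S) * ENNReal.ofReal x := by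
        rw [ENNReal.ofReal_add (by positivity) (by positivity), ENNReal.ofReal_mul hΛ,
          ← mul_assoc μ, ENNReal.ofReal_mul (by positivity)]
    _ ≤ ENNReal.ofReal Λ * (ENNReal.ofReal (C * h ^ (2 * s)) * S)
        + ENNReal.ofReal (μ * C_S) * (ENNReal.ofReal (C * (h ^ 2 * h ^ (2 * s))) * S) := by
        gcongr
    _ = ENNReal.ofReal (Λ * (C * h ^ (2 * s))
        + μ * C_S * (C * (h ^ 2 * h ^ (2 * s)))) * S := by
        rw [ENNReal.ofReal_add (by positivity) (by positivity), ENNReal.ofReal_mul hΛ,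
          ENNReal.ofReal_mul (by positivity : 0 ≤ μ * C_S)]
        ring
    _ ≤ ENNReal.ofReal (C * (Λ + C_S) * h ^ (2 * s) * (1 + μ * h ^ 2)) * S := by
        gcongr
        have h3 : 0 ≤ C * h ^ (2 * s) * C_S := by positivity
        have h4 : 0 ≤ C * h ^ (2 * s) * (Λ * (μ * h ^ 2)) := by positivity
        linarith

/-- The error of the `L²` projection in the energy norm. The weight `μ h²` comes from the extra
power of `h` in the `L²` error. -/
theorem Mesh.exists_energy_projection_error {n : ℕ} {Ω : Set (Eu n)}
    (hΩ : IsBoundedLipschitzDomain Ω) {A : Eu n → Eu n →L[ℝ] Eu n} (hA : IsConductivity Ω A)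
    {s : ℝ} (hs : 0 < s) {k : ℕ} (hsk : s ≤ k) (shape : CellShape) (κ : ℝ) {C_S : ℝ}
    (hC_S : 0 < C_S) :
    ∃ C : ℝ, 0 < C ∧ ∀ M : Mesh Ω shape, M.IsRegular κ → 0 < κ → 0 < M.size →
      ∀ {Y : Type*} [NormedAddCommGroup Y] [InnerProductSpace ℝ Y] (L : H1 Ω →L[ℝ] Y),
      (∀ v : H1 Ω, ‖L v‖ ^ 2 ≤ C_S * ‖toL2 Ω v‖ ^ 2) → ∀ μ : ℝ, 0 < μ →
      ∀ v : H1 Ω, ∀ p ∈ M.feSpace k,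
      (∀ z ∈ M.feSpace k, ⟪toL2 Ω (v - p), toL2 Ω z⟫_ℝ = 0) →
        ENNReal.ofReal (aForm Ω A (v - p) (v - p) + μ * ‖L (v - p)‖ ^ 2)
          ≤ ENNReal.ofReal (C * M.size ^ (2 * s) * (1 + μ * M.size ^ 2))
            * sobolevSq Ω (1 + s) (toL2 Ω v) := by
  have hΩo := hΩ.isOpen
  obtain ⟨Λ, hΛ0, hΛ⟩ := hA.exists_bound hΩ.isBounded
  obtain ⟨C, hC, hproj⟩ := Mesh.exists_projection_error hΩ hs (Nat.ceil_le.2 hsk) shape κ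
  refine ⟨C * (Λ + C_S), by positivity, ?_⟩
  intro M hM hκ hh Y _ _ L hL μ hμ v p hp hvp
  obtain ⟨h1, h2⟩ := hproj M hM hκ hh v p hp hvp
  refine (ENNReal.ofReal_le_ofReal (add_le_add (aForm_self_le hΛ hA hΩo hΩ.isBounded (v - p))
    (mul_le_mul_of_nonneg_left (hL (v - p)) hμ.le))).trans ?_
  rw [← ofReal_norm, ← ENNReal.ofReal_pow (norm_nonneg _)] at h1 h2
  exact ofReal_energy_le hΛ0.le hC_S.le hC.le hμ.le hh (sq_nonneg _) (sq_nonneg _) h1 h2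

end Nudging
set_option maxHeartbeats 1000000 in
theorem lemma3p8 {n : ℕ} (hn : 1 ≤ n) (Ω : Set (Eu n)) (hΩ : IsBoundedLipschitzDomain Ω)
    (A : Eu n → Eu n →L[ℝ] Eu n) (hA : IsConductivity Ω A)
    (shape : CellShape) (k : ℕ) (s : ℝ) (hs : 0 < s) (hsk : s ≤ k)
    (κ C_S : ℝ) (hC_S : 0 < C_S) :
    ∃ C : ℝ, 0 < C ∧
      ∀ (M : Mesh Ω shape), M.IsRegular κ →
      ∀ (Y : Type*) [NormedAddCommGroup Y] [InnerProductSpace ℝ Y] [CompleteSpace Y]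
        (L : H1 Ω →L[ℝ] Y), (∀ v : H1 Ω, ‖L v‖ ^ 2 ≤ C_S * ‖toL2 Ω v‖ ^ 2) →
      ∀ (μ T : ℝ), 0 < μ → 0 < T →
      ∀ (f : ℝ → HNeg1 Ω) (g : ℝ → HNegHalfBdry Ω),
        MemLp f 2 (timeMeasure T) → MemLp g 2 (timeMeasure T) →
      ∀ (ν₀ : L2 Ω) (ν u uh : ℝ → H1 Ω),
        SolvesHeat Ω A T f g ν₀ ν →
        SolvesNudged Ω A T f g L μ (fun t => L (ν t)) u →
        SolvesSemiDiscrete Ω A T f g L μ (fun t => L (ν t)) (M.feSpace k) uh →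
        ∫⁻ t in Ioo 0 T, sobolevSq Ω (1 + s) (toL2 Ω (u t)) < ∞ →
      ∀ t ∈ Icc 0 T,
        (∫⁻ τ in Ioo 0 t, ENNReal.ofReal (aForm Ω A (uh τ - u τ) (uh τ - u τ)))
            + ENNReal.ofReal μ * ∫⁻ τ in Ioo 0 t, ‖L (uh τ - u τ)‖ₑ ^ 2
          ≤ ENNReal.ofReal (C * M.size ^ (2 * s) * (1 + μ * M.size ^ 2))
            * ∫⁻ τ in Ioo 0 t, sobolevSq Ω (1 + s) (toL2 Ω (u τ)) := by
  have hΩo := hΩ.isOpen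
  obtain ⟨C, hC, hproj⟩ := Mesh.exists_energy_projection_error hΩ hA hs hsk shape κ hC_S
  refine ⟨C, hC, ?_⟩
  intro M hM Y _ _ _ L hL μ T hμ _ f g _ _ ν₀ ν u uh _ hu huh _ t ht
  obtain ⟨hκ, hh⟩ := hM.pos hn hΩo hΩ.isConnected.nonempty
  have hfin := M.finiteDimensional_feSpace hΩo (k := k) (by exact_mod_cast hs.trans_le hsk)
  refine (lintegral_error_le hΩo hΩ.isBounded hA hμ.le hu huh
    (hproj M hM hκ hh L hL μ hμ) ht).trans_eq ?_
  exact lintegral_const_mul' _ _ ENNReal.ofReal_ne_top
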